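/- Let kPMF be the following problem: given a directed graph $G$ and an integer $k\ge 1$, output every pair of distinct nodes $u,v$ for which the maximum flow that can be shipped in $G$ from $u$ to $v$ is at most $k$, together with the value of this maximum flow. A graph is uncapacitated if every edge has capacity $1$. MAX-CNF-SAT asks for the maximum number of clauses of a given CNF formula that can be satisfied simultaneously. Algorithms are deterministic word-RAM programs; the words have $O(\log n)$ bits for $n$-node graphs, $O(n')$ bits for MAX-CNF-SAT on $n'$ variables, and $O(n'+\log m')$ bits for $k$-SAT on $n'$ variables and $m'$ clauses. SETH is the hypothesis that for every $\varepsilon'>0$ there is an integer $q\ge 3$ such that $q$-SAT on $n'$ variables and $m'$ clauses cannot be solved in time $2^{(1-\varepsilon')n'}\,\mathrm{poly}(m')$. Theorem. For every $\varepsilon>0$ there is $\delta=\delta(\varepsilon)>0$ such that the following holds for every $c\in[0,1]$. Suppose that kPMF in uncapacitated graphs with $n$ nodes, $k=\tilde O(n^c)$ and $m=O(kn)$ edges can be solved in time $O\big((n^2k)^{1-\varepsilon}\big)$, where for $k<n^c$ only the time $O\big((n^2n^c)^{1-\varepsilon}\big)$ is required; that is, for all constants $C,D$ there is an algorithm that solves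 kPMF on all inputs with $n\ge 1$, $1\le k\le C\,n^c(\lfloor\log_2 n\rfloor+1)^D$ and $m\le Ckn$ in time $O\big((n^2\max\{k,n^c\})^{1-\varepsilon}\big)$. Then for every constant $B$, MAX-CNF-SAT on $n'$ variables and at most $Bn'$ clauses can be solved in time $O\big(2^{(1-\delta)n'}\big)$, and in particular SETH is false. -/

import Mathlib

namespace FineGrained

/-! ### The machine: a word RAM with unit cost per instruction -/

/-- The binary word operations. `sub` is truncated at `0`, `lt` and `eq` return `0` or `1`,
division by `0` returns `0`. -/
inductive WordOp where
  | add | sub | mul | div | mod | land | lor | xor | shl | shr | lt | eq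

def WordOp.eval : WordOp → ℕ → ℕ → ℕ
  | .add, a, b => a + b
  | .sub, a, b => a - b
  | .mul, a, b => a * b
  | .div, a, b => a / b
  | .mod, a, b => a % b
  | .land, a, b => a &&& b
  | .lor, a, b => a ||| b
  | .xor, a, b => a ^^^ b
  | .shl, a, b => a <<< b
  | .shr, a, b => a >>> b
  | .lt, a, b => if a < b then 1 else 0
  | .eq, a, b => if a = b then 1 else 0

/-- Programs of the machine. A program has registers and memories (arrays); their names are fixed
numbers in the text of the program, so each program uses finitely many of them. Cells of a memory
are addressed through the content of a register. -/
inductive Program where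
  /-- do nothing -/
  | skip
  /-- `reg r := a` for a fixed number `a` -/
  | const (r a : ℕ)
  /-- `reg r := o (reg a) (reg b)` -/
  | op (o : WordOp) (r a b : ℕ)
  /-- `reg r := mem A (reg i)` -/
  | load (r A i : ℕ)
  /-- `mem A (reg i) := reg r` -/
  | store (A i r : ℕ)
  /-- one program after the other -/
  | seq (p q : Program)
  /-- run `p` if `reg r ≠ 0`, otherwise run `q` -/
  | ite (r : ℕ) (p q : Program)
  /-- repeat `p` as long as `reg r ≠ 0` -/
  | while (r : ℕ) (p : Program)

/-- The contents of all registers and of all memories. -/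
structure State where
  reg : ℕ → ℕ
  mem : ℕ → ℕ → ℕ

def State.setReg (s : State) (r v : ℕ) : State :=
  { s with reg := Function.update s.reg r v }

def State.setMem (s : State) (A i v : ℕ) : State :=
  { s with mem := Function.update s.mem A (Function.update (s.mem A) i v) }

/-- `Exec w p s t s'`: with words of `w` bits, the program `p` started in state `s` halts after
exactly `t` steps in state `s'`. Each instruction and each test costs one step. Every number that
is ever written has to fit into a word; if one does not, there is no execution. -/
inductive Exec (w : ℕ) : Program → State → ℕ → State → Prop
  | skip (s : State) : Exec w .skip s 1 s
  | const (s : State) (r a : ℕ) (h : a < 2 ^ w) :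
      Exec w (.const r a) s 1 (s.setReg r a)
  | op (s : State) (o : WordOp) (r a b : ℕ) (h : o.eval (s.reg a) (s.reg b) < 2 ^ w) :
      Exec w (.op o r a b) s 1 (s.setReg r (o.eval (s.reg a) (s.reg b)))
  | load (s : State) (r A i : ℕ) (h : s.mem A (s.reg i) < 2 ^ w) :
      Exec w (.load r A i) s 1 (s.setReg r (s.mem A (s.reg i)))
  | store (s : State) (A i r : ℕ) (h : s.reg r < 2 ^ w) :
      Exec w (.store A i r) s 1 (s.setMem A (s.reg i) (s.reg r))
  | seq {p q : Program} {s₁ s₂ s₃ : State} {t₁ t₂ : ℕ}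
      (hp : Exec w p s₁ t₁ s₂) (hq : Exec w q s₂ t₂ s₃) :
      Exec w (.seq p q) s₁ (t₁ + t₂) s₃
  | iteTrue {r : ℕ} {p q : Program} {s s' : State} {t : ℕ}
      (hr : s.reg r ≠ 0) (hp : Exec w p s t s') :
      Exec w (.ite r p q) s (t + 1) s'
  | iteFalse {r : ℕ} {p q : Program} {s s' : State} {t : ℕ}
      (hr : s.reg r = 0) (hq : Exec w q s t s') :
      Exec w (.ite r p q) s (t + 1) s'
  | whileDone {r : ℕ} {p : Program} {s : State} (hr : s.reg r = 0) :
      Exec w (.while r p) s 1 s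
  | whileStep {r : ℕ} {p : Program} {s₁ s₂ s₃ : State} {t₁ t₂ : ℕ}
      (hr : s₁.reg r ≠ 0) (hp : Exec w p s₁ t₁ s₂) (hw : Exec w (.while r p) s₂ t₂ s₃) :
      Exec w (.while r p) s₁ (t₁ + t₂ + 1) s₃

/-- The input, a list of words, is in memory `0` and its length in register `0`; everything else
is `0`. -/
def State.init (x : List ℕ) : State where
  reg r := if r = 0 then x.length else 0
  mem A i := if A = 0 then x.getD i 0 else 0

/-- The output is in memory `1` and its length in register `0`. -/
def State.output (s : State) : List ℕ :=
  (List.range (s.reg 0)).map (s.mem 1)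

/-- With words of `w` bits, the program `p` on input `x` halts after `t` steps with output `y`. -/
def Computes (w : ℕ) (p : Program) (x : List ℕ) (t : ℕ) (y : List ℕ) : Prop :=
  ∃ s : State, Exec w p (State.init x) t s ∧ s.output = y

/-! ### Flows -/

/-- `f` is a flow from `s` to `t` in the network on the node set `V` in which the edge from `u` to
`v` has capacity `cap u v` (capacity `0` where there is no edge). -/
structure IsFlow {V : Type*} [Fintype V] (cap : V → V → ℕ) (s t : V) (f : V → V → ℝ) : Prop where
  nonneg : ∀ u v, 0 ≤ f u v
  le_cap : ∀ u v, f u v ≤ cap u v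
  conservation : ∀ v, v ≠ s → v ≠ t → ∑ u, f u v = ∑ u, f v u

/-- The net amount of flow that leaves `s`. -/
noncomputable def flowValue {V : Type*} [Fintype V] (f : V → V → ℝ) (s : V) : ℝ :=
  ∑ v, f s v - ∑ v, f v s

/-- `x` is the maximum flow that can be shipped from `s` to `t`. -/
def IsMaxFlow {V : Type*} [Fintype V] (cap : V → V → ℕ) (s t : V) (x : ℝ) : Prop :=
  IsGreatest {y : ℝ | ∃ f : V → V → ℝ, IsFlow cap s t f ∧ flowValue f s = y} x

/-- A finite directed graph without parallel edges and loops, given by a list of its edges. -/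
structure EdgeListDigraph where
  n : ℕ
  edges : List (Fin n × Fin n)
  nodup : edges.Nodup
  loopless : ∀ e ∈ edges, e.1 ≠ e.2

namespace EdgeListDigraph

/-- The number of edges. -/
def m (G : EdgeListDigraph) : ℕ := G.edges.length

/-- In an uncapacitated graph every edge has capacity `1`. -/
def unitCap (G : EdgeListDigraph) (u v : Fin G.n) : ℕ := if (u, v) ∈ G.edges then 1 else 0

/-- The input of kPMF as a list of words: the number of nodes, the threshold, the number of edges
and the edges. -/
def encode (G : EdgeListDigraph) (k : ℕ) : List ℕ :=
  G.n :: k :: G.m :: G.edges.flatMap fun e => [(e.1 : ℕ), (e.2 : ℕ)]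

/-- `y` is a correct output of kPMF: it lists, in any order, the triples `(u, v, F)` such that the
maximum flow from `u` to `v` is `F` and is at most `k`, for all pairs of different nodes. -/
def IsKPMFOutput (G : EdgeListDigraph) (k : ℕ) (y : List ℕ) : Prop :=
  ∃ L : List (Fin G.n × Fin G.n × ℕ),
    (y = L.flatMap fun e => [(e.1 : ℕ), (e.2.1 : ℕ), e.2.2]) ∧
    ∀ (u v : Fin G.n) (F : ℕ),
      (u, v, F) ∈ L ↔ u ≠ v ∧ F ≤ k ∧ IsMaxFlow G.unitCap u v (F : ℝ)

end EdgeListDigraph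

/-- kPMF in uncapacitated graphs with `n` nodes, `k = Õ(n ^ c)` and `m = O(k n)` edges can be
solved in time `O((n² k) ^ (1 - ε))`, on a word RAM with words of `O(log n)` bits. The constants
`C` and `D` are those hidden in `Õ(n ^ c)` and `O(k n)`; the program and the constants hidden in
the running time and the word length may depend on them. Where `k` is below `n ^ c` the time
allowed is the one for `k = n ^ c`: fewer than `n²` steps do not even suffice to write the output
for a graph without edges. -/
def KPMFSolvable (ε c : ℝ) : Prop :=
  ∀ C D : ℕ, ∃ (p : Program) (d : ℕ) (K : ℝ), ∀ (G : EdgeListDigraph) (k : ℕ),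
    1 ≤ G.n → 1 ≤ k →
    (k : ℝ) ≤ C * (G.n : ℝ) ^ c * ((Nat.log 2 G.n : ℝ) + 1) ^ D →
    G.m ≤ C * k * G.n →
    ∃ (t : ℕ) (y : List ℕ),
      Computes (d * (Nat.log 2 G.n + 1)) p (G.encode k) t y ∧
      G.IsKPMFOutput k y ∧
      (t : ℝ) ≤ K * ((G.n : ℝ) ^ 2 * max (k : ℝ) ((G.n : ℝ) ^ c)) ^ (1 - ε)

/-! ### Satisfiability -/

/-- A CNF formula on `n` variables: a list of clauses. A clause is a list of different literals;
the literal `(i, b)` is true if the variable `i` has the value `b`. -/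
structure CNF where
  n : ℕ
  clauses : List (List (Fin n × Bool))
  nodup : ∀ C ∈ clauses, C.Nodup

namespace CNF

/-- The number of clauses. -/
def m (φ : CNF) : ℕ := φ.clauses.length

/-- The clause `C` is satisfied by the assignment `a`. -/
def clauseSat {n : ℕ} (a : Fin n → Bool) (C : List (Fin n × Bool)) : Bool :=
  C.any fun l => a l.1 == l.2

/-- The number of clauses that `a` satisfies. -/
def numSat (φ : CNF) (a : Fin φ.n → Bool) : ℕ := φ.clauses.countP (clauseSat a)

/-- The maximum number of clauses that an assignment satisfies. -/
def maxSat (φ : CNF) : ℕ := Finset.univ.sup φ.numSat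

/-- Some assignment satisfies all clauses. -/
def Satisfiable (φ : CNF) : Prop := ∃ a : Fin φ.n → Bool, ∀ C ∈ φ.clauses, clauseSat a C = true

/-- The formula as a list of words: the number of variables, the number of clauses, and for each
clause its length and its literals, where the literals of variable `i` are `2 i` and `2 i + 1`. -/
def encode (φ : CNF) : List ℕ :=
  φ.n :: φ.m :: φ.clauses.flatMap fun C =>
    C.length :: C.map fun l => 2 * (l.1 : ℕ) + l.2.toNat

end CNF

/-- MAX-CNF-SAT on `n` variables and `O(n)` clauses can be solved in time `O(2 ^ ((1 - δ) n))`, on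
a word RAM with words of `O(n)` bits. The constant `B` is the one hidden in the number of clauses;
the program and the constants hidden in the running time and the word length may depend on it. -/
def MaxCNFSATSolvable (δ : ℝ) : Prop :=
  ∀ B : ℕ, ∃ (p : Program) (d : ℕ) (K : ℝ), ∀ φ : CNF, φ.m ≤ B * φ.n →
    ∃ t : ℕ, Computes (d * (φ.n + 1)) p φ.encode t [φ.maxSat] ∧
      (t : ℝ) ≤ K * (2 : ℝ) ^ ((1 - δ) * (φ.n : ℝ))

open Classical in
/-- `k`-SAT on `n` variables and `m` clauses can be solved in time `2 ^ ((1 - ε) n) poly(m)`, on a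
word RAM with words of `O(n + log m)` bits. -/
def KSATSolvable (k : ℕ) (ε : ℝ) : Prop :=
  ∃ (p : Program) (d e : ℕ) (K : ℝ), ∀ φ : CNF, (∀ C ∈ φ.clauses, C.length ≤ k) →
    ∃ t : ℕ,
      Computes (d * (φ.n + Nat.log 2 φ.m + 1)) p φ.encode t [if φ.Satisfiable then 1 else 0] ∧
      (t : ℝ) ≤ K * (2 : ℝ) ^ ((1 - ε) * (φ.n : ℝ)) * ((φ.m : ℝ) + 1) ^ e

/-- The Strong Exponential Time Hypothesis. -/
def SETH : Prop := ∀ ε : ℝ, 0 < ε → ∃ k : ℕ, 3 ≤ k ∧ ¬ KSATSolvable k ε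

end FineGrained

/-! ### Word-RAM programs: subroutines, expressions, weakest preconditions. -/

namespace FineGrained

/-! ### General properties of executions -/

/-! Split the variables into three groups of sizes `a`, `b`, `g`, and let `M` be the number of
clauses plus one. The network has a source for every assignment `y` of the first group, a sink `(t,
y')` for every `t < M` and every assignment `y'` of the second, and a block of `M` slots for every
assignment `z` of the third. Slot `j` stands for clause `j`; the last slot is a clause that nothing
satisfies. A source enters each slot of block `z` by one of two doors, according to whether `y` and
`z` together leave the clause unsatisfied. From the door for unsatisfied clauses a direct edge leads
to `(t, y')` if `y'` misses the clause too. Both doors lead to all exits of the block, but only `M -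
t - 1` of these exits reach `(t, y')`.

If `d` slots are missed by the whole assignment `(y, y', z)`, then block `z` carries `min M (d + (M
- t - 1))` units from `y` to `(t, y')` (`isMaxFlow_network`: an explicit fractional flow and a
matching cut). So the maximum flow reaches `k = M * 2 ^ g` unless some `z` has `d ≤ t`, that is,
unless some completion of `(y, y')` satisfies at least `M - t` clauses. No such flow exceeds `k`, so
kPMF reports all of them, and the optimum is the largest `M - t` among source-sink pairs with flow
below `k` (`direct_add_satCount`, `scan_eq_maxCount`).

With group sizes in the ratio `Q : Q : p`, where `p / Q` approximates `c` from below, the network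
has about `2 ^ (Q r)` nodes and threshold about `2 ^ (p r)`, for `r = n / (2 Q + p)`. Hence nodes
squared times threshold is about `2 ^ n` up to polynomial factors, and the exponent `1 - ε` yields
time `2 ^ ((1 - ε) n)` before rounding losses (`split_exponents_le`, `query_time_le`). The factor
`M` in the threshold is polylogarithmic in the number of nodes (`threshold_le`). For `q`-SAT it
suffices to drop repeated clauses: polynomially many remain, and the formula is satisfiable iff the
maximum equals their number.

The rest is an implementation on the word RAM: `computes_reduction` gives a program that builds the
network, runs the assumed algorithm as a subroutine and scans its output; `exists_program` chooses
the parameters and bounds the time. -/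

theorem Exec.mono {w w' : ℕ} (hw : w ≤ w') {p : Program} {s s' : State} {t : ℕ}
    (h : Exec w p s t s') : Exec w' p s t s' := by
  have hp : 2 ^ w ≤ 2 ^ w' := Nat.pow_le_pow_right (by norm_num) hw
  induction h with
  | skip s => exact .skip s
  | const s r a h => exact .const s r a (h.trans_le hp)
  | op s o r a b h => exact .op s o r a b (h.trans_le hp)
  | load s r A i h => exact .load s r A i (h.trans_le hp)
  | store s A i r h => exact .store s A i r (h.trans_le hp)
  | seq _ _ h1 h2 => exact .seq h1 h2
  | iteTrue hr _ h => exact .iteTrue hr h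
  | iteFalse hr _ h => exact .iteFalse hr h
  | whileDone hr => exact .whileDone hr
  | whileStep hr _ _ h1 h2 => exact .whileStep hr h1 h2

/-- An execution of `t` steps changes at most `t` cells of each memory. -/
theorem Exec.changed_cells {w : ℕ} {p : Program} {s s' : State} {t : ℕ}
    (h : Exec w p s t s') (A : ℕ) :
    ∃ S : Finset ℕ, S.card ≤ t ∧ ∀ i ∉ S, s'.mem A i = s.mem A i := by
  induction h with
  | skip s => exact ⟨∅, by simp, by simp⟩
  | const s r a h => exact ⟨∅, by simp, by simp [State.setReg]⟩
  | op s o r a b h => exact ⟨∅, by simp, by simp [State.setReg]⟩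
  | load s r A i h => exact ⟨∅, by simp, by simp [State.setReg]⟩
  | store s A' i r h =>
    refine ⟨{s.reg i}, by simp, fun j hj => ?_⟩
    by_cases hA : A = A'
    · subst hA; simp_all [State.setMem]
    · simp [State.setMem, hA]
  | seq _ _ h1 h2 | whileStep _ _ _ h1 h2 =>
    obtain ⟨S1, c1, e1⟩ := h1
    obtain ⟨S2, c2, e2⟩ := h2
    refine ⟨S1 ∪ S2, (Finset.card_union_le _ _).trans (by omega), fun i hi => ?_⟩
    simp only [Finset.mem_union, not_or] at hi
    rw [e2 i hi.2, e1 i hi.1]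
  | iteTrue _ _ h | iteFalse _ _ h =>
    obtain ⟨S, c, e⟩ := h
    exact ⟨S, by omega, e⟩
  | whileDone hr => exact ⟨∅, by simp, by simp⟩

/-- All numbers in registers and memories are below `2 ^ h`. -/
def State.Small (h : ℕ) (s : State) : Prop :=
  (∀ r, s.reg r < 2 ^ h) ∧ ∀ A i, s.mem A i < 2 ^ h

theorem State.Small.setReg {h : ℕ} {s : State} (hs : s.Small h) {r v : ℕ} (hv : v < 2 ^ h) :
    (s.setReg r v).Small h := by
  refine ⟨fun r' => ?_, hs.2⟩
  by_cases hr : r' = r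
  · simp [State.setReg, hr, hv]
  · simp [State.setReg, hr, hs.1]

theorem State.Small.setMem {h : ℕ} {s : State} (hs : s.Small h) {A i v : ℕ} (hv : v < 2 ^ h) :
    (s.setMem A i v).Small h := by
  refine ⟨hs.1, fun A' i' => ?_⟩
  by_cases hA : A' = A
  · subst hA
    by_cases hi : i' = i
    · simp [State.setMem, hi, hv]
    · simp [State.setMem, hi, hs.2]
  · simp [State.setMem, hA, hs.2]

/-- Every write is checked against the word size. For a called program about which nothing else is
known, this is what keeps the caller's size bound valid after the call. -/
theorem Exec.small {w h : ℕ} (hw : w ≤ h) {p : Program} {s s' : State} {t : ℕ}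
    (he : Exec w p s t s') (hs : s.Small h) : s'.Small h := by
  have hp : 2 ^ w ≤ 2 ^ h := Nat.pow_le_pow_right (by norm_num) hw
  induction he with
  | skip s => exact hs
  | const s r a h => exact hs.setReg (h.trans_le hp)
  | op s o r a b h => exact hs.setReg (h.trans_le hp)
  | load s r A i h => exact hs.setReg (h.trans_le hp)
  | store s A i r h => exact hs.setMem (h.trans_le hp)
  | seq _ _ h1 h2 => exact h2 (h1 hs)
  | iteTrue hr _ h => exact h hs
  | iteFalse hr _ h => exact h hs
  | whileDone hr => exact hs
  | whileStep hr _ _ h1 h2 => exact h2 (h1 hs)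

/-! ### Running a program inside another one -/

/-- The program with registers shifted by `R` and memories shifted by `A`. -/
def Program.shift (R A : ℕ) : Program → Program
  | .skip => .skip
  | .const r a => .const (r + R) a
  | .op o r a b => .op o (r + R) (a + R) (b + R)
  | .load r B i => .load (r + R) (B + A) (i + R)
  | .store B i r => .store (B + A) (i + R) (r + R)
  | .seq p q => .seq (p.shift R A) (q.shift R A)
  | .ite r p q => .ite (r + R) (p.shift R A) (q.shift R A)
  | .while r p => .while (r + R) (p.shift R A)

/-- The state `o` with the state `s` in its registers from `R` and its memories from `A` on. -/
def State.embed (R A : ℕ) (o s : State) : State where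
  reg r := if r < R then o.reg r else s.reg (r - R)
  mem B := if B < A then o.mem B else s.mem (B - A)

@[simp] theorem State.embed_reg (R A : ℕ) (o s : State) (r : ℕ) :
    (State.embed R A o s).reg (r + R) = s.reg r := by simp [State.embed]

@[simp] theorem State.embed_mem (R A : ℕ) (o s : State) (B : ℕ) :
    (State.embed R A o s).mem (B + A) = s.mem B := by simp [State.embed]

theorem State.embed_setReg (R A : ℕ) (o s : State) (r v : ℕ) :
    (State.embed R A o s).setReg (r + R) v = State.embed R A o (s.setReg r v) := by
  simp only [State.embed, State.setReg, State.mk.injEq, and_true]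
  funext r'
  by_cases h : r' < R
  · have : r' ≠ r + R := by omega
    simp [h, this]
  · by_cases h' : r' = r + R
    · simp [h']
    · have : r' - R ≠ r := by omega
      simp [h, h', this]

theorem State.embed_setMem (R A : ℕ) (o s : State) (B i v : ℕ) :
    (State.embed R A o s).setMem (B + A) i v = State.embed R A o (s.setMem B i v) := by
  simp only [State.embed, State.setMem, State.mk.injEq, true_and]
  funext B'
  by_cases h : B' < A
  · have : B' ≠ B + A := by omega
    simp [h, this]
  · by_cases h' : B' = B + A
    · simp [h']
    · have : B' - A ≠ B := by omega
      simp [h, h', this]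

/-- Renaming isolates a subroutine: it touches only the shifted registers and memories, and the
caller's data below them stay fixed. -/
theorem Exec.shift {w : ℕ} (R A : ℕ) (o : State) {p : Program} {s s' : State} {t : ℕ}
    (h : Exec w p s t s') :
    Exec w (p.shift R A) (State.embed R A o s) t (State.embed R A o s') := by
  induction h with
  | skip s => exact .skip _
  | const s r a h =>
    rw [← State.embed_setReg]
    exact .const _ _ _ h
  | op s op r a b h =>
    rw [← State.embed_setReg]
    simpa [Program.shift] using Exec.op (w := w) (State.embed R A o s) op (r + R) (a + R) (b + R)
      (by simpa using h)
  | load s r B i h =>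
    rw [← State.embed_setReg]
    simpa [Program.shift] using Exec.load (w := w) (State.embed R A o s) (r + R) (B + A) (i + R)
      (by simpa using h)
  | store s B i r h =>
    rw [← State.embed_setMem]
    simpa [Program.shift] using Exec.store (w := w) (State.embed R A o s) (B + A) (i + R) (r + R)
      (by simpa using h)
  | seq _ _ h1 h2 => exact .seq h1 h2
  | iteTrue hr _ h => exact .iteTrue (by simpa using hr) h
  | iteFalse hr _ h => exact .iteFalse (by simpa using hr) h
  | whileDone hr => exact .whileDone (by simpa using hr)
  | whileStep hr _ _ h1 h2 => exact .whileStep (by simpa using hr) h1 h2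

/-! ### Expressions -/

/-- Arithmetic expressions in registers and memory cells. -/
inductive Ex where
  | lit (a : ℕ)
  | var (r : ℕ)
  | ld (A : ℕ) (e : Ex)
  | bin (o : WordOp) (e f : Ex)

namespace Ex

def val (s : State) : Ex → ℕ
  | lit a => a
  | var r => s.reg r
  | ld A e => s.mem A (e.val s)
  | bin o e f => o.eval (e.val s) (f.val s)

def size : Ex → ℕ
  | lit _ => 1
  | var _ => 1
  | ld _ e => e.size + 1
  | bin _ e f => e.size + f.size + 1

/-- Registers `64, …, 127` are reserved for the evaluation of expressions. -/
def IsTemp (r : ℕ) : Prop := 64 ≤ r ∧ r < 128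

instance : DecidablePred IsTemp := fun r => inferInstanceAs (Decidable (64 ≤ r ∧ r < 128))

/-- The expression does not use reserved registers, its literals are less than `2`
or are bounded by `B`, and it has no left shift. -/
def wf (B : ℕ) : Ex → Bool
  | lit a => decide (a < B)
  | var r => decide (¬ IsTemp r)
  | ld _ e => e.wf B
  | bin o e f => (match o with | .shl => false | _ => true) && e.wf B && f.wf B

/-- A program that evaluates the expression into register `d`, using registers from `d` on. -/
def code : Ex → ℕ → Program
  | lit a, d => .const d a
  | var r, d => .op .lor d r r
  | ld A e, d => .seq (e.code d) (.load d A d)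
  | bin o e f, d => .seq (e.code d) (.seq (f.code (d + 1)) (.op o d d (d + 1)))

end Ex

/-- Bit lengths at most add up, plus one. Left shift is the only operation for which this fails. -/
theorem WordOp.eval_lt (o : WordOp) (ho : (match o with | .shl => false | _ => true) = true)
    {x y a b : ℕ} (hx : x < 2 ^ a) (hy : y < 2 ^ b) :
    o.eval x y < 2 ^ (a + b + 1) := by
  have h1 : (2 : ℕ) ^ a ≤ 2 ^ (a + b + 1) := Nat.pow_le_pow_right (by norm_num) (by omega)
  have h2 : (2 : ℕ) ^ b ≤ 2 ^ (a + b + 1) := Nat.pow_le_pow_right (by norm_num) (by omega)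
  have h3 : (2 : ℕ) ^ 1 ≤ 2 ^ (a + b + 1) := Nat.pow_le_pow_right (by norm_num) (by omega)
  have h4 : (2 : ℕ) ^ (a + b) ≤ 2 ^ (a + b + 1) := Nat.pow_le_pow_right (by norm_num) (by omega)
  cases o with
  | add =>
    have e1 : (2 : ℕ) ^ a ≤ 2 ^ (a + b) := Nat.pow_le_pow_right (by norm_num) (by omega)
    have e2 : (2 : ℕ) ^ b ≤ 2 ^ (a + b) := Nat.pow_le_pow_right (by norm_num) (by omega)
    have : (2 : ℕ) ^ (a + b + 1) = 2 * 2 ^ (a + b) := by ring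
    simp only [WordOp.eval]; omega
  | sub => simp only [WordOp.eval]; omega
  | mul =>
    simp only [WordOp.eval]
    refine lt_of_lt_of_le ?_ h4
    rw [pow_add]
    exact Nat.mul_lt_mul'' hx hy
  | div => exact (Nat.div_le_self x y).trans_lt (hx.trans_le h1)
  | mod => exact (Nat.mod_le x y).trans_lt (hx.trans_le h1)
  | land => exact Nat.and_le_left.trans_lt (hx.trans_le h1)
  | lor => exact Nat.or_lt_two_pow (hx.trans_le h1) (hy.trans_le h2)
  | xor => exact Nat.xor_lt_two_pow (hx.trans_le h1) (hy.trans_le h2)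
  | shl => simp at ho
  | shr =>
    simp only [WordOp.eval, Nat.shiftRight_eq_div_pow]
    exact (Nat.div_le_self _ _).trans_lt (hx.trans_le h1)
  | lt => simp only [WordOp.eval]; split <;> omega
  | eq => simp only [WordOp.eval]; split <;> omega

namespace Ex

theorem val_congr {B : ℕ} {e : Ex} (he : e.wf B = true) {s s' : State}
    (hr : ∀ r, ¬ IsTemp r → s.reg r = s'.reg r) (hm : s.mem = s'.mem) : e.val s = e.val s' := by
  induction e with
  | lit a => rfl
  | var r => exact hr r (by simpa [wf] using he)
  | ld A e ih => simp [val, hm, ih he]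
  | bin o e f ih1 ih2 =>
    simp only [wf, Bool.and_eq_true] at he
    simp [val, ih1 he.1.2, ih2 he.2]

/-- Since bit lengths add, the size of an expression bounds its growth. Intermediate values
therefore never need an individual estimate; only stored results do. -/
theorem val_lt {h B : ℕ} (hB : B ≤ 2 ^ h) (hh : 1 ≤ h) {e : Ex} (he : e.wf B = true) {s : State}
    (hr : ∀ r, ¬ IsTemp r → s.reg r < 2 ^ h) (hm : ∀ A i, s.mem A i < 2 ^ h) :
    e.val s < 2 ^ (e.size * h) := by
  induction e with
  | lit a => simpa [size, val] using (by simpa [wf] using he : a < B).trans_le hB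
  | var r => simpa [size, val] using hr r (by simpa [wf] using he)
  | ld A e ih =>
    refine (hm A _).trans_le (Nat.pow_le_pow_right (by norm_num) ?_)
    simp only [size]; nlinarith
  | bin o e f ih1 ih2 =>
    simp only [wf, Bool.and_eq_true] at he
    refine (WordOp.eval_lt o he.1.1 (ih1 he.1.2) (ih2 he.2)).trans_le
      (Nat.pow_le_pow_right (by norm_num) ?_)
    simp only [size]; nlinarith

theorem size_pos (e : Ex) : 1 ≤ e.size := by cases e <;> simp [size]

/-- Stack discipline: the second operand is evaluated one register higher, so the first survives,
and everything below `d` or from `128` on is untouched. -/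
theorem exec_code {h B w : ℕ} (hB : B ≤ 2 ^ h) (hh : 1 ≤ h) {e : Ex} (he : e.wf B = true)
    (hw : e.size * h ≤ w) {s : State} {d : ℕ} (hd : 64 ≤ d) (hd' : d + e.size ≤ 128)
    (hr : ∀ r, ¬ IsTemp r → s.reg r < 2 ^ h) (hm : ∀ A i, s.mem A i < 2 ^ h) :
    ∃ s', Exec w (e.code d) s e.size s' ∧ s'.reg d = e.val s ∧ s'.mem = s.mem ∧
      ∀ r, r < d ∨ 128 ≤ r → s'.reg r = s.reg r := by
  induction e generalizing s d with
  | lit a =>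
    refine ⟨s.setReg d a, .const _ _ _ ?_, by simp [State.setReg, val], rfl, fun r hr' => ?_⟩
    · have : a < B := by simpa [wf] using he
      exact (this.trans_le hB).trans_le
        (Nat.pow_le_pow_right (by norm_num) (by simpa [size] using hw))
    · have : r ≠ d := by simp [size] at hd'; omega
      simp [State.setReg, this]
  | var r =>
    have h1 := hr r (by simpa [wf] using he)
    have h2 : (2 : ℕ) ^ h ≤ 2 ^ w := Nat.pow_le_pow_right (by norm_num) (by simpa [size] using hw)
    -- A register move is written as a bitwise or of the register with itself.
    refine ⟨s.setReg d (s.reg r), ?_, by simp [State.setReg, val], rfl, fun r' hr' => ?_⟩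
    · have := Exec.op (w := w) s .lor d r r (by simp [WordOp.eval]; omega)
      simpa [WordOp.eval, code, size] using this
    · have : r' ≠ d := by simp [size] at hd'; omega
      simp [State.setReg, this]
  | ld A e ih =>
    simp only [size] at hw hd'
    obtain ⟨s1, e1, v1, m1, r1⟩ := ih (d := d) (s := s) he (by nlinarith) hd (by omega) hr hm
    have h2 : (2 : ℕ) ^ h ≤ 2 ^ w := Nat.pow_le_pow_right (by norm_num) (by nlinarith)
    refine ⟨s1.setReg d (s1.mem A (s1.reg d)), .seq e1 (.load _ _ _ _ ?_), ?_, m1,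
      fun r' hr' => ?_⟩
    · rw [m1]; exact (hm _ _).trans_le h2
    · simp [State.setReg, val, m1, v1]
    · have : r' ≠ d := by omega
      simp [State.setReg, this, r1 r' hr']
  | bin o e f ih1 ih2 =>
    have hv := val_lt hB hh he hr hm
    have he0 := he
    simp only [wf, Bool.and_eq_true] at he
    have hw0 := hw
    simp only [size] at hw hd'
    obtain ⟨s1, e1, v1, m1, r1⟩ :=
      ih1 (d := d) (s := s) he.1.2 (by nlinarith) hd (by omega) hr hm
    have n1 : ∀ r, ¬ IsTemp r → s1.reg r = s.reg r := fun r h => r1 r (by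
      simp only [IsTemp, not_and_or] at h; omega)
    obtain ⟨s2, e2, v2, m2, r2⟩ :=
      ih2 (d := d + 1) (s := s1) he.2 (by nlinarith) (by omega) (by have := size_pos e; omega)
        (fun r h => by rw [n1 r h]; exact hr r h) (fun A i => by rw [m1]; exact hm A i)
    have w2 : f.val s1 = f.val s := val_congr he.2 n1 m1
    have w1 : s2.reg d = e.val s := by rw [r2 d (by omega), v1]
    have hval : o.eval (s2.reg d) (s2.reg (d + 1)) = (bin o e f).val s := by
      simp [val, v2, w2, w1]
    refine ⟨s2.setReg d (o.eval (s2.reg d) (s2.reg (d + 1))), ?_, ?_, by simp [State.setReg, m1, m2],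
      fun r' hr' => ?_⟩
    · have := Exec.seq e1 (Exec.seq e2 (Exec.op (w := w) s2 o d d (d + 1) (by
        rw [hval]; exact hv.trans_le (Nat.pow_le_pow_right (by norm_num) hw0))))
      simpa [code, size, add_assoc] using this
    · rw [hval]; simp [State.setReg]
    · have : r' ≠ d := by omega
      simp [State.setReg, this, r2 r' (by omega), r1 r' hr']

end Ex

/-! ### Weakest preconditions -/

/-- The state with the reserved registers set to `0`. -/
def State.clean (s : State) : State where
  reg r := if Ex.IsTemp r then 0 else s.reg r
  mem := s.mem

/-- Words have `64 h` bits, all numbers between statements are below `2 ^ h`. The program started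
in a state that is `s` up to reserved registers halts within `T` steps in a state that satisfies
`Q` up to reserved registers. -/
def Wp (h : ℕ) (p : Program) (T : ℕ) (s : State) (Q : State → Prop) : Prop :=
  s.Small h → ∀ s₀ : State, s₀.clean = s →
    ∃ t s', t ≤ T ∧ Exec (64 * h) p s₀ t s' ∧ s'.clean.Small h ∧ Q s'.clean

namespace Wp

variable {h T T' : ℕ} {p q : Program} {s : State} {Q Q' : State → Prop}

theorem weaken (hT : T ≤ T') (hQ : ∀ s, s.Small h → Q s → Q' s) (H : Wp h p T s Q) :
    Wp h p T' s Q' := by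
  intro hs s₀ h₀
  obtain ⟨t, s', ht, he, hsm, hq⟩ := H hs s₀ h₀
  exact ⟨t, s', ht.trans hT, he, hsm, hQ _ hsm hq⟩

theorem small (H : s.Small h → Wp h p T s Q) : Wp h p T s Q := fun hs => H hs hs

theorem skip (H : Q s) : Wp h .skip 1 s Q := by
  rintro hs s₀ rfl
  exact ⟨1, s₀, le_rfl, .skip _, hs, H⟩

theorem seq (H : Wp h p T s fun s' => Wp h q T' s' Q) : Wp h (.seq p q) (T + T') s Q := by
  intro hs s₀ h₀
  obtain ⟨t, s', ht, he, hsm, hq⟩ := H hs s₀ h₀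
  obtain ⟨t', s'', ht', he', hsm', hq'⟩ := hq hsm s' rfl
  exact ⟨t + t', s'', by omega, .seq he he', hsm', hq'⟩

end Wp

theorem State.clean_setReg {s : State} {r v : ℕ} (hr : ¬ Ex.IsTemp r) :
    (s.setReg r v).clean = s.clean.setReg r v := by
  simp only [State.clean, State.setReg, State.mk.injEq, and_true]
  funext r'
  by_cases h : r' = r
  · subst h; simp [hr]
  · simp [h]

theorem State.clean_eq_of {s s' : State} (hr : ∀ r, ¬ Ex.IsTemp r → s'.reg r = s.reg r)
    (hm : s'.mem = s.mem) : s'.clean = s.clean := by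
  simp only [State.clean, hm, State.mk.injEq, and_true]
  funext r
  by_cases h : Ex.IsTemp r
  · simp [h]
  · simp [h, hr r h]

theorem State.clean_reg {s : State} {r : ℕ} (hr : ¬ Ex.IsTemp r) : s.clean.reg r = s.reg r := by
  simp [State.clean, hr]

theorem Ex.val_clean {B : ℕ} {e : Ex} (he : e.wf B = true) {s : State} :
    e.val s.clean = e.val s :=
  val_congr he (fun _ hr => State.clean_reg hr) rfl

/-- Evaluate an expression into reserved registers. -/
theorem Ex.exec_code_clean {h B : ℕ} (hB : B ≤ 2 ^ h) (hh : 1 ≤ h) {e : Ex} (he : e.wf B = true)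
    {d : ℕ} (hd : 64 ≤ d) (hsz : d + e.size ≤ 128) {s₀ : State} (hs : s₀.clean.Small h) :
    ∃ s', Exec (64 * h) (e.code d) s₀ e.size s' ∧ s'.clean = s₀.clean ∧
      s'.reg d = e.val s₀.clean ∧ ∀ r, r < d → s'.reg r = s₀.reg r := by
  obtain ⟨s', e1, v1, m1, r1⟩ := exec_code (w := 64 * h) hB hh he
    (Nat.mul_le_mul_right h (by omega)) hd hsz
    (s := s₀) (fun r hr => by rw [← State.clean_reg hr]; exact hs.1 r) hs.2
  refine ⟨s', e1, State.clean_eq_of (fun r hr => r1 r ?_) m1, by rw [v1, val_clean he],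
    fun r hr => r1 r (.inl hr)⟩
  simp only [IsTemp, not_and_or] at hr; omega

/-! ### Statements -/

/-- `reg x := e` -/
def assign (x : ℕ) (e : Ex) : Program := .seq (e.code 64) (.op .lor x 64 64)

/-- `reg x := 2 ^ e` -/
def assignPow (x : ℕ) (e : Ex) : Program :=
  .seq (.const 64 1) (.seq (e.code 65) (.op .shl x 64 65))

/-- `mem A e := f` -/
def put (A : ℕ) (e f : Ex) : Program := .seq (e.code 64) (.seq (f.code 65) (.store A 64 65))

/-- `if e ≠ 0 then p else q` -/
def cond (e : Ex) (p q : Program) : Program := .seq (e.code 64) (.ite 64 p q)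

/-- `for i < reg n do p` -/
def loop (i n : ℕ) (p : Program) : Program :=
  .seq (assign i (.lit 0)) (.seq (Ex.code (.bin .lt (.var i) (.var n)) 64)
    (.while 64 (.seq p (.seq (assign i (.bin .add (.var i) (.lit 1)))
      (Ex.code (.bin .lt (.var i) (.var n)) 64)))))

/-- One program after the other. -/
def block (l : List Program) : Program := l.foldr .seq .skip

namespace Wp

variable {h B T T' : ℕ} {p q : Program} {s : State} {Q : State → Prop}

theorem nil (H : Q s) : Wp h (block []) 1 s Q := skip H

theorem cons {l : List Program} (H : Wp h p T s fun s' => Wp h (block l) T' s' Q) :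
    Wp h (block (p :: l)) (T + T') s Q := seq H

theorem assign (hh : 1 ≤ h) {x : ℕ} {e : Ex} (B : ℕ) (hB : B ≤ 2 ^ h)
    (hx : ¬ Ex.IsTemp x) (he : e.wf B = true)
    (hsz : e.size ≤ 60) (hv : e.val s < 2 ^ h) (H : Q (s.setReg x (e.val s))) :
    Wp h (assign x e) (e.size + 1) s Q := by
  rintro hs s₀ rfl
  obtain ⟨s', e1, c1, v1, -⟩ := Ex.exec_code_clean hB hh he (d := 64) le_rfl (by omega) hs
  have hw : (2 : ℕ) ^ h ≤ 2 ^ (64 * h) := Nat.pow_le_pow_right (by norm_num) (by omega)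
  refine ⟨_, _, le_rfl, .seq e1 (.op _ _ _ _ _ ?_), ?_, ?_⟩
  · simp only [WordOp.eval, Nat.or_self, v1]; omega
  · rw [State.clean_setReg hx, c1]
    simp only [WordOp.eval, Nat.or_self, v1]
    exact hs.setReg hv
  · rw [State.clean_setReg hx, c1]
    simpa only [WordOp.eval, Nat.or_self, v1] using H

/-- Powers of two are the only place where a left shift is allowed; the exponent must be below `h`,
because no size bound follows from the operands. -/
theorem assignPow (hh : 1 ≤ h) {x : ℕ} {e : Ex} (B : ℕ) (hB : B ≤ 2 ^ h)
    (hx : ¬ Ex.IsTemp x) (he : e.wf B = true)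
    (hsz : e.size ≤ 60) (hv : e.val s < h) (H : Q (s.setReg x (2 ^ e.val s))) :
    Wp h (assignPow x e) (e.size + 2) s Q := by
  rintro hs s₀ rfl
  have hw : (2 : ℕ) ^ h ≤ 2 ^ (64 * h) := Nat.pow_le_pow_right (by norm_num) (by omega)
  have hv' : 2 ^ e.val s₀.clean < 2 ^ h := Nat.pow_lt_pow_right (by norm_num) hv
  have h1 : (1 : ℕ) < 2 ^ h := Nat.one_lt_two_pow (by omega)
  have c0 : (s₀.setReg 64 1).clean = s₀.clean := State.clean_eq_of (fun r hr => by
    have : r ≠ 64 := by rintro rfl; simp [Ex.IsTemp] at hr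
    simp [State.setReg, this]) rfl
  obtain ⟨s', e1, c1, v1, r1⟩ := Ex.exec_code_clean hB hh he (d := 65) (by omega) (by omega)
    (s₀ := s₀.setReg 64 1) (by rwa [c0])
  rw [c0] at v1 c1
  have hval : WordOp.eval .shl (s'.reg 64) (s'.reg 65) = 2 ^ e.val s₀.clean := by
    rw [v1, r1 64 (by omega)]
    simp [WordOp.eval, State.setReg, Nat.shiftLeft_eq]
  refine ⟨_, _, ?_, .seq (.const _ _ _ (h1.trans_le hw)) (.seq e1 (.op _ _ _ _ _ ?_)), ?_, ?_⟩
  · omega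
  · rw [hval]; omega
  · rw [State.clean_setReg hx, c1, hval]
    exact hs.setReg hv'
  · rw [State.clean_setReg hx, c1, hval]
    exact H

theorem put (hh : 1 ≤ h) {A : ℕ} {e f : Ex} (B : ℕ) (hB : B ≤ 2 ^ h)
    (he : e.wf B = true) (hf : f.wf B = true)
    (hsz : e.size ≤ 60) (hsz' : f.size ≤ 60) (hv : f.val s < 2 ^ h)
    (H : Q (s.setMem A (e.val s) (f.val s))) :
    Wp h (put A e f) (e.size + f.size + 1) s Q := by
  rintro hs s₀ rfl
  obtain ⟨s1, e1, c1, v1, -⟩ := Ex.exec_code_clean hB hh he (d := 64) le_rfl (by omega) hs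
  obtain ⟨s2, e2, c2, v2, r2⟩ := Ex.exec_code_clean hB hh hf (d := 65) (by omega) (by omega)
    (s₀ := s1) (by rwa [c1])
  rw [c1] at c2 v2
  have hw : (2 : ℕ) ^ h ≤ 2 ^ (64 * h) := Nat.pow_le_pow_right (by norm_num) (by omega)
  have hc : (s2.setMem A (s2.reg 64) (s2.reg 65)).clean =
      s₀.clean.setMem A (e.val s₀.clean) (f.val s₀.clean) := by
    rw [r2 64 (by omega), v1, v2, ← c2]
    rfl
  refine ⟨_, _, ?_, .seq e1 (.seq e2 (.store _ _ _ _ ?_)), ?_, ?_⟩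
  · omega
  · rw [v2]; omega
  · rw [hc]; exact hs.setMem hv
  · rw [hc]; exact H

theorem cond (hh : 1 ≤ h) {e : Ex} (B : ℕ) (hB : B ≤ 2 ^ h) (he : e.wf B = true)
    (hsz : e.size ≤ 60) (Hp : e.val s ≠ 0 → Wp h p T s Q) (Hq : e.val s = 0 → Wp h q T s Q) :
    Wp h (cond e p q) (e.size + T + 1) s Q := by
  rintro hs s₀ rfl
  obtain ⟨s1, e1, c1, v1, -⟩ := Ex.exec_code_clean hB hh he (d := 64) le_rfl (by omega) hs
  by_cases hz : e.val s₀.clean = 0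
  · obtain ⟨t, s2, ht, e2, hsm, hq⟩ := Hq hz hs s1 c1
    exact ⟨_, _, by omega, .seq e1 (.iteFalse (by rw [v1, hz]) e2), hsm, hq⟩
  · obtain ⟨t, s2, ht, e2, hsm, hq⟩ := Hp hz hs s1 c1
    exact ⟨_, _, by omega, .seq e1 (.iteTrue (by rwa [v1]) e2), hsm, hq⟩

/-- The invariant after a round refers to the state with the counter already advanced. The `10` per
round pays for the increment, the comparison and the test. -/
theorem loop {i n N : ℕ} (hi : ¬ Ex.IsTemp i) (hn : ¬ Ex.IsTemp n) (hin : i ≠ n) (hh : 2 ≤ h)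
    (I : ℕ → State → Prop) (hN : s.reg n = N) (h0 : I 0 (s.setReg i 0))
    (hstep : ∀ j < N, ∀ s', s'.reg i = j → s'.reg n = N → I j s' →
      Wp h p T s' fun s'' => s''.reg i = j ∧ s''.reg n = N ∧ I (j + 1) (s''.setReg i (j + 1))) :
    Wp h (loop i n p) (N * (T + 10) + 10) s fun s' => s'.reg n = N ∧ I N s' := by
  have hB : 2 ≤ 2 ^ h := le_trans (by norm_num : 2 ≤ 2 ^ 1)
    (Nat.pow_le_pow_right (by norm_num) (by omega))
  have hlt : ∀ s₀ : State, s₀.clean.Small h → ∃ s', Exec (64 * h)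
      (Ex.code (.bin .lt (.var i) (.var n)) 64) s₀ 3 s' ∧ s'.clean = s₀.clean ∧
        s'.reg 64 = if s₀.clean.reg i < s₀.clean.reg n then 1 else 0 := by
    intro s₀ hs
    obtain ⟨s', e1, c1, v1, -⟩ := Ex.exec_code_clean (e := .bin .lt (.var i) (.var n)) hB
      (by omega) (by simp [Ex.wf, hi, hn]) (d := 64) le_rfl (by simp [Ex.size]) hs
    exact ⟨s', e1, c1, v1⟩
  -- Induction on the number `d` of remaining rounds.
  have key : ∀ d j : ℕ, j + d = N → ∀ s₀ : State, s₀.clean.Small h → s₀.clean.reg i = j →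
      s₀.clean.reg n = N → I j s₀.clean →
      (s₀.reg 64 = if j < N then 1 else 0) →
      ∃ t s', t ≤ d * (T + 10) + 1 ∧ Exec (64 * h) (.while 64 (.seq p (.seq
        (FineGrained.assign i (.bin .add (.var i) (.lit 1)))
        (Ex.code (.bin .lt (.var i) (.var n)) 64)))) s₀ t s' ∧ s'.clean.Small h ∧
        s'.clean.reg n = N ∧ I N s'.clean := by
    intro d
    induction d with
    | zero =>
      intro j hj s₀ hs hi' hn' hI h64
      obtain rfl : j = N := by omega
      exact ⟨1, s₀, by omega, .whileDone (by simpa using h64), hs, hn', hI⟩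
    | succ d ih =>
      intro j hj s₀ hs hi' hn' hI h64
      have hjN : j < N := by omega
      obtain ⟨t1, s1, ht1, e1, sm1, i1, n1, I1⟩ := hstep j hjN s₀.clean hi' hn' hI hs s₀ rfl
      have hN' : N < 2 ^ h := by rw [← hn']; exact hs.1 n
      obtain ⟨t2, s2, ht2, e2, sm2, q2⟩ := Wp.assign (h := h) (s := s1.clean)
        (x := i) (e := .bin .add (.var i) (.lit 1))
        (Q := fun s' => s' = s1.clean.setReg i (j + 1)) (by omega) 2 hB hi
        (by simp [Ex.wf, hi]) (by simp [Ex.size])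
        (by simp [Ex.val, WordOp.eval, i1]; omega) (by simp [Ex.val, WordOp.eval, i1])
        sm1 s1 rfl
      obtain ⟨s3, e3, c3, v3⟩ := hlt s2 sm2
      rw [q2] at c3 v3
      have r3 : s3.clean.reg i = j + 1 := by rw [c3]; simp [State.setReg]
      have n3 : s3.clean.reg n = N := by rw [c3]; simp [State.setReg, n1, hin.symm]
      obtain ⟨t4, s4, ht4, e4, sm4, q4⟩ := ih (j + 1) (by omega) s3 (by rw [c3, ← q2]; exact sm2)
        r3 n3 (by rw [c3]; exact I1)
        (by rw [v3, ← c3, r3, n3])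
      refine ⟨_, s4, ?_, .whileStep (by simp [h64, hjN]) (.seq e1 (.seq e2 e3)) e4, sm4, q4⟩
      simp only [Ex.size] at ht2
      nlinarith
  rintro hs s₀ rfl
  obtain ⟨t2, s2, ht2, e2, sm2, q2⟩ := Wp.assign (h := h) (s := s₀.clean)
    (x := i) (e := .lit 0)
    (Q := fun s' => s' = s₀.clean.setReg i 0) (by omega) 2 hB hi
    (by simp [Ex.wf]) (by simp [Ex.size])
    (by simp [Ex.val]) (by simp [Ex.val])
    hs s₀ rfl
  obtain ⟨s3, e3, c3, v3⟩ := hlt s2 sm2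
  rw [q2] at c3 v3
  have r3 : s3.clean.reg i = 0 := by rw [c3]; simp [State.setReg]
  have n3 : s3.clean.reg n = N := by rw [c3]; simp [State.setReg, hN, hin.symm]
  obtain ⟨t4, s4, ht4, e4, sm4, q4⟩ := key N 0 (by omega) s3 (by rw [c3, ← q2]; exact sm2)
    r3 n3 (by rw [c3]; exact h0) (by rw [v3, ← c3, r3, n3])
  refine ⟨_, s4, ?_, .seq e2 (.seq e3 e4), sm4, q4⟩
  simp only [Ex.size] at ht2
  omega

/-- Run a program in the registers from `128` and the memories from `4` on. -/
theorem call {w t : ℕ} {i f : State} (he : Exec w p i t f) (hw : w ≤ 64 * h)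
    (hs : State.embed 128 4 s i = s) (hsm : (State.embed 128 4 s f).Small h)
    (H : Q (State.embed 128 4 s f)) :
    Wp h (p.shift 128 4) t s Q := by
  rintro - s₀ rfl
  have hc : ∀ x : State, (State.embed 128 4 s₀ x).clean = State.embed 128 4 s₀.clean x := by
    intro x
    simp only [State.embed, State.clean, State.mk.injEq, and_true]
    funext r
    by_cases h1 : r < 128
    · simp [h1]
    · have : ¬ Ex.IsTemp r := by simp [Ex.IsTemp]; omega
      simp [h1, this]
  -- The reserved registers lie below `128`, so clearing them does not affect what the subroutine
  -- sees.
  have h0 : State.embed 128 4 s₀ i = s₀ := by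
    have hr := congrArg State.reg hs
    have hm := congrArg State.mem hs
    cases s₀ with
    | mk reg mem =>
      simp only [State.embed, State.clean] at hr hm ⊢
      simp only [State.mk.injEq]
      constructor
      · funext r
        have := congrFun hr r
        by_cases h1 : r < 128
        · simp [h1]
        · have h2 : ¬ Ex.IsTemp r := by simp [Ex.IsTemp]; omega
          simpa [h1, h2] using this
      · exact hm
  refine ⟨t, State.embed 128 4 s₀ f, le_rfl, ?_, ?_, ?_⟩
  · have := (he.mono hw).shift 128 4 s₀
    rwa [h0] at this
  · rwa [hc]
  · rwa [hc]

end Wp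

end FineGrained

/-! ### The network and its maximum flows. -/

namespace FineGrained

/-! ### Maximum flows and cuts -/

/-- The value of a flow is at most the capacity of a cut. -/
theorem IsFlow.value_le_cut {V : Type*} [Fintype V] {cap : V → V → ℕ} {s t : V}
    {f : V → V → ℝ} (hf : IsFlow cap s t f) (S : V → Prop) [DecidablePred S] (hs : S s)
    (ht : ¬ S t) :
    flowValue f s ≤ ∑ u, ∑ v, if S u ∧ ¬ S v then (cap u v : ℝ) else 0 := by
  classical
  -- Sum the net outflow over all nodes of `S`: by conservation only `s` contributes, and flow
  -- between two nodes of `S` then cancels.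
  have h1 : flowValue f s = ∑ u, if S u then (∑ v, f u v - ∑ v, f v u) else 0 := by
    rw [Finset.sum_eq_single s]
    · simp [flowValue, hs]
    · intro u _ hu
      split_ifs with h
      · rw [hf.conservation u hu (by rintro rfl; exact ht h), sub_self]
      · rfl
    · simp
  have h2 : (∑ u, if S u then (∑ v, f u v - ∑ v, f v u) else 0) =
      ∑ u, ∑ v, ((if S u then f u v else 0) - (if S v then f u v else 0)) := by
    simp only [Finset.sum_sub_distrib]
    rw [Finset.sum_comm (f := fun u v => if S v then f u v else 0), ← Finset.sum_sub_distrib]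
    refine Finset.sum_congr rfl fun u _ => ?_
    split_ifs <;> simp
  rw [h1, h2]
  refine Finset.sum_le_sum fun u _ => Finset.sum_le_sum fun v _ => ?_
  have a := hf.nonneg u v
  have b := hf.le_cap u v
  by_cases hu : S u <;> by_cases hv : S v <;> simp [hu, hv, a, b]

/-- Flows are analysed on structured nodes, whereas the kPMF input has nodes `Fin n`; a bijection
carries maximum flows over. -/
theorem IsMaxFlow.congr {V W : Type*} [Fintype V] [Fintype W] (e : V ≃ W) {cap : V → V → ℕ}
    {cap' : W → W → ℕ} (hc : ∀ u v, cap u v = cap' (e u) (e v)) {s t : V} {x : ℝ}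
    (h : IsMaxFlow cap' (e s) (e t) x) : IsMaxFlow cap s t x := by
  have key : {y : ℝ | ∃ f : V → V → ℝ, IsFlow cap s t f ∧ flowValue f s = y} =
      {y : ℝ | ∃ f : W → W → ℝ, IsFlow cap' (e s) (e t) f ∧ flowValue f (e s) = y} := by
    ext y
    constructor
    · rintro ⟨f, hf, rfl⟩
      refine ⟨fun u v => f (e.symm u) (e.symm v), ⟨fun u v => hf.nonneg _ _, fun u v => ?_,
        fun v h1 h2 => ?_⟩, ?_⟩
      · simpa [hc] using hf.le_cap (e.symm u) (e.symm v)
      · rw [e.symm.sum_comp (fun u => f u (e.symm v)), e.symm.sum_comp (fun u => f (e.symm v) u)]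
        exact hf.conservation _ (fun h => h1 (by simp [← h])) (fun h => h2 (by simp [← h]))
      · simp only [flowValue, Equiv.symm_apply_apply]
        rw [e.symm.sum_comp (fun u => f s u), e.symm.sum_comp (fun u => f u s)]
    · rintro ⟨f, hf, rfl⟩
      refine ⟨fun u v => f (e u) (e v), ⟨fun u v => hf.nonneg _ _, fun u v => ?_,
        fun v h1 h2 => ?_⟩, ?_⟩
      · simpa [hc] using hf.le_cap (e u) (e v)
      · rw [e.sum_comp (fun u => f u (e v)), e.sum_comp (fun u => f (e v) u)]
        exact hf.conservation _ (fun h => h1 (e.injective h)) (fun h => h2 (e.injective h))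
      · simp only [flowValue]
        rw [e.sum_comp (fun u => f (e s) u), e.sum_comp (fun u => f u (e s))]
  unfold IsMaxFlow at h ⊢
  rwa [key]

/-! ### The network -/

/-- The nodes of the network: inner nodes `(g, j, b)`, sources and sinks. The inner nodes with
`b < 2` are the two entrances to block `g` for the slot `j`, those with `b = 2` its exits. -/
abbrev Node (G M A B : ℕ) := ((Fin G × Fin M) × Fin 3) ⊕ (Fin A ⊕ (Fin M × Fin B))

variable {G M A B : ℕ}

/-- The edges of the network. Every source `a` is joined to the entrance `s a g j` of each block and
slot; the entrances of a block are joined to all its exits; the sink `(t, b)` is reached from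
`M - t - 1` exits of each block, and from the entrances `(g, j, 0)` with `r b j`. -/
def Node.Adj (s : Fin A → Fin G → Fin M → Fin 3) (r : Fin B → Fin M → Prop) :
    Node G M A B → Node G M A B → Prop
  | .inl ((g, _), b), .inl ((g', _), b') => g = g' ∧ b ≠ 2 ∧ b' = 2
  | .inr (.inl a), .inl ((g, j), b) => b = s a g j
  | .inl ((_, j), b), .inr (.inr (t, y)) =>
    (b = 2 ∧ (j : ℕ) + t + 1 < M) ∨ (b = 0 ∧ r y j)
  | _, _ => False

open Classical in
/-- The number of slots of block `g` through which one can go directly from `a` to `(t, b)`. -/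
noncomputable def direct (s : Fin A → Fin G → Fin M → Fin 3) (r : Fin B → Fin M → Prop)
    (a : Fin A) (b : Fin B) (g : Fin G) : ℕ :=
  (Finset.univ.filter fun j => s a g j = 0 ∧ r b j).card

theorem card_exits (t : Fin M) :
    (Finset.univ.filter fun j : Fin M => (j : ℕ) + t + 1 < M).card = M - (t + 1) := by
  have := Fin.card_filter_val_lt (n := M) (m := M - (t + 1))
  rw [min_eq_right (by omega)] at this
  rw [← this]
  congr 1
  ext j
  simp only [Finset.mem_filter, Finset.mem_univ, true_and]
  omega

/-- A function on pairs of nodes that vanishes unless the pair is of the type of an edge. -/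
def Node.pairs (x : (Fin G × Fin M) × Fin 3 → (Fin G × Fin M) × Fin 3 → ℝ)
    (y : Fin A → (Fin G × Fin M) × Fin 3 → ℝ)
    (z : (Fin G × Fin M) × Fin 3 → Fin M × Fin B → ℝ) : Node G M A B → Node G M A B → ℝ
  | .inl u, .inl v => x u v
  | .inr (.inl a), .inl v => y a v
  | .inl u, .inr (.inr b) => z u b
  | _, _ => 0

open Classical in
theorem direct_le (s : Fin A → Fin G → Fin M → Fin 3) (r : Fin B → Fin M → Prop)
    (a : Fin A) (b : Fin B) (g : Fin G) : direct s r a b g ≤ M :=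
  (Finset.card_filter_le _ _).trans (by simp)

open Classical in
theorem sum_direct (s : Fin A → Fin G → Fin M → Fin 3) (r : Fin B → Fin M → Prop)
    (a : Fin A) (b : Fin B) (g : Fin G) :
    (∑ j : Fin M, if s a g j = 0 ∧ r b j then (1 : ℝ) else 0) = direct s r a b g := by
  rw [Finset.sum_boole]; rfl

theorem sum_exits (t : Fin M) (x : ℝ) :
    (∑ j : Fin M, if (j : ℕ) + t + 1 < M then x else 0) = ((M - (t + 1) : ℕ) : ℝ) * x := by
  rw [← Finset.sum_filter, Finset.sum_const, card_exits, nsmul_eq_mul]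

open Classical in
theorem sum_not_direct (s : Fin A → Fin G → Fin M → Fin 3) (r : Fin B → Fin M → Prop)
    (a : Fin A) (b : Fin B) (g : Fin G) (x : ℝ) :
    (∑ j : Fin M, if s a g j = 0 ∧ r b j then 0 else x) = ((M - direct s r a b g : ℕ) : ℝ) * x := by
  have h1 : (∑ j : Fin M, if s a g j = 0 ∧ r b j then (0 : ℝ) else x) =
      ∑ j : Fin M, (x - x * if s a g j = 0 ∧ r b j then 1 else 0) :=
    Finset.sum_congr rfl fun j _ => by split_ifs <;> simp
  rw [h1, Finset.sum_sub_distrib, ← Finset.mul_sum, sum_direct, Nat.cast_sub (direct_le s r a b g)]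
  simp only [Finset.sum_const, Finset.card_univ, Fintype.card_fin, nsmul_eq_mul]
  ring

-- The cut is chosen block by block. If `d g + w < M`, the exits of block `g` and the entrances used
-- by `a` go to the source side, which cuts the `w` exit edges and the `d g` direct edges into the
-- sink. Otherwise the block goes to the sink side and its `M` edges from `a` are cut. The other
-- sinks join the source side at no cost, having no outgoing edges.
open Classical in
theorem value_le_network (s : Fin A → Fin G → Fin M → Fin 3)
    (r : Fin B → Fin M → Prop) (a : Fin A) (t : Fin M) (b : Fin B) {f : Node G M A B → _ → ℝ}
    (hf : IsFlow (fun u v : Node G M A B => if Node.Adj s r u v then 1 else 0)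
      (.inr (.inl a)) (.inr (.inr (t, b))) f) :
    flowValue f (.inr (.inl a)) ≤
      ((∑ g, min M (direct s r a b g + (M - (t + 1))) : ℕ) : ℝ) := by
  set w : ℕ := M - (t + 1) with hw
  set d : Fin G → ℕ := direct s r a b with hd
  let S : Node G M A B → Prop := fun u => match u with
    | .inl ((g, j), b') => d g + w < M ∧ (b' = 2 ∨ b' = s a g j)
    | .inr (.inl a') => a' = a
    | .inr (.inr y) => y ≠ (t, b)
  refine (hf.value_le_cut S (by simp [S]) (by simp [S])).trans ?_
  -- Only edges leaving `a` or entering `(t, b)` can be cut, so the double sum collapses to sums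
  -- over one block.
  have key : ∀ u v : Node G M A B, (if S u ∧ ¬ S v then
      (((if Node.Adj s r u v then 1 else 0 : ℕ)) : ℝ) else 0) ≤
      Node.pairs (fun _ _ => 0)
        (fun a' x => if a' = a then if x.2 = s a x.1.1 x.1.2 then
          if d x.1.1 + w < M then 0 else 1 else 0 else 0)
        (fun x y => if y = (t, b) then if d x.1.1 + w < M then
          (if x.2 = 2 then if (x.1.2 : ℕ) + t + 1 < M then 1 else 0 else 0) +
          (if x.2 = 0 then if s a x.1.1 x.1.2 = 0 ∧ r b x.1.2 then 1 else 0 else 0)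
          else 0 else 0) u v := by
    rintro (⟨⟨g, j⟩, b'⟩ | a' | ⟨t', y⟩) (⟨⟨g', j'⟩, b''⟩ | a'' | ⟨t'', y'⟩)
    · simp only [S, Node.Adj, Node.pairs]
      by_cases h : g = g' ∧ b' ≠ 2 ∧ b'' = 2
      · obtain ⟨rfl, -, rfl⟩ := h
        by_cases h2 : d g + w < M <;> simp [h2]
      · simp only [h, if_false, Nat.cast_zero, ite_self, le_refl]
    · simp [Node.Adj, Node.pairs]
    · simp only [S, Node.Adj, Node.pairs]
      by_cases h : (t'', y') = (t, b)
      · simp only [h, if_true]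
        simp only [Prod.mk.injEq] at h
        obtain ⟨rfl, rfl⟩ := h
        by_cases h2 : d g + w < M
        · rcases eq_or_ne b' 2 with rfl | hb
          · simp [h2]
          · rcases eq_or_ne b' 0 with rfl | hb'
            · by_cases h3 : s a g j = 0
              · simp [h2, h3]
              · simp [h2, h3, Ne.symm h3]
            · simp [hb, hb']
        · simp [h2]
      · simp [h]
    · simp only [S, Node.Adj, Node.pairs]
      by_cases h : a' = a
      · subst h
        by_cases h2 : b'' = s a' g' j'
        · simp only [h2, or_true, and_true, true_and, if_true]
          split_ifs <;> simp
        · simp [h2]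
      · simp [h]
    all_goals simp [Node.Adj, Node.pairs]
  refine (Finset.sum_le_sum fun u _ => Finset.sum_le_sum fun v _ => key u v).trans (le_of_eq ?_)
  simp only [Fintype.sum_sum_type, Node.pairs, Finset.sum_const_zero, zero_add, add_zero,
    Finset.sum_ite_eq', Finset.mem_univ, if_true]
  rw [Finset.sum_comm (s := (Finset.univ : Finset (Fin A)))]
  simp only [Finset.sum_ite_eq', Finset.mem_univ, if_true]
  simp only [Fintype.sum_prod_type]
  rw [← Finset.sum_add_distrib, Nat.cast_sum]
  refine Finset.sum_congr rfl fun g _ => ?_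
  by_cases h2 : d g + w < M
  · simp only [h2, if_true, Finset.sum_add_distrib, Finset.sum_ite_eq', Finset.mem_univ,
      ite_self, Finset.sum_const_zero, add_zero]
    rw [sum_direct, sum_exits, min_eq_right h2.le]
    push_cast
    simp only [← hw, ← hd]
    ring
  · simp [h2, min_eq_left (not_lt.1 h2)]

-- Each of the `d g` direct paths of a block carries one unit. The other `c g` slots together send
-- `μ g = min (c g) w` units, spread evenly over their source edges, over all pairs of such an
-- entrance and an open exit, and over the `w` exit edges. Averaging, which real-valued flows
-- permit, avoids choosing a matching between entrances and exits.
set_option maxHeartbeats 1000000 in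
open Classical in
theorem exists_flow_network (s : Fin A → Fin G → Fin M → Fin 3) (hs : ∀ a g j, s a g j ≠ 2)
    (r : Fin B → Fin M → Prop) (a : Fin A) (t : Fin M) (b : Fin B) :
    ∃ f, IsFlow (fun u v : Node G M A B => if Node.Adj s r u v then 1 else 0)
      (.inr (.inl a)) (.inr (.inr (t, b))) f ∧ flowValue f (.inr (.inl a)) =
      ((∑ g, min M (direct s r a b g + (M - (t + 1))) : ℕ) : ℝ) := by
  have cardP := sum_direct s r a b
  have cardNP := sum_not_direct s r a b
  have cardW := sum_exits t
  have hdM := direct_le s r a b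
  set w : ℕ := M - (t + 1) with hw
  set d : Fin G → ℕ := direct s r a b with hd
  set c : Fin G → ℕ := fun g => M - d g with hc
  set μ : Fin G → ℝ := fun g => ((min (c g) w : ℕ) : ℝ) with hμ
  have hμ0 : ∀ g, 0 ≤ μ g := fun g => Nat.cast_nonneg _
  have hμc : ∀ g, μ g ≤ c g := fun g => Nat.cast_le.2 (min_le_left _ _)
  have hμw : ∀ g, μ g ≤ w := fun g => Nat.cast_le.2 (min_le_right _ _)
  -- When `c g` or `w` is zero, so is `μ g`; thus the convention for division by zero gives the
  -- correct empty flow here and below.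
  have hμc' : ∀ g, (c g : ℝ) * (μ g / c g) = μ g := by
    intro g
    by_cases h : (c g : ℝ) = 0
    · have : μ g = 0 := le_antisymm (h ▸ hμc g) (hμ0 g)
      simp [this]
    · field_simp
  have hμwc : ∀ g, (w : ℝ) * (μ g / (c g * w)) = μ g / c g := by
    intro g
    by_cases h : (w : ℝ) = 0
    · have : μ g = 0 := le_antisymm (h ▸ hμw g) (hμ0 g)
      simp [this]
    · field_simp
  have hμcw : ∀ g, (c g : ℝ) * (μ g / (c g * w)) = μ g / w := by
    intro g
    by_cases h : (c g : ℝ) = 0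
    · have : μ g = 0 := le_antisymm (h ▸ hμc g) (hμ0 g)
      simp [this]
    · field_simp
  have hval : ∀ g, (d g : ℝ) + μ g = ((min M (d g + w) : ℕ) : ℝ) := by
    intro g
    have := hdM g
    simp only [hμ, hc]
    norm_cast
    omega
  have div_le : ∀ x y : ℝ, 0 ≤ x → x ≤ y → x / y ≤ 1 := fun x y h0 h =>
    div_le_one_of_le₀ h (h0.trans h)
  have hν : ∀ g, μ g / (c g * w) ≤ 1 := by
    intro g
    rw [← div_div]
    by_cases hw0 : w = 0
    · simp [hw0]
    · refine (div_le_self (div_nonneg (hμ0 g) (Nat.cast_nonneg _)) ?_).trans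
        (div_le _ _ (hμ0 g) (hμc g))
      exact_mod_cast Nat.one_le_iff_ne_zero.2 hw0
  let f : Node G M A B → Node G M A B → ℝ := Node.pairs
    (fun x y => if x.1.1 = y.1.1 then if x.2 = s a x.1.1 x.1.2 then if y.2 = 2 then
      if (y.1.2 : ℕ) + t + 1 < M then if s a x.1.1 x.1.2 = 0 ∧ r b x.1.2 then 0 else
        μ x.1.1 / (c x.1.1 * w) else 0 else 0 else 0 else 0)
    (fun a' x => if a' = a then if x.2 = s a x.1.1 x.1.2 then
      (if s a x.1.1 x.1.2 = 0 ∧ r b x.1.2 then 1 else 0) +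
      (if s a x.1.1 x.1.2 = 0 ∧ r b x.1.2 then 0 else μ x.1.1 / c x.1.1) else 0 else 0)
    (fun x y => if y = (t, b) then if x.2 = 2 then
      if (x.1.2 : ℕ) + t + 1 < M then μ x.1.1 / w else 0
      else if x.2 = 0 then if s a x.1.1 x.1.2 = 0 ∧ r b x.1.2 then 1 else 0 else 0 else 0)
  refine ⟨f, ⟨?_, ?_, ?_⟩, ?_⟩
  · rintro (⟨⟨g, j⟩, b'⟩ | a' | ⟨t', y⟩) (⟨⟨g', j'⟩, b''⟩ | a'' | ⟨t'', y'⟩) <;>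
      simp only [f, Node.pairs] <;> try exact le_rfl
    · have := hμ0 g; split_ifs <;> positivity
    · have := hμ0 g; split_ifs <;> positivity
    · have := hμ0 g'; split_ifs <;> positivity
  · rintro (⟨⟨g, j⟩, b'⟩ | a' | ⟨t', y⟩) (⟨⟨g', j'⟩, b''⟩ | a'' | ⟨t'', y'⟩)
    · simp only [f, Node.Adj, Node.pairs]
      have h1 := hν g
      have h2 := hs a g j
      by_cases h : g = g' ∧ b' = s a g j ∧ b'' = 2
      · obtain ⟨rfl, rfl, rfl⟩ := h
        simp only [if_true, h2, ne_eq, not_false_eq_true, and_self, Nat.cast_one]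
        split_ifs <;> first | exact zero_le_one | exact h1
      · have : ∀ x : ℝ, (if g = g' then if b' = s a g j then if b'' = 2 then x else 0 else 0
            else 0) = 0 := by
          intro x; split_ifs <;> simp_all
        rw [this]; positivity
    · simp [f, Node.Adj, Node.pairs]
    · simp only [f, Node.Adj, Node.pairs]
      by_cases h : (t'', y') = (t, b)
      · simp only [h, if_true]
        simp only [Prod.mk.injEq] at h
        obtain ⟨rfl, rfl⟩ := h
        by_cases h2 : b' = 2
        · subst h2
          by_cases h3 : (j : ℕ) + t'' + 1 < M
          · simpa [h3] using div_le _ _ (hμ0 g) (hμw g)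
          · simp [h3]
        · by_cases h0 : b' = 0
          · subst h0
            by_cases h4 : s a g j = 0 ∧ r y' j
            · simp [h4]
            · simp only [h4, h2, if_false, if_true]; positivity
          · simp [h2, h0]
      · simp only [h, if_false]; positivity
    · simp only [f, Node.Adj, Node.pairs]
      by_cases h1 : a' = a
      · subst h1
        by_cases h2 : b'' = s a' g' j'
        · simp only [h2, if_true]
          split_ifs
          · simp
          · simpa using div_le _ _ (hμ0 g') (hμc g')
        · simp [h2]
      · simp only [h1, if_false]; positivity
    all_goals simp [f, Node.Adj, Node.pairs]
  · rintro (⟨⟨g, j⟩, b'⟩ | a' | ⟨t', y⟩) h1 h2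
    · simp only [Fintype.sum_sum_type, f, Node.pairs, Finset.sum_const_zero, zero_add, add_zero,
        Finset.sum_ite_eq', Finset.mem_univ, if_true]
      simp only [Fintype.sum_prod_type]
      rcases eq_or_ne b' 2 with rfl | hb
      · have h3 := (hs a g j).symm
        by_cases hj : (j : ℕ) + t + 1 < M
        · simp only [h3, hj, if_true, if_false, ite_self, Finset.sum_const_zero, zero_add,
            add_zero]
          rw [Finset.sum_eq_single g]
          · simp only [if_true, Finset.sum_ite_eq', Finset.mem_univ]
            rw [cardNP, hμcw]
          · intro g' _ hg'; simp [hg']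
          · simp
        · simp [hj, h3]
      · by_cases hb' : b' = s a g j
        · subst hb'
          simp only [hb, if_true, if_false, ite_self, Finset.sum_const_zero, zero_add]
          rw [Finset.sum_eq_single g]
          · simp only [if_true, Finset.sum_ite_eq', Finset.mem_univ]
            rw [cardW]
            by_cases hP : s a g j = 0 ∧ r b j
            · simp [hP]
            · simp only [hP, if_false, hμwc, ite_self]
              ring
          · intro g' _ hg'; simp [hg'.symm]
          · simp
        · simp only [hb', hb, if_false, ite_self, Finset.sum_const_zero, zero_add]
          symm
          by_cases h0 : b' = 0
          · subst h0
            simp [Ne.symm hb']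
          · simp [h0]
    · have : a' ≠ a := fun h => h1 (by rw [h])
      simp [Fintype.sum_sum_type, f, Node.pairs, this]
    · have : (t', y) ≠ (t, b) := fun h => h2 (by rw [h])
      simp only [Fintype.sum_sum_type, f, Node.pairs, this, if_false, Finset.sum_const_zero,
        add_zero]
  · simp only [flowValue, Fintype.sum_sum_type, f, Node.pairs, if_true, Finset.sum_const_zero,
      add_zero, sub_zero, Fintype.sum_prod_type, Finset.sum_ite_eq', Finset.mem_univ,
      Finset.sum_add_distrib]
    rw [← Finset.sum_add_distrib, Nat.cast_sum]
    refine Finset.sum_congr rfl fun g _ => ?_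
    rw [cardP, cardNP, hμc', hval]

open Classical in
theorem isMaxFlow_network (s : Fin A → Fin G → Fin M → Fin 3) (hs : ∀ a g j, s a g j ≠ 2)
    (r : Fin B → Fin M → Prop) (a : Fin A) (t : Fin M) (b : Fin B) :
    IsMaxFlow (fun u v : Node G M A B => if Node.Adj s r u v then 1 else 0)
      (.inr (.inl a)) (.inr (.inr (t, b)))
      ((∑ g, min M (direct s r a b g + (M - (t + 1))) : ℕ) : ℝ) := by
  refine ⟨exists_flow_network s hs r a t b, ?_⟩
  rintro x ⟨f, hf, rfl⟩
  exact value_le_network s r a t b hf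

end FineGrained

/-! ### From clause masks to a numbered digraph. -/

namespace FineGrained

/-! ### Assignments and clauses as bit masks -/

/-- The mask of the literals that are true under the assignment with the bits of `y` to the `l`
variables from `o` on, where the positive literals come `n` places after the negative ones. -/
def partialMask (n o l y : ℕ) : ℕ := (y * 2 ^ n + (2 ^ l - 1 - y)) * 2 ^ o

/-- `2 ^ l - 1 - y` is the bitwise complement of `y` within `l` bits. It is below `2 ^ n`, so it
does not overlap `y * 2 ^ n`. -/
theorem testBit_partialMask {n o l y : ℕ} (hy : y < 2 ^ l) (h : o + l ≤ n) (i : ℕ) :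
    (partialMask n o l y).testBit i =
      if i < o then false else if i - o < n then decide (i - o < l) && !y.testBit (i - o)
        else y.testBit (i - o - n) := by
  have hz : 2 ^ l - 1 - y = 2 ^ l - (y + 1) := by omega
  have hlt : 2 ^ l - (y + 1) < 2 ^ n :=
    lt_of_lt_of_le (by omega) (Nat.pow_le_pow_right (by norm_num) (by omega : l ≤ n))
  rw [partialMask, mul_comm, Nat.testBit_two_pow_mul, hz, mul_comm,
    Nat.testBit_two_pow_mul_add _ hlt, Nat.testBit_two_pow_sub_succ hy]
  by_cases h1 : i < o
  · simp [h1]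
  · simp [h1, not_lt.1 h1]

theorem testBit_add_mul {a x y : ℕ} (hx : x < 2 ^ a) (i : ℕ) :
    (x + 2 ^ a * y).testBit i = if i < a then x.testBit i else y.testBit (i - a) := by
  rw [add_comm, Nat.testBit_two_pow_mul_add _ hx]

/-- Concatenating assignments becomes the disjunction of their masks. Hence a clause is missed by
the whole assignment iff it is missed separately by the parts recorded at source, block and sink. -/
theorem partialMask_or {a b g x y z : ℕ} (hx : x < 2 ^ a) (hy : y < 2 ^ b) (hz : z < 2 ^ g) :
    partialMask (a + b + g) 0 a x ||| partialMask (a + b + g) (a + b) g z |||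
      partialMask (a + b + g) a b y =
    partialMask (a + b + g) 0 (a + b + g) (x + 2 ^ a * (y + 2 ^ b * z)) := by
  have hyz : y + 2 ^ b * z < 2 ^ (b + g) := by
    rw [pow_add]; nlinarith
  have hxyz : x + 2 ^ a * (y + 2 ^ b * z) < 2 ^ (a + b + g) := by
    rw [add_assoc, pow_add]; nlinarith
  refine Nat.eq_of_testBit_eq fun i => ?_
  rw [Nat.testBit_or, Nat.testBit_or, testBit_partialMask hx (by omega),
    testBit_partialMask hz (by omega), testBit_partialMask hy (by omega),
    testBit_partialMask hxyz (by omega), testBit_add_mul hx, testBit_add_mul hx,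
    testBit_add_mul hy, testBit_add_mul hy]
  have hX : ∀ i, a ≤ i → x.testBit i = false := fun i hi =>
    Nat.testBit_lt_two_pow (hx.trans_le (Nat.pow_le_pow_right (by norm_num) hi))
  have hY : ∀ i, b ≤ i → y.testBit i = false := fun i hi =>
    Nat.testBit_lt_two_pow (hy.trans_le (Nat.pow_le_pow_right (by norm_num) hi))
  have hZ : ∀ i, g ≤ i → z.testBit i = false := fun i hi =>
    Nat.testBit_lt_two_pow (hz.trans_le (Nat.pow_le_pow_right (by norm_num) hi))
  have e1 : i - a - b = i - (a + b) := by omega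
  have e2 : i - a - (a + b + g) - b = i - (a + b) - (a + b + g) := by omega
  have e3 : i - (a + b + g) - a = i - a - (a + b + g) := by omega
  simp only [Nat.sub_zero, e1, e3, e2]
  by_cases c1 : i < a
  · have : i < a + b + g := by omega
    have : i < a + b := by omega
    simp [*]
  by_cases c2 : i < a + b
  · have : i < a + b + g := by omega
    have : i - a < a + b + g := by omega
    have : i - a < b := by omega
    simp [*]
  by_cases c3 : i < a + b + g
  · have : i - a < a + b + g := by omega
    have : ¬ i - a < b := by omega
    have : i - (a + b) < a + b + g := by omega
    have : i - (a + b) < g := by omega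
    simp [*]
  by_cases c4 : i - (a + b + g) < a
  · have h1 : i - a < a + b + g ∨ ¬ i - a < a + b + g := by omega
    have : i - (a + b) < a + b + g := by omega
    have : ¬ i - (a + b) < g := by omega
    have : ¬ i - a < b := by omega
    have : i - a < a + b + g := by omega
    simp [*]
  have := hX _ (not_lt.1 c4)
  have : ¬ i - a < a + b + g := by omega
  by_cases c5 : i - a - (a + b + g) < b
  · have : i - (a + b) < a + b + g := by omega
    have : ¬ i - (a + b) < g := by omega
    simp [*]
  · have := hY _ (not_lt.1 c5)
    have : ¬ i - (a + b) < a + b + g := by omega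
    simp [*]

/-- The number of clauses in the list `ms` of clause masks that are satisfied by the assignment to
`n` variables with the bits of `x`. -/
def satCount (n : ℕ) (ms : List ℕ) (x : ℕ) : ℕ :=
  ms.countP fun c => decide (c &&& partialMask n 0 n x ≠ 0)

/-- The maximum number of satisfied clauses. -/
def maxCount (n : ℕ) (ms : List ℕ) : ℕ := (Finset.range (2 ^ n)).sup (satCount n ms)

/-! ### The digraph of a formula -/

/-- A list of clause masks, and the variables split into three groups. -/
structure Instance where
  ms : List ℕ
  a : ℕ
  b : ℕ
  g : ℕ

namespace Instance

variable (S : Instance)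

/-- The number of slots: one for each clause, and one that counts as an unsatisfiable clause. -/
def M : ℕ := S.ms.length + 1

/-- The number of inner nodes. -/
def X : ℕ := 2 ^ S.g * S.M * 3

/-- The number of nodes. -/
def nodes : ℕ := S.X + (2 ^ S.a + S.M * 2 ^ S.b)

def vars : ℕ := S.a + S.b + S.g

/-- The threshold. -/
def k : ℕ := S.M * 2 ^ S.g

def mask (j : ℕ) : ℕ := S.ms.getD j 0

def maskA (y : ℕ) : ℕ := partialMask S.vars 0 S.a y
def maskB (y : ℕ) : ℕ := partialMask S.vars S.a S.b y
def maskG (y : ℕ) : ℕ := partialMask S.vars (S.a + S.b) S.g y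

/-- The entrance that source `y` uses for slot `j` of block `z`. -/
def entrance (y z j : ℕ) : ℕ := if S.mask j &&& (S.maskA y ||| S.maskG z) = 0 then 0 else 1

/-- The edge between node `u` and inner node `x`. -/
def edgeAt (u x : ℕ) : Option (ℕ × ℕ) :=
  if u < S.X then
    if u / 3 / S.M = x / 3 / S.M ∧ u % 3 < 2 ∧ x % 3 = 2 then some (u, x) else none
  else if u < S.X + 2 ^ S.a then
    if x % 3 = S.entrance (u - S.X) (x / 3 / S.M) (x / 3 % S.M) then some (u, x) else none
  else if (x % 3 = 2 ∧ x / 3 % S.M + (u - (S.X + 2 ^ S.a)) / 2 ^ S.b + 1 < S.M) ∨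
      (x % 3 = 0 ∧ S.mask (x / 3 % S.M) &&& S.maskB ((u - (S.X + 2 ^ S.a)) % 2 ^ S.b) = 0)
    then some (x, u) else none

/-- The first edges, in the order in which they are written. -/
def edgesTo (e : ℕ) : List (ℕ × ℕ) :=
  (List.range e).filterMap fun i => S.edgeAt (i / S.X) (i % S.X)

theorem edgesTo_succ (e : ℕ) :
    S.edgesTo (e + 1) = S.edgesTo e ++ (S.edgeAt (e / S.X) (e % S.X)).toList := by
  rw [edgesTo, List.range_succ, List.filterMap_append]
  rw [edgesTo]
  cases h : S.edgeAt (e / S.X) (e % S.X) <;> simp [h]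

theorem length_edgesTo (e : ℕ) : (S.edgesTo e).length ≤ e :=
  (List.length_filterMap_le _ _).trans (by simp)

def edgeList : List (ℕ × ℕ) := S.edgesTo (S.nodes * S.X)

theorem M_pos : 0 < S.M := Nat.succ_pos _

theorem X_pos : 0 < S.X := by
  have := S.M_pos
  unfold X; positivity

/-- Every edge has an inner endpoint `x`, and an index `w * X + x` encodes the pair of any node `w`
with `x`. The edge leaves `w` if `w` is inner or a source, and enters `w` if `w` is a sink; these
are the two alternatives. -/
theorem mem_edgeList {u v : ℕ} : (u, v) ∈ S.edgeList ↔
    (u < S.X + 2 ^ S.a ∧ v < S.X ∧ S.edgeAt u v = some (u, v)) ∨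
    (S.X + 2 ^ S.a ≤ v ∧ v < S.nodes ∧ u < S.X ∧ S.edgeAt v u = some (u, v)) := by
  have hX := S.X_pos
  have hA := Nat.two_pow_pos S.a
  have key : ∀ u x, u < S.nodes → x < S.X → u * S.X + x < S.nodes * S.X ∧
      (u * S.X + x) / S.X = u ∧ (u * S.X + x) % S.X = x := by
    intro u x hu hx
    refine ⟨by nlinarith, ?_, ?_⟩
    · rw [mul_comm, Nat.mul_add_div hX, Nat.div_eq_of_lt hx, add_zero]
    · rw [mul_comm, Nat.mul_add_mod, Nat.mod_eq_of_lt hx]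
  simp only [edgeList, edgesTo, List.mem_filterMap, List.mem_range]
  constructor
  · rintro ⟨e, he, h⟩
    have h1 : e / S.X < S.nodes := Nat.div_lt_of_lt_mul (by rwa [mul_comm])
    have h2 : e % S.X < S.X := Nat.mod_lt _ hX
    set x := e % S.X
    set w := e / S.X
    have h0 := h
    unfold edgeAt at h
    by_cases c1 : w < S.X
    · rw [if_pos c1] at h
      split_ifs at h
      simp only [Option.some.injEq, Prod.mk.injEq] at h
      obtain ⟨rfl, rfl⟩ := h
      exact .inl ⟨by omega, h2, h0⟩
    · rw [if_neg c1] at h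
      by_cases c2 : w < S.X + 2 ^ S.a
      · rw [if_pos c2] at h
        split_ifs at h
        simp only [Option.some.injEq, Prod.mk.injEq] at h
        obtain ⟨rfl, rfl⟩ := h
        exact .inl ⟨by omega, h2, h0⟩
      · rw [if_neg c2] at h
        split_ifs at h
        simp only [Option.some.injEq, Prod.mk.injEq] at h
        obtain ⟨rfl, rfl⟩ := h
        exact .inr ⟨by omega, h1, h2, h0⟩
  · rintro (⟨h1, h2, h3⟩ | ⟨h1, h2, h3, h4⟩)
    · have hn : u < S.nodes := by
        have : 0 < S.M * 2 ^ S.b := Nat.mul_pos S.M_pos (by positivity)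
        unfold nodes; omega
      obtain ⟨e1, e2, e3⟩ := key u v hn h2
      exact ⟨_, e1, by rw [e2, e3, h3]⟩
    · obtain ⟨e1, e2, e3⟩ := key v u h2 h3
      exact ⟨_, e1, by rw [e2, e3, h4]⟩

theorem edgeList_lt {p : ℕ × ℕ} (hp : p ∈ S.edgeList) : p.1 < S.nodes ∧ p.2 < S.nodes := by
  obtain ⟨u, v⟩ := p
  have hA := Nat.two_pow_pos S.a
  have : 0 < S.M * 2 ^ S.b := Nat.mul_pos S.M_pos (by positivity)
  rcases S.mem_edgeList.1 hp with ⟨h1, h2, -⟩ | ⟨h1, h2, h3, -⟩ <;> simp only [nodes] at * <;> omega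

/-- Whether the head of an edge is an inner node reveals which endpoint was the quotient and which
the remainder, so the edge determines its index. -/
theorem nodup_edgeList : S.edgeList.Nodup := by
  have hX := S.X_pos
  refine List.Nodup.filterMap ?_ List.nodup_range
  have key : ∀ e (p : ℕ × ℕ), p ∈ S.edgeAt (e / S.X) (e % S.X) →
      (p.2 < S.X ∧ p.1 = e / S.X ∧ p.2 = e % S.X) ∨ (S.X ≤ p.2 ∧ p.1 = e % S.X ∧ p.2 = e / S.X) := by
    intro e p hp
    have h2 : e % S.X < S.X := Nat.mod_lt _ hX
    unfold edgeAt at hp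
    split_ifs at hp <;> simp only [Option.mem_def, Option.some.injEq, reduceCtorEq] at hp <;>
      subst hp
    · exact .inl ⟨h2, rfl, rfl⟩
    · exact .inl ⟨h2, rfl, rfl⟩
    · exact .inr ⟨by simp only; omega, rfl, rfl⟩
  intro e e' p hp hp'
  rcases key e p hp with ⟨h1, h2, h3⟩ | ⟨h1, h2, h3⟩ <;>
    rcases key e' p hp' with ⟨h1', h2', h3'⟩ | ⟨h1', h2', h3'⟩
  · rw [← Nat.div_add_mod e S.X, ← Nat.div_add_mod e' S.X, ← h2, ← h3, h2', h3']
  · omega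
  · omega
  · rw [← Nat.div_add_mod e S.X, ← Nat.div_add_mod e' S.X, ← h2, ← h3, h2', h3']

/-- The digraph of the instance. -/
def digraph : EdgeListDigraph where
  n := S.nodes
  edges := S.edgeList.pmap (fun p h => (⟨p.1, h.1⟩, ⟨p.2, h.2⟩)) fun _ => S.edgeList_lt
  nodup := by
    refine List.Nodup.pmap ?_ S.nodup_edgeList
    rintro ⟨a, b⟩ h ⟨a', b'⟩ h' heq
    simpa using heq
  loopless := by
    simp only [List.mem_pmap]
    rintro _ ⟨⟨u, v⟩, hp, rfl⟩ h
    simp only [Fin.mk.injEq] at h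
    subst h
    have hA := Nat.two_pow_pos S.a
    rcases S.mem_edgeList.1 hp with ⟨h1, h2, h3⟩ | ⟨h1, h2, h3, -⟩
    · simp only [edgeAt, h2, if_true] at h3
      split_ifs at h3 with h
      omega
    · omega

theorem encode_digraph (k : ℕ) : S.digraph.encode k =
    S.nodes :: k :: S.edgeList.length :: S.edgeList.flatMap fun p => [p.1, p.2] := by
  unfold EdgeListDigraph.encode EdgeListDigraph.m digraph
  simp only [List.length_pmap, List.cons.injEq, true_and]
  rw [List.flatMap_def, List.flatMap_def, List.map_pmap]
  exact congrArg _ (List.pmap_eq_map (f := fun q : ℕ × ℕ => [q.1, q.2]) _)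

abbrev NodeT := Node (2 ^ S.g) S.M (2 ^ S.a) (2 ^ S.b)

/-- The numbering of the nodes. -/
def number : S.NodeT ≃ Fin S.nodes :=
  (Equiv.sumCongr ((Equiv.prodCongr finProdFinEquiv (Equiv.refl _)).trans finProdFinEquiv)
    ((Equiv.sumCongr (Equiv.refl _) finProdFinEquiv).trans finSumFinEquiv)).trans finSumFinEquiv

theorem number_inner (z : Fin (2 ^ S.g)) (j : Fin S.M) (b : Fin 3) :
    (S.number (.inl ((z, j), b)) : ℕ) = b + 3 * (j + S.M * z) := rfl

theorem number_source (y : Fin (2 ^ S.a)) : (S.number (.inr (.inl y)) : ℕ) = S.X + y := rfl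

theorem number_sink (t : Fin S.M) (y : Fin (2 ^ S.b)) :
    (S.number (.inr (.inr (t, y))) : ℕ) = S.X + (2 ^ S.a + (y + 2 ^ S.b * t)) := rfl

theorem number_inner_lt (x) : (S.number (.inl x) : ℕ) < S.X := by
  have : (S.number (.inl x) : ℕ) = ((Equiv.prodCongr finProdFinEquiv (Equiv.refl _)).trans
    finProdFinEquiv x : Fin (2 ^ S.g * S.M * 3)) := rfl
  rw [this]
  exact Fin.is_lt _

def entranceFin (y : Fin (2 ^ S.a)) (z : Fin (2 ^ S.g)) (j : Fin S.M) : Fin 3 :=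
  if S.mask j &&& (S.maskA y ||| S.maskG z) = 0 then 0 else 1

theorem entranceFin_val (y : Fin (2 ^ S.a)) (z : Fin (2 ^ S.g)) (j : Fin S.M) :
    (S.entranceFin y z j : ℕ) = S.entrance y z j := by
  unfold entranceFin entrance; split_ifs <;> rfl

theorem entranceFin_ne (y : Fin (2 ^ S.a)) (z : Fin (2 ^ S.g)) (j : Fin S.M) :
    S.entranceFin y z j ≠ 2 := by
  unfold entranceFin; split_ifs <;> decide

def missed (y : Fin (2 ^ S.b)) (j : Fin S.M) : Prop := S.mask j &&& S.maskB y = 0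

/-- The quotients and remainders in `edgeAt` invert the numbering: modulo `3` gives the kind of an
inner node, then division by `M` separates block and slot, while division by `2 ^ b` separates the
two components of a sink. -/
theorem adj_iff (u v : S.NodeT) :
    ((S.number u : ℕ), (S.number v : ℕ)) ∈ S.edgeList ↔ Node.Adj S.entranceFin S.missed u v := by
  have hM := S.M_pos
  have e0 : ∀ (z : Fin (2 ^ S.g)) (j : Fin S.M) (b : Fin 3),
      ((b : ℕ) + 3 * (j + S.M * z)) % 3 = b := by
    intro z j b; rw [Nat.add_mul_mod_self_left, Nat.mod_eq_of_lt b.2]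
  have e1 : ∀ (z : Fin (2 ^ S.g)) (j : Fin S.M) (b : Fin 3),
      ((b : ℕ) + 3 * (j + S.M * z)) / 3 = j + S.M * z := by
    intro z j b; rw [Nat.add_mul_div_left _ _ (by norm_num), Nat.div_eq_of_lt b.2, zero_add]
  have e2 : ∀ (z : Fin (2 ^ S.g)) (j : Fin S.M), ((j : ℕ) + S.M * z) / S.M = z := by
    intro z j; rw [Nat.add_mul_div_left _ _ hM, Nat.div_eq_of_lt j.2, zero_add]
  have e3 : ∀ (z : Fin (2 ^ S.g)) (j : Fin S.M), ((j : ℕ) + S.M * z) % S.M = j := by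
    intro z j; rw [Nat.add_mul_mod_self_left, Nat.mod_eq_of_lt j.2]
  have e4 : ∀ (t : Fin S.M) (y : Fin (2 ^ S.b)), ((y : ℕ) + 2 ^ S.b * t) / 2 ^ S.b = t := by
    intro t y
    rw [Nat.add_mul_div_left _ _ (by positivity), Nat.div_eq_of_lt y.2, zero_add]
  have e5 : ∀ (t : Fin S.M) (y : Fin (2 ^ S.b)), ((y : ℕ) + 2 ^ S.b * t) % 2 ^ S.b = y := by
    intro t y; rw [Nat.add_mul_mod_self_left, Nat.mod_eq_of_lt y.2]
  have hA := Nat.two_pow_pos S.a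
  have hif : ∀ (c : Prop) [Decidable c] (p : ℕ × ℕ),
      (if c then some p else none) = some p ↔ c := by intros; simp
  rw [S.mem_edgeList]
  rcases u with ⟨⟨z, j⟩, b⟩ | y | ⟨t, y⟩ <;> rcases v with ⟨⟨z', j'⟩, b'⟩ | y' | ⟨t', y'⟩ <;>
    simp only [Node.Adj, iff_false]
  · have h1 := S.number_inner_lt ((z, j), b)
    have h2 := S.number_inner_lt ((z', j'), b')
    have h4 : ((b : ℕ) < 2 ↔ b ≠ 2) := by omega
    have h5 : ((b' : ℕ) = 2 ↔ b' = 2) := by omega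
    have h6 : ¬ S.X + 2 ^ S.a ≤ (S.number (.inl ((z', j'), b')) : ℕ) := by omega
    simp only [h2, h6, true_and, false_and, or_false, edgeAt, h1, if_true, Nat.lt_add_right,
      hif]
    rw [S.number_inner, S.number_inner, e0, e0, e1, e1, e2, e2, h4, h5, ← Fin.ext_iff]
  · have h1 := S.number_inner_lt ((z, j), b)
    have h2 := S.number_source y'
    rintro (h | h) <;> omega
  · have h1 := S.number_inner_lt ((z, j), b)
    have h2 := S.number_sink t' y'
    have h3 := (S.number (.inr (.inr (t', y')))).2
    have c1 : ¬ (S.number (.inr (.inr (t', y'))) : ℕ) < S.X := by omega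
    have c2 : ¬ (S.number (.inr (.inr (t', y'))) : ℕ) < S.X + 2 ^ S.a := by omega
    have c3 : (S.number (.inr (.inr (t', y'))) : ℕ) - (S.X + 2 ^ S.a) = y' + 2 ^ S.b * t' := by
      omega
    simp only [h3, not_lt.1 c2, c1, c2, h1, c3, edgeAt, e4, e5, if_false, true_and, false_and,
      and_false, false_or, hif]
    rw [S.number_inner, e0, e1, e3]
    have h5 : ((b : ℕ) = 2 ↔ b = 2) := by omega
    have h6 : ((b : ℕ) = 0 ↔ b = 0) := by omega
    rw [h5, h6]
    rfl
  · have h1 := S.number_inner_lt ((z', j'), b')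
    have h2 := S.number_source y
    have h3 := y.2
    have c1 : ¬ (S.number (.inr (.inl y)) : ℕ) < S.X := by omega
    have c2 : (S.number (.inr (.inl y)) : ℕ) < S.X + 2 ^ S.a := by omega
    have c3 : (S.number (.inr (.inl y)) : ℕ) - S.X = y := by omega
    have c4 : ¬ S.X + 2 ^ S.a ≤ (S.number (.inl ((z', j'), b')) : ℕ) := by omega
    simp only [c2, h1, c1, c4, c3, edgeAt, if_true, if_false, true_and, false_and, or_false,
      hif]
    rw [S.number_inner, e0, e1, e2, e3, ← S.entranceFin_val, ← Fin.ext_iff]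
  · have h2 := S.number_source y
    have h1 := S.number_source y'
    rintro (h | h) <;> omega
  · have h2 := S.number_source y
    have h1 := S.number_sink t' y'
    rintro (h | h) <;> omega
  · have h2 := S.number_sink t y
    have h1 := S.number_inner_lt ((z', j'), b')
    rintro (h | h) <;> omega
  · have h2 := S.number_sink t y
    have h1 := S.number_source y'
    rintro (h | h) <;> omega
  · have h2 := S.number_sink t y
    have h1 := S.number_sink t' y'
    rintro (h | h) <;> omega

theorem isMaxFlow_digraph (y : Fin (2 ^ S.a)) (t : Fin S.M) (y' : Fin (2 ^ S.b)) :
    IsMaxFlow S.digraph.unitCap (S.number (.inr (.inl y))) (S.number (.inr (.inr (t, y'))))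
      ((∑ z, min S.M (direct S.entranceFin S.missed y y' z + (S.M - (t + 1))) : ℕ) : ℝ) := by
  classical
  refine IsMaxFlow.congr S.number.symm (cap' := fun u v =>
    if Node.Adj S.entranceFin S.missed u v then 1 else 0) (fun u v => ?_) ?_
  · unfold EdgeListDigraph.unitCap
    refine if_congr ?_ rfl rfl
    rw [← S.adj_iff, Equiv.apply_symm_apply, Equiv.apply_symm_apply]
    change (u, v) ∈ List.pmap _ _ _ ↔ _
    rw [List.mem_pmap]
    constructor
    · rintro ⟨p, hp, h⟩
      have h1 := congrArg Prod.fst h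
      have h2 := congrArg Prod.snd h
      simp only at h1 h2
      rw [← h1, ← h2]
      exact hp
    · intro h
      exact ⟨_, h, rfl⟩
  · rw [Equiv.symm_apply_apply, Equiv.symm_apply_apply]
    exact isMaxFlow_network S.entranceFin S.entranceFin_ne S.missed y t y'

/-- A direct slot is exactly a clause missed by the combined assignment. The total is one more than
the number of clauses because the extra slot is always direct. -/
theorem direct_add_satCount (y : Fin (2 ^ S.a)) (y' : Fin (2 ^ S.b)) (z : Fin (2 ^ S.g)) :
    direct S.entranceFin S.missed y y' z +
      satCount S.vars S.ms (y + 2 ^ S.a * (y' + 2 ^ S.b * z)) = S.M := by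
  have hm := partialMask_or y.2 y'.2 z.2
  set f := partialMask S.vars 0 S.vars (y + 2 ^ S.a * (y' + 2 ^ S.b * z)) with hf
  have h1 : ∀ j : Fin S.M, (S.entranceFin y z j = 0 ∧ S.missed y' j) ↔ S.mask j &&& f = 0 := by
    intro j
    have : S.entranceFin y z j = 0 ↔ S.mask j &&& (S.maskA y ||| S.maskG z) = 0 := by
      unfold entranceFin; split_ifs <;> simp_all
    rw [this, missed, hf, vars, ← hm, Nat.and_or_distrib_left _ (_ ||| _), Nat.or_eq_zero_iff]
    rfl
  have h2 : ∀ ms : List ℕ, (∑ j ∈ Finset.range ms.length,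
      if ms.getD j 0 &&& f = 0 then 1 else 0) + ms.countP (fun c => decide (c &&& f ≠ 0)) =
      ms.length := by
    intro ms
    induction ms using List.reverseRecOn with
    | nil => simp
    | append_singleton l c ih =>
      rw [List.length_append, List.length_singleton, Finset.sum_range_succ, List.countP_append]
      have h3 : ∀ j ∈ Finset.range l.length, (if (l ++ [c]).getD j 0 &&& f = 0 then 1 else 0) =
          if l.getD j 0 &&& f = 0 then 1 else 0 := by
        intro j hj
        rw [List.getD_append _ _ _ _ (Finset.mem_range.1 hj)]
      rw [Finset.sum_congr rfl h3]
      have h4 : (l ++ [c]).getD l.length 0 = c := by simp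
      rw [h4]
      by_cases hc : c &&& f = 0
      · simp only [hc, if_true]
        have : List.countP (fun c => decide (c &&& f ≠ 0)) [c] = 0 := by simp [hc]
        omega
      · simp only [hc, if_false]
        have : List.countP (fun c => decide (c &&& f ≠ 0)) [c] = 1 := by simp [hc]
        omega
  have hd : direct S.entranceFin S.missed y y' z =
      (Finset.univ.filter fun j : Fin S.M => S.mask j &&& f = 0).card := by
    unfold direct
    congr 1
    ext j
    simp only [Finset.mem_filter, h1]
  have h0 : satCount S.vars S.ms (y + 2 ^ S.a * (y' + 2 ^ S.b * z)) =
    S.ms.countP (fun c => decide (c &&& f ≠ 0)) := rfl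
  rw [h0, hd, Finset.card_filter,
    Fin.sum_univ_eq_sum_range (fun j => if S.mask j &&& f = 0 then 1 else 0)]
  have h5 := h2 S.ms
  -- The default value `0` beyond the end of the list is the mask of the empty clause.
  have h6 : S.mask S.ms.length = 0 := by simp [mask]
  rw [M, Finset.sum_range_succ, h6]
  simp only [Nat.zero_and, if_true, mask]
  linarith

/-- The update for one triple of the output of kPMF. -/
def scanStep (acc : ℕ) (e : ℕ × ℕ × ℕ) : ℕ :=
  if S.X ≤ e.1 ∧ e.1 < S.X + 2 ^ S.a ∧ S.X + 2 ^ S.a ≤ e.2.1 ∧ e.2.2 < S.k ∧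
    acc < S.M - (e.2.1 - (S.X + 2 ^ S.a)) / 2 ^ S.b
  then S.M - (e.2.1 - (S.X + 2 ^ S.a)) / 2 ^ S.b else acc

def scan (L : List (ℕ × ℕ × ℕ)) : ℕ := L.foldl S.scanStep 0

/-- The triple shows that some assignment satisfies `v` clauses. -/
def Shows (v : ℕ) (e : ℕ × ℕ × ℕ) : Prop :=
  S.X ≤ e.1 ∧ e.1 < S.X + 2 ^ S.a ∧ S.X + 2 ^ S.a ≤ e.2.1 ∧ e.2.2 < S.k ∧
    v = S.M - (e.2.1 - (S.X + 2 ^ S.a)) / 2 ^ S.b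

theorem scan_spec (L : List (ℕ × ℕ × ℕ)) :
    (∀ v, ∀ e ∈ L, S.Shows v e → v ≤ S.scan L) ∧
      (S.scan L = 0 ∨ ∃ e ∈ L, S.Shows (S.scan L) e) := by
  induction L using List.reverseRecOn with
  | nil => simp [scan]
  | append_singleton L e ih =>
    have h1 : S.scan (L ++ [e]) = S.scanStep (S.scan L) e := by simp [scan]
    have h2 : S.scan L ≤ S.scanStep (S.scan L) e := by
      unfold scanStep; split_ifs <;> omega
    rw [h1]
    constructor
    · intro v e' he' hv
      rw [List.mem_append, List.mem_singleton] at he'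
      rcases he' with he' | rfl
      · exact (ih.1 v e' he' hv).trans h2
      · obtain ⟨a1, a2, a3, a4, rfl⟩ := hv
        unfold scanStep
        split_ifs with h
        · exact le_rfl
        · simp only [a1, a2, a3, a4, true_and, not_lt] at h
          exact h
    · by_cases h : S.scanStep (S.scan L) e = S.scan L
      · rw [h]
        exact ih.2.imp id fun ⟨e', he', h'⟩ => ⟨e', by simp [he'], h'⟩
      · refine .inr ⟨e, by simp, ?_⟩
        unfold scanStep at h ⊢
        split_ifs at h ⊢ with h3
        · exact ⟨h3.1, h3.2.1, h3.2.2.1, h3.2.2.2.1, rfl⟩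
        · exact absurd rfl h

/-- A flow below `k` exhibits an assignment satisfying at least `M - t` clauses, so the scan never
overshoots. Conversely, an assignment that misses `t` slots shows up at the sink with this `t`. -/
theorem scan_eq_maxCount {L : List (Fin S.nodes × Fin S.nodes × ℕ)}
    (hL : ∀ (u v : Fin S.digraph.n) (F : ℕ),
      (u, v, F) ∈ L ↔ u ≠ v ∧ F ≤ S.k ∧ IsMaxFlow S.digraph.unitCap u v (F : ℝ)) :
    S.scan (L.map fun e => ((e.1 : ℕ), (e.2.1 : ℕ), e.2.2)) = maxCount S.vars S.ms := by
  obtain ⟨h1, h2⟩ := S.scan_spec (L.map fun e => ((e.1 : ℕ), (e.2.1 : ℕ), e.2.2))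
  set v := S.scan (L.map fun e => ((e.1 : ℕ), (e.2.1 : ℕ), e.2.2))
  -- No block carries more than `M`, so the sum falls below `k` iff some block is not saturated,
  -- that is, `d z + (M - t - 1) < M`.
  have hsum : ∀ d : Fin (2 ^ S.g) → ℕ, ∀ t : Fin S.M,
      (∑ z, min S.M (d z + (S.M - (t + 1))) < S.k ↔ ∃ z, d z ≤ t) := by
    intro d t
    have hk : S.k = ∑ _z : Fin (2 ^ S.g), S.M := by simp [k, mul_comm]
    constructor
    · intro h
      by_contra! hc
      refine absurd h (not_lt.2 ?_)
      rw [hk]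
      exact Finset.sum_le_sum fun z _ => by have := hc z; omega
    · rintro ⟨z, hz⟩
      rw [hk]
      exact Finset.sum_lt_sum (fun z _ => min_le_left _ _) ⟨z, Finset.mem_univ _, by omega⟩
  have hle : ∀ d : Fin (2 ^ S.g) → ℕ, ∀ t : Fin S.M,
      ∑ z, min S.M (d z + (S.M - (t + 1))) ≤ S.k := by
    intro d t
    have hk : S.k = ∑ _z : Fin (2 ^ S.g), S.M := by simp [k, mul_comm]
    rw [hk]
    exact Finset.sum_le_sum fun z _ => min_le_left _ _
  have hA := Nat.two_pow_pos S.a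
  have hpow : 2 ^ S.vars = 2 ^ S.a * (2 ^ S.b * 2 ^ S.g) := by
    rw [vars, pow_add, pow_add, mul_assoc]
  apply le_antisymm
  · rcases h2 with h2 | ⟨e, he, s1, s2, s3, s4, s5⟩
    · rw [h2]; exact Nat.zero_le _
    · simp only [List.mem_map] at he
      obtain ⟨⟨u, w, F⟩, hm, rfl⟩ := he
      simp only at s1 s2 s3 s4 s5
      obtain ⟨-, -, hF⟩ := (hL u w F).1 hm
      have hw := w.2
      have hq : ((w : ℕ) - (S.X + 2 ^ S.a)) / 2 ^ S.b < S.M := by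
        refine Nat.div_lt_of_lt_mul ?_
        have : S.nodes = S.X + (2 ^ S.a + S.M * 2 ^ S.b) := rfl
        rw [mul_comm]; omega
      have hr : ((w : ℕ) - (S.X + 2 ^ S.a)) % 2 ^ S.b < 2 ^ S.b := Nat.mod_lt _ (by positivity)
      let y : Fin (2 ^ S.a) := ⟨u - S.X, by omega⟩
      let t : Fin S.M := ⟨_, hq⟩
      let y' : Fin (2 ^ S.b) := ⟨_, hr⟩
      have hu : u = S.number (.inr (.inl y)) := by
        apply Fin.ext; rw [S.number_source]; simp only [y]; omega
      have hw' : w = S.number (.inr (.inr (t, y'))) := by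
        apply Fin.ext; rw [S.number_sink]; simp only [t, y']
        have := Nat.mod_add_div ((w : ℕ) - (S.X + 2 ^ S.a)) (2 ^ S.b)
        omega
      rw [hu, hw'] at hF
      have hF' := IsGreatest.unique hF (S.isMaxFlow_digraph y t y')
      norm_cast at hF'
      rw [hF', hsum] at s4
      obtain ⟨z, hz⟩ := s4
      have hd := S.direct_add_satCount y y' z
      have ht : (t : ℕ) = ((w : ℕ) - (S.X + 2 ^ S.a)) / 2 ^ S.b := rfl
      have hx : (y : ℕ) + 2 ^ S.a * (y' + 2 ^ S.b * z) ∈ Finset.range (2 ^ S.vars) := by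
        rw [Finset.mem_range, hpow]
        have a1 : (y' : ℕ) + 2 ^ S.b * z < 2 ^ S.b * 2 ^ S.g := by
          have := y'.2; have := z.2; nlinarith
        have := y.2; nlinarith
      refine le_trans ?_ (Finset.le_sup hx)
      omega
  · refine Finset.sup_le fun x hx => ?_
    rw [Finset.mem_range, hpow] at hx
    let y : Fin (2 ^ S.a) := ⟨x % 2 ^ S.a, Nat.mod_lt _ (by positivity)⟩
    let y' : Fin (2 ^ S.b) := ⟨x / 2 ^ S.a % 2 ^ S.b, Nat.mod_lt _ (by positivity)⟩
    let z : Fin (2 ^ S.g) := ⟨x / 2 ^ S.a / 2 ^ S.b,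
      Nat.div_lt_of_lt_mul (Nat.div_lt_of_lt_mul hx)⟩
    have hxe : (y : ℕ) + 2 ^ S.a * (y' + 2 ^ S.b * z) = x := by
      simp only [y, y', z, Nat.mod_add_div]
    have hd := S.direct_add_satCount y y' z
    rw [hxe] at hd
    rcases Nat.eq_zero_or_pos (satCount S.vars S.ms x) with h0 | hpos
    · rw [h0]; exact Nat.zero_le _
    -- This index is less than `M` precisely because at least one clause is satisfied; the value `0`
    -- is already the starting value of the scan.
    · let t : Fin S.M := ⟨direct S.entranceFin S.missed y y' z, by omega⟩
      have hlt := (hsum (direct S.entranceFin S.missed y y') t).2 ⟨z, le_rfl⟩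
      have hm := (hL (S.number (.inr (.inl y))) (S.number (.inr (.inr (t, y')))) _).2
        ⟨S.number.injective.ne (by simp), hle _ t, S.isMaxFlow_digraph y t y'⟩
      refine h1 _ _ (List.mem_map_of_mem hm) ⟨?_, ?_, ?_, hlt, ?_⟩
      · simp only [S.number_source]; omega
      · simp only [S.number_source]; have := y.2; omega
      · simp only [S.number_sink]; omega
      · have e1 : S.X + (2 ^ S.a + ((y' : ℕ) + 2 ^ S.b * t)) - (S.X + 2 ^ S.a) =
            y' + 2 ^ S.b * t := by omega
        simp only [S.number_sink, e1]
        rw [Nat.add_mul_div_left _ _ (by positivity), Nat.div_eq_of_lt y'.2, zero_add]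
        simp only [t]
        omega

end Instance

end FineGrained

/-! ### The program of the reduction and its verification. -/

namespace FineGrained

/-! ### Symbolic execution -/

@[simp] theorem State.reg_setReg (s : State) (r v r' : ℕ) :
    (s.setReg r v).reg r' = if r' = r then v else s.reg r' := by
  simp [State.setReg, Function.update_apply]

@[simp] theorem State.mem_setReg (s : State) (r v : ℕ) : (s.setReg r v).mem = s.mem := rfl

@[simp] theorem State.reg_setMem (s : State) (A i v : ℕ) : (s.setMem A i v).reg = s.reg := rfl

theorem State.mem_setMem (s : State) (A i v A' : ℕ) :
    (s.setMem A i v).mem A' = if A' = A then Function.update (s.mem A) i v else s.mem A' := by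
  simp [State.setMem, Function.update_apply]

theorem Wp.assign_cons {h x T : ℕ} {e : Ex} {l : List Program} {s : State} {Q : State → Prop}
    (hh : 2 ≤ h) (hv : e.val s < 2 ^ h) (H : Wp h (block l) T (s.setReg x (e.val s)) Q)
    (hx : ¬ Ex.IsTemp x := by decide) (he : e.wf 4 = true := by decide)
    (hsz : e.size ≤ 60 := by decide) :
    Wp h (block (FineGrained.assign x e :: l)) (e.size + 1 + T) s Q :=
  Wp.cons (Wp.assign (by omega) 4 ((by norm_num : 4 ≤ 2 ^ 2).trans
    (Nat.pow_le_pow_right (by norm_num) hh)) hx he hsz hv H)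

theorem Wp.assignPow_cons {h x T : ℕ} {e : Ex} {l : List Program} {s : State} {Q : State → Prop}
    (hh : 2 ≤ h) (hv : e.val s < h) (H : Wp h (block l) T (s.setReg x (2 ^ e.val s)) Q)
    (hx : ¬ Ex.IsTemp x := by decide) (he : e.wf 4 = true := by decide)
    (hsz : e.size ≤ 60 := by decide) :
    Wp h (block (FineGrained.assignPow x e :: l)) (e.size + 2 + T) s Q :=
  Wp.cons (Wp.assignPow (by omega) 4 ((by norm_num : 4 ≤ 2 ^ 2).trans
    (Nat.pow_le_pow_right (by norm_num) hh)) hx he hsz hv H)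

theorem Wp.put_cons {h A T : ℕ} {e f : Ex} {l : List Program} {s : State} {Q : State → Prop}
    (hh : 2 ≤ h) (hv : f.val s < 2 ^ h)
    (H : Wp h (block l) T (s.setMem A (e.val s) (f.val s)) Q)
    (he : e.wf 4 = true := by decide) (hf : f.wf 4 = true := by decide)
    (hsz : e.size ≤ 60 := by decide) (hsz' : f.size ≤ 60 := by decide) :
    Wp h (block (FineGrained.put A e f :: l)) (e.size + f.size + 1 + T) s Q :=
  Wp.cons (Wp.put (by omega) 4 ((by norm_num : 4 ≤ 2 ^ 2).trans
    (Nat.pow_le_pow_right (by norm_num) hh)) he hf hsz hsz' hv H)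

theorem Wp.cond' {h T : ℕ} {e : Ex} {p q : Program} {s : State} {Q : State → Prop}
    (hh : 2 ≤ h) (Hp : e.val s ≠ 0 → Wp h p T s Q) (Hq : e.val s = 0 → Wp h q T s Q)
    (he : e.wf 4 = true := by decide) (hsz : e.size ≤ 60 := by decide) :
    Wp h (FineGrained.cond e p q) (e.size + T + 1) s Q :=
  Wp.cond (by omega) 4 ((by norm_num : 4 ≤ 2 ^ 2).trans
    (Nat.pow_le_pow_right (by norm_num) hh)) he hsz Hp Hq

/-! ### Reading the formula -/

/-- The mask of a clause that is given as a list of words. -/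
def clauseMask (n : ℕ) (C : List ℕ) : ℕ :=
  C.foldl (fun c l => c ||| 2 ^ (l / 2 + l % 2 * n)) 0

/-- Append a mask, unless it is a duplicate and duplicates are to be removed. -/
def keep (dd : Bool) (ms : List ℕ) (c : ℕ) : List ℕ :=
  if dd = true ∧ c ∈ ms then ms else ms ++ [c]

/-- The masks of the clauses, without duplicates if `dd`. -/
def keptMasks (dd : Bool) (n : ℕ) (Cs : List (List ℕ)) : List ℕ :=
  (Cs.map (clauseMask n)).foldl (keep dd) []

theorem keptMasks_append (dd : Bool) (n : ℕ) (Cs : List (List ℕ)) (C : List ℕ) :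
    keptMasks dd n (Cs ++ [C]) = keep dd (keptMasks dd n Cs) (clauseMask n C) := by
  simp [keptMasks]

theorem length_keptMasks_le (dd : Bool) (n : ℕ) (Cs : List (List ℕ)) :
    (keptMasks dd n Cs).length ≤ Cs.length := by
  induction Cs using List.reverseRecOn with
  | nil => simp [keptMasks]
  | append_singleton Cs C ih =>
    rw [keptMasks_append, keep]
    split_ifs <;> simp <;> omega

/-- A formula as a list of words. -/
def encodeWords (n : ℕ) (Cs : List (List ℕ)) : List ℕ :=
  n :: Cs.length :: Cs.flatMap fun C => C.length :: C

def readClause : Program :=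
  block [
    assign 5 (.ld 0 (.var 3)),
    assign 3 (.bin .add (.var 3) (.lit 1)),
    assign 8 (.lit 0),
    loop 6 5 (block [
      assign 7 (.ld 0 (.bin .add (.var 3) (.var 6))),
      assignPow 7 (.bin .add (.bin .div (.var 7) (.lit 2))
        (.bin .mul (.bin .mod (.var 7) (.lit 2)) (.var 1))),
      assign 8 (.bin .lor (.var 8) (.var 7))]),
    assign 3 (.bin .add (.var 3) (.var 5))]

/-- Memory `3` is an indicator table addressed by the mask itself, so a duplicate is found in
constant time. -/
def keepMask (dd : Bool) : Program :=
  cond (.bin .mul (.lit dd.toNat) (.ld 3 (.var 8))) .skip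
    (block [
      put 3 (.var 8) (.lit 1),
      put 2 (.var 9) (.var 8),
      assign 9 (.bin .add (.var 9) (.lit 1))])

def readFormula (dd : Bool) : Program :=
  block [
    assign 1 (.ld 0 (.lit 0)),
    assign 2 (.ld 0 (.lit 1)),
    assign 3 (.lit 2),
    assign 9 (.lit 0),
    loop 4 2 (block [readClause, keepMask dd])]

/-- The registers are the same except for those in the list. -/
def SameRegs (l : List ℕ) (s s' : State) : Prop := ∀ r, r ∉ l → s'.reg r = s.reg r

theorem getD_append_add {α : Type*} (l l' : List α) (i : ℕ) (d : α) :
    (l ++ l').getD (l.length + i) d = l'.getD i d := by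
  rw [List.getD_append_right _ _ _ _ (by omega)]; simp

theorem wp_readClause {h n L : ℕ} (hh : 2 ≤ h) (hn : 2 * n ≤ h) {pre C post : List ℕ}
    (hC : ∀ l ∈ C, l < 2 * n) (hL : C.length ≤ L) (hlen : (pre ++ C.length :: C).length < 2 ^ h)
    {s : State}
    (h0 : ∀ i, s.mem 0 i = (pre ++ C.length :: C ++ post).getD i 0) (h1 : s.reg 1 = n)
    (h3 : s.reg 3 = pre.length) :
    Wp h readClause (L * 32 + 40) s fun s' =>
      s'.mem = s.mem ∧ s'.reg 3 = (pre ++ C.length :: C).length ∧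
        s'.reg 8 = clauseMask n C ∧ SameRegs [3, 5, 6, 7, 8] s s' := by
  have hpow : 2 ≤ 2 ^ h := le_trans (by norm_num : 2 ≤ 2 ^ 1)
    (Nat.pow_le_pow_right (by norm_num) (by omega))
  simp only [List.length_append, List.length_cons] at hlen
  have hread : ∀ i, s.mem 0 (pre.length + i) = (C.length :: (C ++ post)).getD i 0 := by
    intro i
    rw [h0]
    rw [List.append_assoc, getD_append_add]
    simp
  have hr0 := hread 0
  simp only [add_zero, List.getD_cons_zero] at hr0
  refine Wp.weaken (T := 2 + 1 + (3 + 1 + (1 + 1 + ((C.length * 31 + 10) + (3 + 1 + 1))))) (by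
    nlinarith) (fun _ _ h => h) ?_
  unfold readClause
  refine Wp.assign_cons hh ?_ ?_
  · simp only [Ex.val, h3, hr0]; omega
  simp only [Ex.val, h3, hr0]
  refine Wp.assign_cons hh ?_ ?_
  · simp [Ex.val, WordOp.eval, h3]; omega
  simp only [Ex.val, WordOp.eval, State.reg_setReg, h3]
  refine Wp.assign_cons hh ?_ ?_
  · simp [Ex.val]
  simp only [Ex.val]
  refine Wp.cons (Wp.weaken le_rfl ?_ (Wp.loop (T := 21) (N := C.length) (by decide) (by decide)
    (by decide) hh
    (fun l s' => s'.mem = s.mem ∧ s'.reg 3 = pre.length + 1 ∧ s'.reg 8 = clauseMask n (C.take l) ∧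
      SameRegs [3, 5, 6, 7, 8] s s') ?_ ?_ ?_))
  · rintro s' hsm ⟨e5, em, e3, e8, er⟩
    refine Wp.assign_cons hh ?_ ?_
    · simp only [Ex.val, WordOp.eval, e3, e5]; omega
    refine Wp.nil ⟨em, ?_, ?_, ?_⟩
    · simp [Ex.val, WordOp.eval, e3, e5]; omega
    · simp [e8]
    · intro r hr
      have := er r hr
      simp only [List.mem_cons, not_or] at hr
      simp [hr, this]
  · simp
  · refine ⟨rfl, by simp, by simp [clauseMask], ?_⟩
    intro r hr
    simp only [List.mem_cons, not_or] at hr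
    simp [hr]
  · rintro l hl s' e6 e5 ⟨em, e3, e8, er⟩
    have hlit : s'.mem 0 (s'.reg 3 + s'.reg 6) = C[l] := by
      rw [em, e3, e6, add_assoc, hread, add_comm 1 l, List.getD_cons_succ,
        List.getD_append _ _ _ _ hl, List.getD_eq_getElem _ _ hl]
    have hlt : C[l] < 2 * n := hC _ (List.getElem_mem hl)
    have e1 : s'.reg 1 = n := by rw [er 1 (by simp), h1]
    -- The bit position of a literal is below `2 n`, hence the mask stays below `2 ^ h`.
    have hpos : C[l] / 2 + C[l] % 2 * n < h := by
      rcases Nat.mod_two_eq_zero_or_one C[l] with h2 | h2 <;> rw [h2] <;> omega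
    refine Wp.weaken (T := 4 + 1 + (9 + 2 + (3 + 1 + 1))) (by norm_num) (fun _ _ h => h) ?_
    refine Wp.assign_cons hh ?_ ?_
    · simp only [Ex.val, WordOp.eval, hlit]
      have : n < 2 ^ n := Nat.lt_two_pow_self
      calc C[l] < 2 * n := hlt
        _ ≤ h := hn
        _ < 2 ^ h := Nat.lt_two_pow_self
    simp only [Ex.val, WordOp.eval, hlit]
    refine Wp.assignPow_cons hh ?_ ?_
    · simp [Ex.val, WordOp.eval, e1, hpos]
    simp only [Ex.val, WordOp.eval, State.reg_setReg]
    refine Wp.small fun hsm => ?_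
    refine Wp.assign_cons hh ?_ ?_
    · exact Nat.or_lt_two_pow (hsm.1 8) (hsm.1 7)
    refine Wp.nil ⟨by simp [e6], by simp [e5], ?_⟩
    refine ⟨by simp [em], by simp [e3], ?_, ?_⟩
    · simp only [Ex.val, WordOp.eval, State.reg_setReg]
      simp only [Nat.reduceEqDiff, if_true, if_false, e8, e1]
      rw [List.take_add_one, clauseMask, clauseMask, List.foldl_append]
      simp [hl]
    · intro r hr
      have := er r hr
      simp only [List.mem_cons, not_or] at hr
      simp [hr, this]

theorem wp_keepMask {h : ℕ} (hh : 2 ≤ h) (dd : Bool) {ms : List ℕ} {c : ℕ}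
    (hlen : ms.length + 1 < 2 ^ h) {s : State} (h8 : s.reg 8 = c) (h9 : s.reg 9 = ms.length)
    (h2 : ∀ i, s.mem 2 i = ms.getD i 0) (h3 : ∀ i, s.mem 3 i = if i ∈ ms then 1 else 0) :
    Wp h (keepMask dd) 30 s fun s' =>
      s'.reg 9 = (keep dd ms c).length ∧ (∀ i, s'.mem 2 i = (keep dd ms c).getD i 0) ∧
      (∀ i, s'.mem 3 i = if i ∈ keep dd ms c then 1 else 0) ∧
      (∀ A, A ≠ 2 → A ≠ 3 → s'.mem A = s.mem A) ∧ SameRegs [9] s s' := by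
  have hpow : 2 ≤ 2 ^ h := le_trans (by norm_num : 2 ≤ 2 ^ 1)
    (Nat.pow_le_pow_right (by norm_num) (by omega))
  refine Wp.weaken (T := 4 + 15 + 1) (by norm_num) (fun _ _ h => h) ?_
  refine Wp.cond' (T := 15) hh ?_ ?_ (by cases dd <;> decide) (by cases dd <;> decide)
  · intro hv
    simp only [Ex.val, WordOp.eval, h8, h3] at hv
    have hk : keep dd ms c = ms := by
      have : dd = true ∧ c ∈ ms := by
        cases dd
        · simp at hv
        · simpa using hv
      rw [keep, if_pos this]
    refine Wp.weaken (T := 1) (by norm_num) (fun _ _ h => h) (Wp.skip ?_)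
    rw [hk]
    exact ⟨h9, h2, h3, fun _ _ _ => rfl, fun _ _ => rfl⟩
  · intro hv
    simp only [Ex.val, WordOp.eval, h8, h3] at hv
    have hk : keep dd ms c = ms ++ [c] := by
      have : ¬ (dd = true ∧ c ∈ ms) := by
        rintro ⟨rfl, hc⟩
        simp [hc] at hv
      rw [keep, if_neg this]
    refine Wp.weaken (T := 1 + 1 + 1 + (1 + 1 + 1 + (3 + 1 + 1))) (by norm_num) (fun _ _ h => h) ?_
    refine Wp.small fun hsm => ?_
    refine Wp.put_cons hh ?_ ?_
    · simp only [Ex.val]; omega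
    refine Wp.put_cons hh ?_ ?_
    · exact hsm.1 8
    refine Wp.assign_cons hh ?_ ?_
    · simp only [Ex.val, WordOp.eval, State.reg_setMem, h9]; exact hlen
    rw [hk]
    refine Wp.nil ⟨?_, ?_, ?_, ?_, ?_⟩
    · simp [Ex.val, WordOp.eval, h9]
    · intro i
      simp only [State.mem_setReg, State.mem_setMem, Ex.val, State.reg_setMem, if_true, h8, h9,
        Function.update_apply, Nat.reduceEqDiff, if_false, h2]
      rcases lt_trichotomy i ms.length with hi | rfl | hi
      · rw [if_neg hi.ne, List.getD_append _ _ _ _ hi]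
      · simp
      · rw [if_neg hi.ne', List.getD_eq_default _ _ hi.le, List.getD_eq_default _ _ (by simp; omega)]
    · intro i
      simp only [State.mem_setReg, State.mem_setMem, Ex.val, State.reg_setMem, if_true, h8,
        Function.update_apply, Nat.reduceEqDiff, if_false, h3, List.mem_append, List.mem_singleton]
      by_cases h1 : i = c <;> simp [h1]
    · intro A h2 h3
      simp [State.mem_setMem, h2, h3]
    · intro r hr
      simp only [List.mem_cons, not_or] at hr
      simp [hr]

theorem wp_readFormula {h n L : ℕ} (hh : 2 ≤ h) (hn : 2 * n ≤ h) (dd : Bool) {Cs : List (List ℕ)}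
    (hC : ∀ C ∈ Cs, C.length ≤ L ∧ ∀ l ∈ C, l < 2 * n)
    (hlen : (encodeWords n Cs).length < 2 ^ h) {s : State}
    (hmem : ∀ A i, s.mem A i = if A = 0 then (encodeWords n Cs).getD i 0 else 0)
    (hreg : ∀ r, 128 ≤ r → s.reg r = 0) :
    Wp h (readFormula dd) (Cs.length * (L * 32 + 81) + 50) s fun s' =>
      s'.reg 1 = n ∧ s'.reg 9 = (keptMasks dd n Cs).length ∧
      (∀ i, s'.mem 2 i = (keptMasks dd n Cs).getD i 0) ∧
      (∀ A, 4 ≤ A → s'.mem A = fun _ => 0) ∧ ∀ r, 128 ≤ r → s'.reg r = 0 := by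
  have hpow : 4 ≤ 2 ^ h := le_trans (by norm_num : 4 ≤ 2 ^ 2)
    (Nat.pow_le_pow_right (by norm_num) (by omega))
  have hn' : n < 2 ^ h := lt_of_le_of_lt (by omega : n ≤ h) Nat.lt_two_pow_self
  have hl2 : Cs.length + 2 ≤ (encodeWords n Cs).length := by
    have : Cs.length ≤ (Cs.flatMap fun C => C.length :: C).length := by
      rw [List.length_flatMap]
      refine (le_of_eq ?_).trans (List.length_le_sum_of_one_le _ ?_)
      · simp
      · simp
    simp only [encodeWords, List.length_cons]; omega
  have m0 : s.mem 0 0 = n := by rw [hmem]; simp [encodeWords]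
  have m1 : s.mem 0 1 = Cs.length := by rw [hmem]; simp [encodeWords]
  refine Wp.weaken (T := 2 + 1 + (2 + 1 + (1 + 1 + (1 + 1 +
    ((Cs.length * ((L * 32 + 40 + (30 + 1)) + 10) + 10) + 1))))) (by nlinarith) (fun _ _ h => h) ?_
  unfold readFormula
  refine Wp.assign_cons hh ?_ ?_
  · simp only [Ex.val, m0]; exact hn'
  refine Wp.assign_cons hh ?_ ?_
  · simp only [Ex.val, State.mem_setReg, m1]; omega
  refine Wp.assign_cons hh ?_ ?_
  · simp only [Ex.val]; omega
  refine Wp.assign_cons hh ?_ ?_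
  · simp only [Ex.val]; omega
  simp only [Ex.val, State.mem_setReg, m0, m1]
  refine Wp.cons (Wp.weaken le_rfl ?_ (Wp.loop (T := L * 32 + 40 + (30 + 1)) (N := Cs.length)
    (by decide) (by decide) (by decide) hh
    -- `D` holds the clauses already read and `E` the others; register `3` points to the first
    -- unread word.
    (fun c s' => s'.reg 1 = n ∧ (∃ D E, Cs = D ++ E ∧ D.length = c ∧
      s'.reg 3 = (n :: Cs.length :: D.flatMap fun C => C.length :: C).length ∧
      s'.reg 9 = (keptMasks dd n D).length ∧
      (∀ i, s'.mem 2 i = (keptMasks dd n D).getD i 0) ∧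
      (∀ i, s'.mem 3 i = if i ∈ keptMasks dd n D then 1 else 0)) ∧
      (∀ A, A ≠ 2 → A ≠ 3 → s'.mem A = s.mem A) ∧ ∀ r, 128 ≤ r → s'.reg r = 0)
    ?_ ?_ ?_))
  · rintro s' hsm ⟨-, e1, ⟨D, E, hDE, hD, e3, e9, e2, -⟩, em, er⟩
    have hE : E = [] := by
      have := congrArg List.length hDE
      simp only [List.length_append] at this
      exact List.length_eq_zero_iff.1 (by omega)
    subst hE
    rw [List.append_nil] at hDE
    subst hDE
    refine Wp.nil ⟨e1, e9, e2, fun A hA => ?_, er⟩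
    rw [em A (by omega) (by omega)]
    funext i
    rw [hmem, if_neg (by omega)]
  · simp
  · refine ⟨by simp, ⟨[], Cs, by simp, rfl, by simp, by simp [keptMasks], ?_, ?_⟩, ?_, ?_⟩
    · intro i; simp [hmem, keptMasks]
    · intro i; simp [hmem, keptMasks]
    · intro A _ _; rfl
    · intro r hr
      have h1 : r ≠ 1 := by omega
      have h2 : r ≠ 2 := by omega
      have h3 : r ≠ 3 := by omega
      have h4 : r ≠ 4 := by omega
      have h9 : r ≠ 9 := by omega
      simp [h1, h2, h3, h4, h9, hreg r hr]
  · rintro c hc s' e4 e2 ⟨e1, ⟨D, E, hDE, hD, e3, e9, em2, em3⟩, em, er⟩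
    obtain ⟨C, E', rfl⟩ : ∃ C E', E = C :: E' := by
      cases E with
      | nil => simp only [List.append_nil] at hDE; subst hDE; omega
      | cons C E' => exact ⟨C, E', rfl⟩
    have hCmem : C ∈ Cs := by rw [hDE]; simp
    have henc : encodeWords n Cs = (n :: Cs.length :: D.flatMap fun C => C.length :: C) ++
        C.length :: C ++ E'.flatMap fun C => C.length :: C := by
      conv_lhs => rw [encodeWords]
      rw [show (Cs.flatMap fun C => C.length :: C) = (D ++ C :: E').flatMap fun C => C.length :: C
        from by rw [← hDE]]
      simp
    have hlen' := hlen
    rw [henc, List.length_append] at hlen'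
    have hDC : (keptMasks dd n D).length + 1 < 2 ^ h := by
      have := length_keptMasks_le dd n D
      have := congrArg List.length hDE
      simp only [List.length_append, List.length_cons] at this
      omega
    refine Wp.cons (Wp.weaken le_rfl ?_ (wp_readClause (L := L) (post := E'.flatMap fun C => C.length :: C)
      hh hn (hC C hCmem).2 (hC C hCmem).1 (by omega) ?_ e1 e3))
    · rintro s1 - ⟨f1, f3, f8, fr⟩
      refine Wp.cons (Wp.weaken le_rfl ?_ (wp_keepMask (ms := keptMasks dd n D) hh dd hDC f8 ?_ ?_ ?_))
      · rintro s2 - ⟨g9, g2, g3, gm, gr⟩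
        refine Wp.nil ⟨?_, ?_, ?_, ⟨D ++ [C], E', ?_, ?_, ?_, ?_, ?_, ?_⟩, ?_, ?_⟩
        · rw [gr 4 (by simp), fr 4 (by simp), e4]
        · rw [gr 2 (by simp), fr 2 (by simp), e2]
        · simp [gr 1, fr 1, e1]
        · simp [hDE]
        · simp [hD]
        · simp only [State.reg_setReg, Nat.reduceEqDiff, if_false]
          rw [gr 3 (by simp), f3]
          simp
        · rw [keptMasks_append]; simpa using g9
        · rw [keptMasks_append]; simpa using g2
        · rw [keptMasks_append]; simpa using g3
        · intro A h2 h3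
          rw [State.mem_setReg, gm A h2 h3, f1, em A h2 h3]
        · intro r hr
          rw [State.reg_setReg, if_neg (by omega), gr r (by simp; omega), fr r (by simp; omega),
            er r hr]
      · rw [fr 9 (by simp), e9]
      · intro i; rw [f1, em2]
      · intro i; rw [f1, em3]
    · intro i
      rw [em 0 (by omega) (by omega), hmem, if_pos rfl, henc]

end FineGrained

namespace FineGrained

/-! ### Writing the digraph -/

/-- The mask of the assignment with the bits of `y` to a group of variables. -/
def maskEx (y len scale : Ex) : Ex :=
  .bin .mul (.bin .add (.bin .mul y (.var 14)) (.bin .sub (.bin .sub len (.lit 1)) y)) scale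

/-- Register `21` holds an arbitrary node and `22` an inner node, decoded into block `23`, slot
`24`, kind `25` and clause mask `26`. The result is a flag in `36` with the endpoints in `37` and
`38`. Powers of two kept in registers turn the shifts of masks into multiplications. -/
def edgeCode : Program :=
  block [
    assign 21 (.bin .div (.var 20) (.var 16)),
    assign 22 (.bin .mod (.var 20) (.var 16)),
    assign 23 (.bin .div (.bin .div (.var 22) (.lit 3)) (.var 15)),
    assign 24 (.bin .mod (.bin .div (.var 22) (.lit 3)) (.var 15)),
    assign 25 (.bin .mod (.var 22) (.lit 3)),
    assign 26 (.ld 2 (.var 24)),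
    cond (.bin .lt (.var 21) (.var 16))
      (block [
        assign 36 (.bin .mul (.bin .eq (.bin .div (.bin .div (.var 21) (.lit 3)) (.var 15)) (.var 23))
          (.bin .mul (.bin .lt (.bin .mod (.var 21) (.lit 3)) (.lit 2)) (.bin .eq (.var 25) (.lit 2)))),
        assign 37 (.var 21),
        assign 38 (.var 22)])
      (cond (.bin .lt (.var 21) (.bin .add (.var 16) (.var 11)))
        (block [
          assign 36 (.bin .eq (.var 25) (.bin .sub (.lit 1) (.bin .eq (.bin .land (.var 26)
            (.bin .lor (maskEx (.bin .sub (.var 21) (.var 16)) (.var 11) (.lit 1))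
              (maskEx (.var 23) (.var 13) (.bin .mul (.var 11) (.var 12))))) (.lit 0)))),
          assign 37 (.var 21),
          assign 38 (.var 22)])
        (block [
          assign 27 (.bin .sub (.var 21) (.bin .add (.var 16) (.var 11))),
          assign 36 (.bin .add
            (.bin .mul (.bin .eq (.var 25) (.lit 2)) (.bin .lt (.bin .add (.bin .add (.var 24)
              (.bin .div (.var 27) (.var 12))) (.lit 1)) (.var 15)))
            (.bin .mul (.bin .eq (.var 25) (.lit 0)) (.bin .eq (.bin .land (.var 26)
              (maskEx (.bin .mod (.var 27) (.var 12)) (.var 12) (.var 11))) (.lit 0)))),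
          assign 37 (.var 22),
          assign 38 (.var 21)]))]

theorem Ex.val_eq_le (s : State) (e f : Ex) : (Ex.bin .eq e f).val s ≤ 1 := by
  simp only [Ex.val, WordOp.eval]; split_ifs <;> simp

theorem Ex.val_lt_le (s : State) (e f : Ex) : (Ex.bin .lt e f).val s ≤ 1 := by
  simp only [Ex.val, WordOp.eval]; split_ifs <;> simp

theorem Ex.val_mul_le {s : State} {e f : Ex} (he : e.val s ≤ 1) (hf : f.val s ≤ 1) :
    (Ex.bin .mul e f).val s ≤ 1 :=
  Nat.mul_le_mul he hf

/-- The registers hold the parameters of the instance, memory `2` the clause masks. -/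
structure Instance.Held (S : Instance) (s : State) : Prop where
  r11 : s.reg 11 = 2 ^ S.a
  r12 : s.reg 12 = 2 ^ S.b
  r13 : s.reg 13 = 2 ^ S.g
  r14 : s.reg 14 = 2 ^ S.vars
  r15 : s.reg 15 = S.M
  r16 : s.reg 16 = S.X
  r17 : s.reg 17 = S.k
  r18 : s.reg 18 = S.nodes
  r19 : s.reg 19 = S.nodes * S.X
  m2 : ∀ i, s.mem 2 i = S.mask i

theorem Instance.Held.congr {S : Instance} {s s' : State} (h : S.Held s)
    (hr : ∀ r, 11 ≤ r → r ≤ 19 → s'.reg r = s.reg r) (hm : s'.mem 2 = s.mem 2) : S.Held s' := by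
  refine ⟨?_, ?_, ?_, ?_, ?_, ?_, ?_, ?_, ?_, fun i => by rw [hm, h.m2]⟩ <;>
    rw [hr _ (by norm_num) (by norm_num)]
  exacts [h.r11, h.r12, h.r13, h.r14, h.r15, h.r16, h.r17, h.r18, h.r19]

theorem wp_edgeCode {h : ℕ} (hh : 2 ≤ h) {S : Instance} {s : State} (H : S.Held s) :
    Wp h edgeCode 150 s fun s' =>
      (if s'.reg 36 = 0 then S.edgeAt (s.reg 20 / S.X) (s.reg 20 % S.X) = none
        else S.edgeAt (s.reg 20 / S.X) (s.reg 20 % S.X) = some (s'.reg 37, s'.reg 38)) ∧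
      s'.mem = s.mem ∧ SameRegs [21, 22, 23, 24, 25, 26, 27, 36, 37, 38] s s' := by
  have hpow : 4 ≤ 2 ^ h := le_trans (by norm_num : 4 ≤ 2 ^ 2)
    (Nat.pow_le_pow_right (by norm_num) (by omega))
  refine Wp.small fun hsm => ?_
  have h20 := hsm.1 20
  have hdiv : ∀ a b : ℕ, a < 2 ^ h → a / b < 2 ^ h := fun a b hab => (Nat.div_le_self _ _).trans_lt hab
  have hmod : ∀ a b : ℕ, a < 2 ^ h → a % b < 2 ^ h := fun a b hab => (Nat.mod_le _ _).trans_lt hab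
  refine Wp.weaken (T := 3 + 1 + (3 + 1 + (5 + 1 + (5 + 1 + (3 + 1 + (2 + 1 +
    ((3 + 110 + 1) + 1))))))) (by norm_num) (fun _ _ h => h) ?_
  unfold edgeCode
  refine Wp.assign_cons hh (hdiv _ _ h20) ?_
  refine Wp.assign_cons hh (hmod _ _ h20) ?_
  refine Wp.small fun hsm => ?_
  refine Wp.assign_cons hh (hdiv _ _ (hdiv _ _ (hsm.1 22))) ?_
  refine Wp.small fun hsm => ?_
  refine Wp.assign_cons hh (hmod _ _ (hdiv _ _ (hsm.1 22))) ?_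
  refine Wp.small fun hsm => ?_
  refine Wp.assign_cons hh (hmod _ _ (hsm.1 22)) ?_
  refine Wp.small fun hsm => ?_
  refine Wp.assign_cons hh (hsm.2 2 _) ?_
  simp only [Ex.val, WordOp.eval, State.reg_setReg, Nat.reduceEqDiff, if_true, if_false,
    State.mem_setReg, H.r16, H.r15, H.m2]
  set u := s.reg 20 / S.X with hu
  set x := s.reg 20 % S.X with hx
  refine Wp.small fun hsm => ?_
  have hsu : u < 2 ^ h := by simpa using hsm.1 21
  have hsx : x < 2 ^ h := by simpa using hsm.1 22
  -- From here on only the decoded values matter, not how they were obtained.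
  have same : ∀ {s' : State}, SameRegs [21, 22, 23, 24, 25, 26] s s' → s'.mem = s.mem →
      s'.reg 21 = u → s'.reg 22 = x → s'.reg 23 = x / 3 / S.M → s'.reg 24 = x / 3 % S.M →
      s'.reg 25 = x % 3 → s'.reg 26 = S.mask (x / 3 % S.M) →
      Wp h (block [cond (.bin .lt (.var 21) (.var 16))
      (block [
        assign 36 (.bin .mul (.bin .eq (.bin .div (.bin .div (.var 21) (.lit 3)) (.var 15)) (.var 23))
          (.bin .mul (.bin .lt (.bin .mod (.var 21) (.lit 3)) (.lit 2)) (.bin .eq (.var 25) (.lit 2)))),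
        assign 37 (.var 21),
        assign 38 (.var 22)])
      (cond (.bin .lt (.var 21) (.bin .add (.var 16) (.var 11)))
        (block [
          assign 36 (.bin .eq (.var 25) (.bin .sub (.lit 1) (.bin .eq (.bin .land (.var 26)
            (.bin .lor (maskEx (.bin .sub (.var 21) (.var 16)) (.var 11) (.lit 1))
              (maskEx (.var 23) (.var 13) (.bin .mul (.var 11) (.var 12))))) (.lit 0)))),
          assign 37 (.var 21),
          assign 38 (.var 22)])
        (block [
          assign 27 (.bin .sub (.var 21) (.bin .add (.var 16) (.var 11))),
          assign 36 (.bin .add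
            (.bin .mul (.bin .eq (.var 25) (.lit 2)) (.bin .lt (.bin .add (.bin .add (.var 24)
              (.bin .div (.var 27) (.var 12))) (.lit 1)) (.var 15)))
            (.bin .mul (.bin .eq (.var 25) (.lit 0)) (.bin .eq (.bin .land (.var 26)
              (maskEx (.bin .mod (.var 27) (.var 12)) (.var 12) (.var 11))) (.lit 0)))),
          assign 37 (.var 22),
          assign 38 (.var 21)]))]) ((3 + 110 + 1) + 1) s' fun s' =>
        (if s'.reg 36 = 0 then S.edgeAt u x = none
          else S.edgeAt u x = some (s'.reg 37, s'.reg 38)) ∧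
        s'.mem = s.mem ∧ SameRegs [21, 22, 23, 24, 25, 26, 27, 36, 37, 38] s s' := by
    intro s' hsame hmem e21 e22 e23 e24 e25 e26
    have e16 : s'.reg 16 = S.X := by rw [hsame 16 (by decide), H.r16]
    have e15 : s'.reg 15 = S.M := by rw [hsame 15 (by decide), H.r15]
    have e14 : s'.reg 14 = 2 ^ S.vars := by rw [hsame 14 (by decide), H.r14]
    have e13 : s'.reg 13 = 2 ^ S.g := by rw [hsame 13 (by decide), H.r13]
    have e12 : s'.reg 12 = 2 ^ S.b := by rw [hsame 12 (by decide), H.r12]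
    have e11 : s'.reg 11 = 2 ^ S.a := by rw [hsame 11 (by decide), H.r11]
    have frame : ∀ r, r ∉ [21, 22, 23, 24, 25, 26, 27, 36, 37, 38] →
        s'.reg r = s.reg r ∧ r ≠ 27 ∧ r ≠ 36 ∧ r ≠ 37 ∧ r ≠ 38 := by
      intro r hr
      refine ⟨hsame r fun h => hr ?_, ?_⟩
      · simp only [List.mem_cons] at h ⊢; tauto
      · simp only [List.mem_cons, not_or] at hr; tauto
    refine Wp.cons (Wp.weaken le_rfl (fun s'' _ h => Wp.nil h) ?_)
    refine Wp.cond' (T := 110) hh ?_ ?_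
    · intro hc
      simp only [Ex.val, WordOp.eval, e21, e16, ne_eq, ite_eq_right_iff, one_ne_zero, imp_false,
        not_not] at hc
      refine Wp.weaken (T := 17 + 1 + (1 + 1 + (1 + 1 + 1))) (by norm_num) (fun _ _ h => h) ?_
      refine Wp.assign_cons hh ?_ ?_
      · exact (Ex.val_mul_le (Ex.val_eq_le _ _ _) (Ex.val_mul_le (Ex.val_lt_le _ _ _)
          (Ex.val_eq_le _ _ _))).trans_lt (by omega)
      refine Wp.assign_cons hh ?_ ?_
      · simpa [Ex.val, e21] using hsu
      refine Wp.assign_cons hh ?_ ?_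
      · simpa [Ex.val, e22] using hsx
      refine Wp.nil ⟨?_, by simpa using hmem, fun r hr => ?_⟩
      · simp only [Ex.val, WordOp.eval, State.reg_setReg, Nat.reduceEqDiff, if_true, if_false,
          e21, e22, e23, e15, e25, Instance.edgeAt, hc]
        by_cases c1 : u / 3 / S.M = x / 3 / S.M <;> by_cases c2 : u % 3 < 2 <;>
          by_cases c3 : x % 3 = 2 <;> simp [c1, c2, c3]
      · obtain ⟨f1, f2, f3, f4, f5⟩ := frame r hr
        simp [f1, f3, f4, f5]
    · intro hc
      simp only [Ex.val, WordOp.eval, e21, e16, ite_eq_right_iff, one_ne_zero, imp_false] at hc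
      refine Wp.weaken (T := 5 + 104 + 1) (by norm_num) (fun _ _ h => h) ?_
      refine Wp.cond' (T := 104) hh ?_ ?_
      · intro hc'
        simp only [Ex.val, WordOp.eval, e21, e16, e11, ne_eq, ite_eq_right_iff, one_ne_zero,
          imp_false, not_not] at hc'
        refine Wp.weaken (T := 37 + 1 + (1 + 1 + (1 + 1 + 1))) (by norm_num) (fun _ _ h => h) ?_
        refine Wp.assign_cons hh ?_ ?_
        · exact (Ex.val_eq_le _ _ _).trans_lt (by omega)
        refine Wp.assign_cons hh ?_ ?_
        · simpa [Ex.val, e21] using hsu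
        refine Wp.assign_cons hh ?_ ?_
        · simpa [Ex.val, e22] using hsx
        refine Wp.nil ⟨?_, by simpa using hmem, fun r hr => ?_⟩
        · have hA : S.maskA (u - S.X) =
              ((u - S.X) * 2 ^ S.vars + (2 ^ S.a - 1 - (u - S.X))) * 1 := by
            simp [Instance.maskA, partialMask]
          have hG : S.maskG (x / 3 / S.M) = (x / 3 / S.M * 2 ^ S.vars +
              (2 ^ S.g - 1 - x / 3 / S.M)) * (2 ^ S.a * 2 ^ S.b) := by
            simp [Instance.maskG, partialMask, pow_add]
          simp only [maskEx, Ex.val, WordOp.eval, State.reg_setReg, Nat.reduceEqDiff, if_true,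
            if_false, e21, e22, e23, e25, e26, e16, e11, e12, e13, e14, Instance.edgeAt, hc, hc',
            Instance.entrance, hA, hG]
          generalize S.mask (x / 3 % S.M) &&& _ = z
          by_cases c1 : z = 0
          · by_cases c3 : x % 3 = 0 <;> simp [c1, c3]
          · by_cases c3 : x % 3 = 1 <;> simp [c1, c3]
        · obtain ⟨f1, f2, f3, f4, f5⟩ := frame r hr
          simp [f1, f3, f4, f5]
      · intro hc'
        simp only [Ex.val, WordOp.eval, e21, e16, e11, ite_eq_right_iff, one_ne_zero,
          imp_false] at hc'
        refine Wp.weaken (T := 5 + 1 + (37 + 1 + (1 + 1 + (1 + 1 + 1)))) (by norm_num)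
          (fun _ _ h => h) ?_
        refine Wp.assign_cons hh ?_ ?_
        · simp only [Ex.val, WordOp.eval, e21]; omega
        refine Wp.assign_cons hh ?_ ?_
        · exact (Nat.add_le_add (Ex.val_mul_le (Ex.val_eq_le _ _ _) (Ex.val_lt_le _ _ _))
            (Ex.val_mul_le (Ex.val_eq_le _ _ _) (Ex.val_eq_le _ _ _))).trans_lt (by omega)
        refine Wp.assign_cons hh ?_ ?_
        · simpa [Ex.val, e22] using hsx
        refine Wp.assign_cons hh ?_ ?_
        · simpa [Ex.val, e21] using hsu
        refine Wp.nil ⟨?_, by simpa using hmem, fun r hr => ?_⟩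
        · have hB : S.maskB ((u - (S.X + 2 ^ S.a)) % 2 ^ S.b) =
              ((u - (S.X + 2 ^ S.a)) % 2 ^ S.b * 2 ^ S.vars +
                (2 ^ S.b - 1 - (u - (S.X + 2 ^ S.a)) % 2 ^ S.b)) * 2 ^ S.a := rfl
          simp only [maskEx, Ex.val, WordOp.eval, State.reg_setReg, Nat.reduceEqDiff, if_true,
            if_false, e21, e22, e24, e25, e26, e16, e11, e12, e14, e15, Instance.edgeAt, hc,
            hc', hB]
          generalize S.mask (x / 3 % S.M) &&& _ = z
          by_cases c1 : z = 0 <;> by_cases c2 : x % 3 = 2 <;>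
            by_cases c3 : x / 3 % S.M + (u - (S.X + 2 ^ S.a)) / 2 ^ S.b + 1 < S.M <;>
            by_cases c4 : x % 3 = 0 <;> simp [c1, c2, c3, c4]
        · obtain ⟨f1, f2, f3, f4, f5⟩ := frame r hr
          simp [f1, f2, f3, f4, f5]
  refine same ?_ ?_ ?_ ?_ ?_ ?_ ?_ ?_
  · intro r hr
    simp only [List.mem_cons, not_or] at hr
    simp [hr]
  all_goals simp

def emitEdge : Program :=
  block [
    edgeCode,
    cond (.var 36)
      (block [
        put 4 (.var 28) (.var 37),
        put 4 (.bin .add (.var 28) (.lit 1)) (.var 38),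
        assign 28 (.bin .add (.var 28) (.lit 2))])
      .skip]

theorem getD_append_pair (l : List ℕ) (a b i : ℕ) :
    (l ++ [a, b]).getD i 0 = if i = l.length + 1 then b else if i = l.length then a
      else l.getD i 0 := by
  rcases lt_trichotomy i l.length with hi | rfl | hi
  · rw [if_neg (by omega), if_neg (by omega), List.getD_append _ _ _ _ hi]
  · simp
  · rw [if_neg (by omega : i ≠ l.length), List.getD_append_right _ _ _ _ hi.le,
      List.getD_eq_default l _ hi.le]
    obtain ⟨j, hj⟩ : ∃ j, i - l.length = j + 1 := ⟨i - l.length - 1, by omega⟩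
    rw [hj]
    cases j with
    | zero => rw [if_pos (by omega)]; simp
    | succ j => rw [if_neg (by omega)]; simp

/-- The words for the first edges, after a header. -/
def Instance.words (S : Instance) (e : ℕ) : List ℕ :=
  S.nodes :: S.k :: 0 :: (S.edgesTo e).flatMap fun p => [p.1, p.2]

theorem Instance.length_words (S : Instance) (e : ℕ) :
    (S.words e).length = 3 + 2 * (S.edgesTo e).length := by
  simp [Instance.words, List.length_flatMap]; ring

theorem wp_emitEdges {h : ℕ} (hh : 2 ≤ h) {S : Instance} {s : State} (H : S.Held s)
    (hE : 2 * (S.nodes * S.X) + 3 < 2 ^ h) (h28 : s.reg 28 = 3)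
    (h4 : ∀ i, s.mem 4 i = (S.words 0).getD i 0) :
    Wp h (loop 20 19 emitEdge) (S.nodes * S.X * 180 + 10) s fun s' =>
      s'.reg 28 = (S.words (S.nodes * S.X)).length ∧
      (∀ i, s'.mem 4 i = (S.words (S.nodes * S.X)).getD i 0) ∧
      (∀ A, A ≠ 4 → s'.mem A = s.mem A) ∧
      SameRegs [20, 21, 22, 23, 24, 25, 26, 27, 28, 36, 37, 38] s s' := by
  refine Wp.weaken (T := S.nodes * S.X * (150 + ((1 + 16 + 1) + 1) + 10) + 10) (by omega) ?_
    (Wp.loop (T := 150 + ((1 + 16 + 1) + 1)) (N := S.nodes * S.X) (by decide) (by decide)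
      (by decide) hh
      (fun e s' => s'.reg 28 = (S.words e).length ∧ (∀ i, s'.mem 4 i = (S.words e).getD i 0) ∧
        (∀ A, A ≠ 4 → s'.mem A = s.mem A) ∧
        SameRegs [20, 21, 22, 23, 24, 25, 26, 27, 28, 36, 37, 38] s s') H.r19 ?_ ?_)
  · rintro s' - ⟨-, h⟩
    exact h
  · refine ⟨by simp [h28, S.length_words, Instance.edgesTo], by simpa using h4,
      fun A _ => rfl, fun r hr => ?_⟩
    simp only [List.mem_cons, not_or] at hr
    simp [hr]
  · rintro e he s' e20 e19 ⟨e28, em4, em, er⟩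
    have H' : S.Held s' := H.congr (fun r h1 h2 => er r (by simp; omega)) (em 2 (by norm_num))
    have hlen : (S.words e).length + 2 < 2 ^ h := by
      have := S.length_edgesTo e
      rw [S.length_words]; omega
    refine Wp.cons (Wp.weaken le_rfl ?_ (wp_edgeCode hh H'))
    rintro s1 hsm ⟨f36, fm, fr⟩
    have f28 : s1.reg 28 = (S.words e).length := by rw [fr 28 (by decide), e28]
    have f20 : s1.reg 20 = e := by rw [fr 20 (by decide), e20]
    have f19 : s1.reg 19 = S.nodes * S.X := by rw [fr 19 (by decide), e19]
    have frame : ∀ r, r ∉ [20, 21, 22, 23, 24, 25, 26, 27, 28, 36, 37, 38] →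
        s1.reg r = s.reg r ∧ r ≠ 20 ∧ r ≠ 28 := by
      intro r hr
      refine ⟨?_, ?_⟩
      · rw [fr r fun h => hr ?_, er r hr]
        simp only [List.mem_cons] at h ⊢; tauto
      · simp only [List.mem_cons, not_or] at hr; tauto
    rw [e20] at f36
    refine Wp.cons (Wp.weaken le_rfl (fun s'' _ h => Wp.nil h) ?_)
    refine Wp.cond' hh ?_ ?_
    · intro hc
      simp only [Ex.val] at hc
      rw [if_neg hc] at f36
      have hw : S.words (e + 1) = S.words e ++ [s1.reg 37, s1.reg 38] := by
        simp [Instance.words, S.edgesTo_succ, f36]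
      refine Wp.weaken (T := 1 + 1 + 1 + (3 + 1 + 1 + (3 + 1 + 1))) (by norm_num)
        (fun _ _ h => h) ?_
      refine Wp.put_cons hh (hsm.1 37) ?_
      refine Wp.put_cons hh (hsm.1 38) ?_
      refine Wp.assign_cons hh ?_ ?_
      · simp only [Ex.val, WordOp.eval, State.reg_setMem, f28]; omega
      refine Wp.nil ⟨by simp [f20], by simp [f19], ?_, ?_, ?_, ?_⟩
      · simp only [Ex.val, WordOp.eval, State.reg_setReg, State.reg_setMem, Nat.reduceEqDiff,
          if_true, if_false, f28, hw]
        simp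
      · intro i
        rw [hw, getD_append_pair]
        simp only [Ex.val, WordOp.eval, State.mem_setReg, State.reg_setMem, State.mem_setMem,
          if_true, f28, Function.update_apply, fm, em4]
      · intro A hA
        simp [State.mem_setMem, hA, fm, em]
      · intro r hr
        obtain ⟨g1, g2, g3⟩ := frame r hr
        simp [g1, g2, g3]
    · intro hc
      simp only [Ex.val] at hc
      rw [if_pos hc] at f36
      have hw : S.words (e + 1) = S.words e := by
        simp [Instance.words, S.edgesTo_succ, f36]
      refine Wp.weaken (T := 1) (by norm_num) (fun _ _ h => h) (Wp.skip ?_)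
      refine ⟨f20, f19, ?_, ?_, ?_, ?_⟩
      · simp [f28, hw]
      · intro i; simp [fm, em4, hw]
      · intro A hA; simp [fm, em A hA]
      · intro r hr
        obtain ⟨g1, g2, g3⟩ := frame r hr
        simp [g1, g2]

/-! ### Reading the output of kPMF -/

def scanTriple : Program :=
  block [
    assign 32 (.ld 5 (.bin .mul (.lit 3) (.var 31))),
    assign 33 (.ld 5 (.bin .add (.bin .mul (.lit 3) (.var 31)) (.lit 1))),
    assign 34 (.ld 5 (.bin .add (.bin .mul (.lit 3) (.var 31)) (.lit 2))),
    assign 35 (.bin .sub (.var 15) (.bin .div (.bin .sub (.var 33) (.bin .add (.var 16) (.var 11)))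
      (.var 12))),
    cond (.bin .mul (.bin .sub (.lit 1) (.bin .lt (.var 32) (.var 16)))
        (.bin .mul (.bin .lt (.var 32) (.bin .add (.var 16) (.var 11)))
        (.bin .mul (.bin .sub (.lit 1) (.bin .lt (.var 33) (.bin .add (.var 16) (.var 11))))
        (.bin .mul (.bin .lt (.var 34) (.var 17)) (.bin .lt (.var 29) (.var 35))))))
      (assign 29 (.var 35)) .skip]

theorem getD_flatMap_triple (L : List (ℕ × ℕ × ℕ)) {i : ℕ} (hi : i < L.length) :
    (L.flatMap fun e => [e.1, e.2.1, e.2.2]).getD (3 * i) 0 = L[i].1 ∧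
    (L.flatMap fun e => [e.1, e.2.1, e.2.2]).getD (3 * i + 1) 0 = L[i].2.1 ∧
    (L.flatMap fun e => [e.1, e.2.1, e.2.2]).getD (3 * i + 2) 0 = L[i].2.2 := by
  induction L generalizing i with
  | nil => simp at hi
  | cons e L ih =>
    cases i with
    | zero => simp
    | succ i =>
      have := ih (i := i) (by simpa using hi)
      simpa [Nat.mul_add] using this

/-- Only the first `3 * L.length` cells are prescribed, since the subroutine may leave anything
beyond its output. -/
theorem wp_scan {h : ℕ} (hh : 2 ≤ h) {S : Instance} {s : State} (H : S.Held s)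
    {L : List (ℕ × ℕ × ℕ)} (h30 : s.reg 30 = L.length) (h29 : s.reg 29 = 0)
    (h5 : ∀ i < 3 * L.length,
      s.mem 5 i = (L.flatMap fun e => [e.1, e.2.1, e.2.2]).getD i 0) :
    Wp h (loop 31 30 scanTriple) (L.length * 110 + 10) s fun s' =>
      s'.reg 29 = S.scan L ∧ s'.mem = s.mem ∧ SameRegs [29, 31, 32, 33, 34, 35] s s' := by
  have hpow : 4 ≤ 2 ^ h := le_trans (by norm_num : 4 ≤ 2 ^ 2)
    (Nat.pow_le_pow_right (by norm_num) (by omega))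
  refine Wp.weaken (T := L.length * (100 + 10) + 10) (by omega) ?_
    (Wp.loop (T := 100) (N := L.length) (by decide) (by decide)
      (by decide) hh
      (fun e s' => s'.reg 29 = S.scan (L.take e) ∧ s'.mem = s.mem ∧
        SameRegs [29, 31, 32, 33, 34, 35] s s') h30 ?_ ?_)
  · rintro s' - ⟨-, h1, h2⟩
    exact ⟨by simpa using h1, h2⟩
  · refine ⟨by simp [h29, Instance.scan], rfl, fun r hr => ?_⟩
    simp only [List.mem_cons, not_or] at hr
    simp [hr]
  · rintro i hi s' e31 e30 ⟨e29, em, er⟩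
    have H' : S.Held s' := H.congr (fun r h1 h2 => er r (by simp; omega)) (by rw [em])
    obtain ⟨t1, t2, t3⟩ := getD_flatMap_triple L hi
    rw [← h5 _ (by omega), ← em] at t1 t2 t3
    have hsc : S.scan (L.take (i + 1)) = S.scanStep (S.scan (L.take i)) L[i] := by
      rw [List.take_add_one, Instance.scan, List.foldl_append]
      simp [hi, Instance.scan]
    refine Wp.weaken (T := 4 + 1 + (6 + 1 + (6 + 1 + (9 + 1 + ((27 + 3 + 1) + 1))))) (by norm_num)
      (fun _ _ h => h) ?_
    refine Wp.small fun hsm => ?_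
    refine Wp.assign_cons hh (hsm.2 5 _) ?_
    refine Wp.assign_cons hh (hsm.2 5 _) ?_
    refine Wp.assign_cons hh (hsm.2 5 _) ?_
    refine Wp.assign_cons hh ?_ ?_
    · simp only [Ex.val, WordOp.eval, State.reg_setReg, Nat.reduceEqDiff, if_false]
      exact (Nat.sub_le _ _).trans_lt (hsm.1 15)
    simp only [Ex.val, WordOp.eval, State.reg_setReg, Nat.reduceEqDiff, if_true, if_false,
      State.mem_setReg, H'.r16, H'.r15, H'.r11, H'.r12, e31, t1, t2, t3]
    refine Wp.small fun hsm => ?_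
    refine Wp.cons (Wp.weaken le_rfl (fun s'' _ h => Wp.nil h) ?_)
    -- The conjunction of conditions is computed as a product of numbers `0` and `1`, with negation
    -- as `1 - ·`.
    have hiff : S.scanStep (S.scan (L.take i)) L[i] =
      if ((1 - if L[i].1 < S.X then 1 else 0) * ((if L[i].1 < S.X + 2 ^ S.a then 1 else 0) *
        ((1 - if L[i].2.1 < S.X + 2 ^ S.a then 1 else 0) * ((if L[i].2.2 < S.k then 1 else 0) *
        if S.scan (L.take i) < S.M - (L[i].2.1 - (S.X + 2 ^ S.a)) / 2 ^ S.b then 1 else 0)))) = 0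
      then S.scan (L.take i) else S.M - (L[i].2.1 - (S.X + 2 ^ S.a)) / 2 ^ S.b := by
      unfold Instance.scanStep
      by_cases c1 : L[i].1 < S.X <;> by_cases c2 : L[i].1 < S.X + 2 ^ S.a <;>
        by_cases c3 : L[i].2.1 < S.X + 2 ^ S.a <;> by_cases c4 : L[i].2.2 < S.k <;>
        by_cases c5 : S.scan (L.take i) < S.M - (L[i].2.1 - (S.X + 2 ^ S.a)) / 2 ^ S.b <;>
        simp only [c1, c2, c3, c4, c5, not_lt.1, if_true, if_false, not_false_eq_true, and_true,
          and_false, mul_zero, mul_one, one_ne_zero, Nat.sub_zero, Nat.sub_self, ← not_lt, not_true_eq_false]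
    refine Wp.cond' hh ?_ ?_
    · intro hc
      simp only [Ex.val, WordOp.eval, State.reg_setReg, Nat.reduceEqDiff, if_true, if_false,
        H'.r16, H'.r11, H'.r17, e29] at hc
      rw [if_neg hc] at hiff
      refine Wp.weaken (T := 1 + 1) (by norm_num) (fun _ _ h => h) (Wp.assign (by omega) 4 hpow
        (by decide) (by decide) (by decide) (hsm.1 35) ⟨by simp [e31], by simp [e30], ?_, ?_, ?_⟩)
      · rw [hsc, hiff]; simp [Ex.val]
      · simp [em]
      · intro r hr
        have := er r hr
        simp only [List.mem_cons, not_or] at hr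
        simp [hr, this]
    · intro hc
      simp only [Ex.val, WordOp.eval, State.reg_setReg, Nat.reduceEqDiff, if_true, if_false,
        H'.r16, H'.r11, H'.r17, e29] at hc
      rw [if_pos hc] at hiff
      refine Wp.weaken (T := 1) (by norm_num) (fun _ _ h => h) (Wp.skip
        ⟨by simp [e31], by simp [e30], ?_, ?_, ?_⟩)
      · rw [hsc, hiff]; simp [e29]
      · simp [em]
      · intro r hr
        have := er r hr
        simp only [List.mem_cons, not_or] at hr
        simp [hr, this]

end FineGrained

namespace FineGrained

/-! ### The reduction -/

/-- The variables split into groups whose sizes are about in the ratio `Q : Q : p`. -/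
def splitInstance (ms : List ℕ) (n Q p : ℕ) : Instance where
  ms := ms
  a := n - (Q + p) * (n / (2 * Q + p))
  b := Q * (n / (2 * Q + p))
  g := p * (n / (2 * Q + p))

theorem splitInstance_vars (ms : List ℕ) (n Q p : ℕ) : (splitInstance ms n Q p).vars = n := by
  have h := Nat.mul_div_le n (2 * Q + p)
  simp only [splitInstance, Instance.vars]
  have e : (2 * Q + p) * (n / (2 * Q + p)) = (Q + p) * (n / (2 * Q + p)) +
    Q * (n / (2 * Q + p)) := by ring
  have e' : (Q + p) * (n / (2 * Q + p)) = Q * (n / (2 * Q + p)) + p * (n / (2 * Q + p)) := by ring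
  omega

def setParameters (Q p : ℕ) : Program :=
  block [
    assign 10 (.bin .div (.var 1) (.lit (2 * Q + p))),
    assignPow 11 (.bin .sub (.var 1) (.bin .mul (.lit (Q + p)) (.var 10))),
    assignPow 12 (.bin .mul (.lit Q) (.var 10)),
    assignPow 13 (.bin .mul (.lit p) (.var 10)),
    assignPow 14 (.var 1),
    assign 15 (.bin .add (.var 9) (.lit 1)),
    assign 16 (.bin .mul (.bin .mul (.var 13) (.var 15)) (.lit 3)),
    assign 17 (.bin .mul (.var 15) (.var 13)),
    assign 18 (.bin .add (.var 16) (.bin .add (.var 11) (.bin .mul (.var 15) (.var 12)))),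
    assign 19 (.bin .mul (.var 18) (.var 16)),
    put 4 (.lit 0) (.var 18),
    put 4 (.lit 1) (.var 17),
    assign 28 (.lit 3)]

theorem Instance.M_le_X (S : Instance) : S.M ≤ S.X := by
  have := Nat.one_le_two_pow (n := S.g)
  unfold X; nlinarith

theorem Instance.k_le_X (S : Instance) : S.k ≤ S.X := by
  unfold X k
  rw [mul_comm S.M]
  exact Nat.le_mul_of_pos_right _ (by norm_num)

theorem Instance.X_le_nodes (S : Instance) : S.X ≤ S.nodes :=
  Nat.le_add_right _ _

theorem Instance.nodes_le (S : Instance) : S.nodes ≤ S.nodes * S.X :=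
  Nat.le_mul_of_pos_right _ S.X_pos

theorem wp_setParameters {h n Q p : ℕ} (hh : 2 ≤ h) (hn : n < h) (hQ : 2 * Q + p + 4 ≤ 2 ^ h)
    {ms : List ℕ}
    (hE : 2 * ((splitInstance ms n Q p).nodes * (splitInstance ms n Q p).X) + 3 < 2 ^ h)
    {s : State} (h1 : s.reg 1 = n) (h9 : s.reg 9 = ms.length)
    (h2 : ∀ i, s.mem 2 i = ms.getD i 0) (h4 : ∀ A, 4 ≤ A → s.mem A = fun _ => 0)
    (hr : ∀ r, 128 ≤ r → s.reg r = 0) :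
    Wp h (setParameters Q p) 70 s fun s' =>
      (splitInstance ms n Q p).Held s' ∧ s'.reg 28 = 3 ∧ s'.reg 9 = ms.length ∧
      (∀ i, s'.mem 4 i = ((splitInstance ms n Q p).words 0).getD i 0) ∧
      (∀ A, 5 ≤ A → s'.mem A = fun _ => 0) ∧ ∀ r, 128 ≤ r → s'.reg r = 0 := by
  set S := splitInstance ms n Q p with hS
  have hpow : 4 ≤ 2 ^ h := by omega
  have hvars : S.vars = n := splitInstance_vars ms n Q p
  have hsum : S.a + S.b + S.g = n := hvars
  have hM := S.M_le_X
  have hk := S.k_le_X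
  have hX := S.X_le_nodes
  have hN := S.nodes_le
  have hn' : n < 2 ^ h := hn.trans Nat.lt_two_pow_self
  have dM : S.M = ms.length + 1 := rfl
  have dX : S.X = 2 ^ S.g * S.M * 3 := rfl
  have dk : S.k = S.M * 2 ^ S.g := rfl
  have dN : S.nodes = S.X + (2 ^ S.a + S.M * 2 ^ S.b) := rfl
  have da : S.a = n - (Q + p) * (n / (2 * Q + p)) := rfl
  have db : S.b = Q * (n / (2 * Q + p)) := rfl
  have dg : S.g = p * (n / (2 * Q + p)) := rfl
  refine Wp.weaken (T := 3 + 1 + (5 + 2 + (3 + 2 + (3 + 2 + (1 + 2 + (3 + 1 + (5 + 1 + (3 + 1 +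
    (7 + 1 + (3 + 1 + (1 + 1 + 1 + (1 + 1 + 1 + (1 + 1 + 1))))))))))))) (by norm_num)
    (fun _ _ h => h) ?_
  unfold setParameters
  refine Wp.cons (Wp.assign (by omega) (2 * Q + p + 4) hQ (by decide)
    (by simp [Ex.wf]; decide) (by simp [Ex.size]) ?_ ?_)
  · simp only [Ex.val, WordOp.eval, h1]
    exact (Nat.div_le_self _ _).trans_lt hn'
  simp only [Ex.val, WordOp.eval, h1]
  refine Wp.cons (Wp.assignPow (by omega) (2 * Q + p + 4) hQ (by decide)
    (by simp [Ex.wf, Ex.IsTemp]; omega) (by simp [Ex.size]) ?_ ?_)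
  · simp only [Ex.val, WordOp.eval, State.reg_setReg, Nat.reduceEqDiff, if_true, if_false, h1]
    omega
  simp only [Ex.val, WordOp.eval, State.reg_setReg, Nat.reduceEqDiff, if_true, if_false, h1, ← da]
  refine Wp.cons (Wp.assignPow (by omega) (2 * Q + p + 4) hQ (by decide)
    (by simp [Ex.wf, Ex.IsTemp]; omega) (by simp [Ex.size]) ?_ ?_)
  · simp only [Ex.val, WordOp.eval, State.reg_setReg, Nat.reduceEqDiff, if_true, if_false, ← db]
    omega
  simp only [Ex.val, WordOp.eval, State.reg_setReg, Nat.reduceEqDiff, if_true, if_false, ← db]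
  refine Wp.cons (Wp.assignPow (by omega) (2 * Q + p + 4) hQ (by decide)
    (by simp [Ex.wf, Ex.IsTemp]; omega) (by simp [Ex.size]) ?_ ?_)
  · simp only [Ex.val, WordOp.eval, State.reg_setReg, Nat.reduceEqDiff, if_true, if_false, ← dg]
    omega
  simp only [Ex.val, WordOp.eval, State.reg_setReg, Nat.reduceEqDiff, if_true, if_false, ← dg]
  refine Wp.assignPow_cons hh ?_ ?_
  · simp [Ex.val, h1, hn]
  refine Wp.assign_cons hh ?_ ?_
  · simp [Ex.val, WordOp.eval, h9]; omega
  simp only [Ex.val, WordOp.eval, State.reg_setReg, Nat.reduceEqDiff, if_false, h1, h9, ← dM,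
    ← hvars]
  refine Wp.assign_cons hh ?_ ?_
  · simp only [Ex.val, WordOp.eval, State.reg_setReg, Nat.reduceEqDiff, if_true, if_false, ← dX]
    omega
  simp only [Ex.val, WordOp.eval, State.reg_setReg, Nat.reduceEqDiff, if_true, if_false, ← dX]
  refine Wp.assign_cons hh ?_ ?_
  · simp only [Ex.val, WordOp.eval, State.reg_setReg, Nat.reduceEqDiff, if_true, if_false, ← dk]
    omega
  simp only [Ex.val, WordOp.eval, State.reg_setReg, Nat.reduceEqDiff, if_true, if_false, ← dk]
  refine Wp.assign_cons hh ?_ ?_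
  · simp only [Ex.val, WordOp.eval, State.reg_setReg, Nat.reduceEqDiff, if_true, if_false, ← dN]
    omega
  simp only [Ex.val, WordOp.eval, State.reg_setReg, Nat.reduceEqDiff, if_true, if_false, ← dN]
  refine Wp.assign_cons hh ?_ ?_
  · simp only [Ex.val, WordOp.eval, State.reg_setReg, Nat.reduceEqDiff, if_true, if_false]
    omega
  simp only [Ex.val, WordOp.eval, State.reg_setReg, Nat.reduceEqDiff, if_true, if_false]
  refine Wp.put_cons hh ?_ ?_
  · simp only [Ex.val, State.reg_setReg, Nat.reduceEqDiff, if_true, if_false]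
    omega
  refine Wp.put_cons hh ?_ ?_
  · simp only [Ex.val, State.reg_setReg, State.reg_setMem, Nat.reduceEqDiff, if_true, if_false]
    omega
  refine Wp.assign_cons hh ?_ ?_
  · simp only [Ex.val]; omega
  refine Wp.nil ⟨⟨?_, ?_, ?_, ?_, ?_, ?_, ?_, ?_, ?_, ?_⟩, ?_, ?_, ?_, ?_, ?_⟩
  any_goals (simp [Ex.val, h9]; done)
  · intro i
    simp only [State.mem_setReg, State.mem_setMem, Nat.reduceEqDiff, if_false, h2]
    rfl
  · intro i
    simp only [State.mem_setReg, State.mem_setMem, State.reg_setReg, State.reg_setMem,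
      Nat.reduceEqDiff, if_true, if_false, Ex.val, Function.update_apply, h4 4 le_rfl,
      Instance.words, Instance.edgesTo]
    rcases i with _ | _ | _ | i <;> simp
  · intro A hA
    have h5 : A ≠ 4 := by omega
    simp [State.mem_setMem, h5, h4 A (by omega)]
  · intro r hr'
    have hne : ∀ q, q < 128 → r ≠ q := fun q hq => by omega
    simp [hne, hr r hr']

/-- Run the algorithm for kPMF on the digraph and determine the maximum from its output. -/
def askKPMF (prog : Program) : Program :=
  block [
    put 4 (.lit 2) (.bin .div (.bin .sub (.var 28) (.lit 3)) (.lit 2)),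
    assign 128 (.var 28),
    prog.shift 128 4,
    assign 30 (.bin .div (.var 128) (.lit 3)),
    assign 29 (.lit 0),
    loop 31 30 scanTriple]

/-- The output may list a triple repeatedly, so its length is bounded by the running time and not by
the number of pairs. In each triple the two nodes differ, so one of them is nonzero and its cell
must have been written, and different triples occupy different cells. -/
theorem length_output_le {w t : ℕ} {p : Program} {x : List ℕ} {f : State}
    (he : Exec w p (State.init x) t f) {L : List (ℕ × ℕ × ℕ)} (hL : ∀ e ∈ L, e.1 ≠ e.2.1)
    (hf : f.output = L.flatMap fun e => [e.1, e.2.1, e.2.2]) : L.length ≤ t := by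
  obtain ⟨C, hC, hCe⟩ := he.changed_cells 1
  have hlen : f.reg 0 = 3 * L.length := by
    have := congrArg List.length hf
    simpa [State.output, List.length_flatMap, mul_comm] using this
  have hcell : ∀ i < f.reg 0, f.mem 1 i =
      (L.flatMap fun e => [e.1, e.2.1, e.2.2]).getD i 0 := by
    intro i hi
    rw [← hf]
    simp [State.output, hi]
  have h0 : ∀ i ∉ C, f.mem 1 i = 0 := by
    intro i hi
    rw [hCe i hi]
    simp [State.init]
  have hsub : Finset.range L.length ⊆ C.image (· / 3) := by
    intro i hi
    rw [Finset.mem_range] at hi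
    obtain ⟨t1, t2, -⟩ := getD_flatMap_triple L hi
    rw [← hcell _ (by omega)] at t1 t2
    rw [Finset.mem_image]
    by_cases c1 : 3 * i ∈ C
    · exact ⟨_, c1, by omega⟩
    · by_cases c2 : 3 * i + 1 ∈ C
      · exact ⟨_, c2, by omega⟩
      · rw [h0 _ c1] at t1
        rw [h0 _ c2] at t2
        exact absurd (t1.symm.trans t2) (hL _ (List.getElem_mem hi))
  have := (Finset.card_le_card hsub).trans Finset.card_image_le
  rw [Finset.card_range] at this
  omega

theorem wp_askKPMF {h w t : ℕ} (hh : 2 ≤ h) (hw : w ≤ h) {S : Instance} {s : State} (H : S.Held s)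
    (hE : 2 * (S.nodes * S.X) + 3 < 2 ^ h)
    (h28 : s.reg 28 = (S.words (S.nodes * S.X)).length)
    (h4 : ∀ i, s.mem 4 i = (S.words (S.nodes * S.X)).getD i 0)
    (h5 : ∀ A, 5 ≤ A → s.mem A = fun _ => 0) (hr : ∀ r, 128 ≤ r → s.reg r = 0)
    {prog : Program} {y : List ℕ} (hc : Computes w prog (S.digraph.encode S.k) t y)
    (hy : S.digraph.IsKPMFOutput S.k y) :
    Wp h (askKPMF prog) (t * 111 + 40) s fun s' =>
      s'.reg 29 = maxCount S.vars S.ms ∧ s'.reg 9 = s.reg 9 := by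
  obtain ⟨f, he, hf⟩ := hc
  obtain ⟨L, hyL, hL⟩ := hy
  set L' : List (ℕ × ℕ × ℕ) := L.map fun e => ((e.1 : ℕ), (e.2.1 : ℕ), e.2.2) with hL'
  have hflat : f.output = L'.flatMap fun e => [e.1, e.2.1, e.2.2] := by
    rw [hf, hyL, hL', List.flatMap_map]
  have hlen : f.reg 0 = 3 * L'.length := by
    have := congrArg List.length hflat
    simpa [State.output, List.length_flatMap, mul_comm] using this
  have hLt : L'.length ≤ t := by
    refine length_output_le he ?_ hflat
    intro e he'
    rw [hL', List.mem_map] at he'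
    obtain ⟨⟨u, v, F⟩, hm, rfl⟩ := he'
    have := ((hL u v F).1 hm).1
    exact fun h => this (Fin.ext h)
  have hlt := S.length_edgesTo (S.nodes * S.X)
  have hwl := S.length_words (S.nodes * S.X)
  have hpow : 4 ≤ 2 ^ h := le_trans (by norm_num : 4 ≤ 2 ^ 2)
    (Nat.pow_le_pow_right (by norm_num) (by omega))
  refine Wp.weaken (T := 1 + 5 + 1 + (1 + 1 + (t + (3 + 1 + (1 + 1 + ((L'.length * 110 + 10) +
    1)))))) (by omega) (fun _ _ h => h) ?_
  refine Wp.put_cons hh ?_ ?_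
  · simp only [Ex.val, WordOp.eval, h28]; omega
  refine Wp.assign_cons hh ?_ ?_
  · simp only [Ex.val, State.reg_setMem, h28]; omega
  simp only [Ex.val, WordOp.eval, State.reg_setMem]
  set s1 := (s.setMem 4 2 ((s.reg 28 - 3) / 2)).setReg 128 (s.reg 28) with hs1
  have henc : S.digraph.encode S.k =
      S.nodes :: S.k :: S.edgeList.length :: S.edgeList.flatMap fun p => [p.1, p.2] :=
    S.encode_digraph S.k
  -- The subroutine's memory `0` is memory `4` and its register `0` is register `128`; all else in
  -- its range is still zero, so it starts exactly on the encoded digraph.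
  have hinit : State.embed 128 4 s1 (State.init (S.digraph.encode S.k)) = s1 := by
    have hreg : (State.embed 128 4 s1 (State.init (S.digraph.encode S.k))).reg = s1.reg := by
      funext r
      by_cases c : r < 128
      · simp [State.embed, c]
      · simp only [State.embed, c, if_false, State.init, hs1, State.reg_setReg, State.reg_setMem]
        by_cases c' : r = 128
        · subst c'
          rw [h28, hwl, henc]
          simp [Instance.edgeList, List.length_flatMap]
          ring
        · rw [if_neg (by omega), if_neg c', hr r (by omega)]
    have hmem : (State.embed 128 4 s1 (State.init (S.digraph.encode S.k))).mem = s1.mem := by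
      funext A i
      by_cases c : A < 4
      · simp [State.embed, c]
      · simp only [State.embed, c, if_false, State.init, hs1, State.mem_setReg]
        rw [State.mem_setMem]
        by_cases c' : A = 4
        · subst c'
          have : (S.words (S.nodes * S.X)).length - 3 = S.edgeList.length * 2 := by
            rw [hwl, Instance.edgeList]; omega
          rw [Nat.sub_self, if_pos rfl, if_pos rfl, Function.update_apply, henc, h28, h4, this]
          rcases i with _ | _ | _ | i <;> simp [Instance.words, Instance.edgeList]
        · rw [if_neg (by omega), if_neg c', h5 A (by omega)]
    cases hx : State.embed 128 4 s1 (State.init (S.digraph.encode S.k)) with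
    | mk reg mem =>
      rw [hx] at hreg hmem
      simp only at hreg hmem
      rw [hreg, hmem]
  refine Wp.small fun hsm1 => ?_
  have hfs : f.Small h := by
    refine he.small hw ⟨fun r => ?_, fun A i => ?_⟩
    · rw [← State.embed_reg 128 4 s1, hinit]; exact hsm1.1 _
    · rw [← State.embed_mem 128 4 s1, hinit]; exact hsm1.2 _ _
  have hes : (State.embed 128 4 s1 f).Small h := by
    refine ⟨fun r => ?_, fun A i => ?_⟩
    · simp only [State.embed]; split_ifs
      exacts [hsm1.1 _, hfs.1 _]
    · simp only [State.embed]; split_ifs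
      exacts [hsm1.2 _ _, hfs.2 _ _]
  refine Wp.cons (Wp.call he (by omega) hinit hes ?_)
  set s2 := State.embed 128 4 s1 f with hs2
  have r2 : ∀ r, r < 128 → s2.reg r = s.reg r := by
    intro r hr'
    have : r ≠ 128 := by omega
    simp [hs2, State.embed, hr', hs1, this]
  have r128 : s2.reg 128 = f.reg 0 := by simp [hs2, State.embed]
  have m5 : s2.mem 5 = f.mem 1 := by simp [hs2, State.embed]
  have H2 : S.Held s2 := by
    refine H.congr (fun r h1 h2 => r2 r (by omega)) ?_
    simp [hs2, State.embed, hs1, State.mem_setMem]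
  have hdiv : s2.reg 128 / 3 = L'.length := by rw [r128, hlen]; omega
  refine Wp.assign_cons hh ?_ ?_
  · simp only [Ex.val, WordOp.eval]
    exact (Nat.div_le_self _ _).trans_lt (hes.1 128)
  refine Wp.assign_cons hh ?_ ?_
  · simp [Ex.val]
  simp only [Ex.val, WordOp.eval, hdiv]
  refine Wp.cons (Wp.weaken le_rfl ?_ (wp_scan (L := L') hh (H2.congr ?_ ?_) ?_ ?_ ?_))
  · rintro s' - ⟨e29, -, er⟩
    refine Wp.nil ⟨?_, ?_⟩
    · rw [e29]; exact S.scan_eq_maxCount hL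
    · rw [er 9 (by decide)]
      simp [r2]
  · intro r h1 h2
    have c1 : r ≠ 30 := by omega
    have c2 : r ≠ 29 := by omega
    simp [c1, c2]
  · rfl
  · simp
  · simp
  · intro i hi
    rw [State.mem_setReg, State.mem_setReg, m5, ← hflat]
    rw [← hlen] at hi
    simp [State.output, hi]

/-- The answer of the program: the maximum number of satisfied clauses, or whether all clauses can
be satisfied. -/
def answer (dd : Bool) (n : ℕ) (ms : List ℕ) : ℕ :=
  if dd then (if maxCount n ms = ms.length then 1 else 0) else maxCount n ms

/-- The program that reduces the satisfiability problems to kPMF. -/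
def reduction (dd : Bool) (Q p : ℕ) (prog : Program) : Program :=
  block [
    readFormula dd,
    setParameters Q p,
    loop 20 19 emitEdge,
    askKPMF prog,
    put 1 (.lit 0) (if dd then .bin .eq (.var 29) (.var 9) else .var 29),
    assign 0 (.lit 1)]

/-- The time consists of reading the formula, testing every pair of a node and an inner node, and
the query. Scanning the output is charged to the query, whose time bounds the number of triples. -/
theorem computes_reduction {h w n t L Q p : ℕ} (hh : 2 ≤ h) (hw : w ≤ h) (hn : 2 * n < h)
    (hQ : 2 * Q + p + 4 ≤ 2 ^ h) (dd : Bool) {Cs : List (List ℕ)}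
    (hC : ∀ C ∈ Cs, C.length ≤ L ∧ ∀ l ∈ C, l < 2 * n)
    (hlen : (encodeWords n Cs).length < 2 ^ h) {S : Instance}
    (hS : S = splitInstance (keptMasks dd n Cs) n Q p)
    (hE : 2 * (S.nodes * S.X) + 3 < 2 ^ h)
    {prog : Program} {y : List ℕ} (hc : Computes w prog (S.digraph.encode S.k) t y)
    (hy : S.digraph.IsKPMFOutput S.k y) :
    ∃ t', t' ≤ Cs.length * (L * 32 + 81) + S.nodes * S.X * 180 + t * 111 + 200 ∧
      Computes (64 * h) (reduction dd Q p prog) (encodeWords n Cs) t'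
        [answer dd n (keptMasks dd n Cs)] := by
  have hpow : 4 ≤ 2 ^ h := by omega
  have hn' : 2 * n < 2 ^ h := hn.trans Nat.lt_two_pow_self
  have hlenL : Cs.length < 2 ^ h := by
    refine lt_of_le_of_lt ?_ hlen
    have : Cs.length ≤ (Cs.flatMap fun C => C.length :: C).length := by
      rw [List.length_flatMap]
      refine (le_of_eq ?_).trans (List.length_le_sum_of_one_le _ ?_)
      · simp
      · simp
    simp only [encodeWords, List.length_cons]; omega
  have hword : ∀ v ∈ encodeWords n Cs, v < 2 ^ h := by
    intro v hv
    simp only [encodeWords, List.mem_cons, List.mem_flatMap] at hv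
    rcases hv with rfl | rfl | ⟨C, hC1, rfl | hv⟩
    · omega
    · exact hlenL
    · refine lt_of_le_of_lt ?_ hlen
      have := (List.sublist_flatten_of_mem
        (List.mem_map_of_mem (f := fun C : List ℕ => C.length :: C) hC1)).length_le
      rw [← List.flatMap_def] at this
      simp only [encodeWords, List.length_cons] at this ⊢
      omega
    · exact ((hC C hC1).2 v hv).trans hn'
  have hclean : (State.init (encodeWords n Cs)).clean = State.init (encodeWords n Cs) := by
    simp only [State.clean, State.init, State.mk.injEq, and_true]
    funext r
    by_cases c : Ex.IsTemp r
    · have : r ≠ 0 := by rintro rfl; simp [Ex.IsTemp] at c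
      simp [this]
    · simp [c]
  have hsmall : (State.init (encodeWords n Cs)).Small h := by
    refine ⟨fun r => ?_, fun A i => ?_⟩
    · simp only [State.init]; split_ifs <;> omega
    · simp only [State.init]; split_ifs
      · rcases lt_or_ge i (encodeWords n Cs).length with hi | hi
        · rw [List.getD_eq_getElem _ _ hi]
          exact hword _ (List.getElem_mem hi)
        · rw [List.getD_eq_default _ _ hi]; omega
      · omega
  have key : Wp h (reduction dd Q p prog)
      ((Cs.length * (L * 32 + 81) + 50) + (70 + ((S.nodes * S.X * 180 + 10) +
        ((t * 111 + 40) + ((5 + 1) + (1 + 1 + 1))))))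
      (State.init (encodeWords n Cs)) fun s' =>
        s'.reg 0 = 1 ∧ s'.mem 1 0 = answer dd n (keptMasks dd n Cs) := by
    refine Wp.cons (Wp.weaken le_rfl ?_ (wp_readFormula hh hn.le dd hC hlen ?_ ?_))
    · rintro s1 hsm1 ⟨e1, e9, e2, e4, er⟩
      refine Wp.cons (Wp.weaken le_rfl ?_ (wp_setParameters (Q := Q) (p := p) hh (by omega) hQ
        (ms := keptMasks dd n Cs) ?_ e1 e9 e2 e4 er))
      · rintro s2 hsm2 ⟨H, f28, f9, f4, f5, fr⟩
        rw [← hS] at H f4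
        refine Wp.cons (Wp.weaken le_rfl ?_ (wp_emitEdges hh H hE f28 f4))
        rintro s3 hsm3 ⟨g28, g4, gm, gr⟩
        have H3 : S.Held s3 := by
          refine ⟨?_, ?_, ?_, ?_, ?_, ?_, ?_, ?_, ?_, fun i => by rw [gm 2 (by norm_num), H.m2]⟩ <;>
            rw [gr _ (by decide)]
          exacts [H.r11, H.r12, H.r13, H.r14, H.r15, H.r16, H.r17, H.r18, H.r19]
        refine Wp.cons (Wp.weaken le_rfl ?_ (wp_askKPMF hh hw H3 hE g28 g4 ?_ ?_ hc hy))
        · rintro s4 hsm4 ⟨k29, k9⟩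
          rw [gr 9 (by decide), f9] at k9
          have hvars : S.vars = n := by rw [hS, splitInstance_vars]
          have hms : S.ms = keptMasks dd n Cs := by rw [hS]; rfl
          rw [hvars, hms] at k29
          have hval : Ex.val s4 (if dd then Ex.bin .eq (.var 29) (.var 9) else .var 29) =
              answer dd n (keptMasks dd n Cs) := by
            cases dd <;> simp [Ex.val, answer, k29, k9, WordOp.eval]
          refine Wp.cons (Wp.weaken (T := 1 + (if dd then Ex.bin .eq (.var 29) (.var 9) else
            Ex.var 29).size + 1) (by cases dd <;> simp [Ex.size]) (fun _ _ h => h)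
            (Wp.put (by omega) 4 hpow (by decide) (by cases dd <;> decide) (by decide)
              (by cases dd <;> decide) ?_ ?_))
          · cases dd
            · exact hsm4.1 29
            · exact (Ex.val_eq_le _ _ _).trans_lt (by omega)
          rw [hval]
          refine Wp.assign_cons hh ?_ (Wp.nil ⟨?_, ?_⟩)
          · simp [Ex.val]; omega
          · simp [Ex.val]
          · simp [State.mem_setMem, Ex.val]
        · intro A hA
          rw [gm A (by omega), f5 A hA]
        · intro r hr
          rw [gr r (by simp; omega), fr r hr]
      · rw [← hS]; exact hE
    · exact fun _ _ => rfl
    · intro r hr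
      have : r ≠ 0 := by omega
      simp [State.init, this]
  obtain ⟨t', s', ht', he, -, h0, h1⟩ := key hsmall _ hclean
  refine ⟨t', by omega, s', he, ?_⟩
  have h0' : s'.reg 0 = 1 := by
    rw [← h0]; exact (State.clean_reg (by decide)).symm
  have h1' : s'.mem 1 0 = answer dd n (keptMasks dd n Cs) := h1
  simp [State.output, h0', h1']

end FineGrained

/-! ### Formulas, masks, and the number of distinct short clauses. -/

namespace FineGrained

/-! ### Clause masks and satisfaction -/

theorem testBit_clauseMask (n : ℕ) (C : List ℕ) (i : ℕ) :
    (clauseMask n C).testBit i = true ↔ ∃ l ∈ C, l / 2 + l % 2 * n = i := by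
  induction C using List.reverseRecOn with
  | nil => simp [clauseMask]
  | append_singleton C l ih =>
    have : clauseMask n (C ++ [l]) = clauseMask n C ||| 2 ^ (l / 2 + l % 2 * n) := by
      simp [clauseMask]
    rw [this, Nat.testBit_or, Bool.or_eq_true, ih, Nat.testBit_two_pow]
    constructor
    · rintro (⟨l', h, e⟩ | h)
      · exact ⟨l', by simp [h], e⟩
      · exact ⟨l, by simp, by simpa using h⟩
    · rintro ⟨l', h, e⟩
      rw [List.mem_append, List.mem_singleton] at h
      rcases h with h | rfl
      · exact .inl ⟨l', h, e⟩
      · exact .inr (by simpa using e)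

theorem and_ne_zero_iff (a b : ℕ) :
    a &&& b ≠ 0 ↔ ∃ i, a.testBit i = true ∧ b.testBit i = true := by
  constructor
  · intro h
    obtain ⟨i, hi⟩ := Nat.exists_testBit_of_ne_zero h
    exact ⟨i, by simpa using hi⟩
  · rintro ⟨i, hi⟩ h
    have := congrArg (fun c => Nat.testBit c i) h
    simp [hi] at this

namespace CNF

/-- The word that encodes a literal. -/
def literalWord {n : ℕ} (l : Fin n × Bool) : ℕ := 2 * (l.1 : ℕ) + l.2.toNat

/-- The clauses as lists of words. -/
def words (φ : CNF) : List (List ℕ) := φ.clauses.map (List.map literalWord)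

theorem encode_eq (φ : CNF) : φ.encode = encodeWords φ.n φ.words := by
  simp only [encode, encodeWords, words, m, List.length_map, List.flatMap_map]
  congr

theorem literalWord_lt {n : ℕ} (l : Fin n × Bool) : literalWord l < 2 * n := by
  have := l.1.2
  have := Bool.toNat_le l.2
  unfold literalWord; omega

theorem length_clause_le (φ : CNF) {C : List (Fin φ.n × Bool)} (hC : C ∈ φ.clauses) :
    C.length ≤ 2 * φ.n := by
  have := (φ.nodup C hC).length_le_card
  simpa [mul_comm] using this

/-- At the bit position of a literal, the assignment mask records its truth value, so a common bit
is a true literal of the clause. -/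
theorem clauseMask_and_partialMask {n x : ℕ} (hx : x < 2 ^ n) (C : List (Fin n × Bool)) :
    clauseMask n (C.map literalWord) &&& partialMask n 0 n x ≠ 0 ↔
      clauseSat (fun i => x.testBit i) C = true := by
  rw [and_ne_zero_iff, clauseSat, List.any_eq_true]
  have key (l : Fin n × Bool) :
      (partialMask n 0 n x).testBit (literalWord l / 2 + literalWord l % 2 * n) =
        (x.testBit l.1 == l.2) := by
    obtain ⟨i, b⟩ := l
    rw [testBit_partialMask hx (by omega)]
    cases b
    · simp [literalWord]
    · have h1 : (2 * (i : ℕ) + 1) / 2 = i := by omega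
      have h2 : (2 * (i : ℕ) + 1) % 2 = 1 := by omega
      simp [literalWord, h1, h2]
  constructor
  · rintro ⟨i, h1, h2⟩
    rw [testBit_clauseMask] at h1
    obtain ⟨l', h, rfl⟩ := h1
    obtain ⟨l, hl, rfl⟩ := List.mem_map.1 h
    exact ⟨l, hl, by rw [← key, h2]⟩
  · rintro ⟨l, hl, h⟩
    exact ⟨_, (testBit_clauseMask _ _ _).2 ⟨_, List.mem_map_of_mem hl, rfl⟩, by rw [key, h]⟩

theorem exists_testBit {n : ℕ} (a : Fin n → Bool) :
    ∃ x < 2 ^ n, (fun i : Fin n => x.testBit i) = a := by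
  refine ⟨Nat.ofBits a, Nat.ofBits_lt_two_pow a, ?_⟩
  funext i
  exact Nat.testBit_ofBits_lt a i i.2

theorem satCount_map (φ : CNF) {x : ℕ} (hx : x < 2 ^ φ.n) :
    satCount φ.n (φ.words.map (clauseMask φ.n)) x = φ.numSat fun i => x.testBit i := by
  rw [satCount, numSat, words, List.map_map, List.countP_map]
  refine List.countP_congr fun C _ => ?_
  simpa using clauseMask_and_partialMask hx C

theorem maxCount_map (φ : CNF) : maxCount φ.n (φ.words.map (clauseMask φ.n)) = φ.maxSat := by
  refine le_antisymm (Finset.sup_le fun x hx => ?_) (Finset.sup_le fun a _ => ?_)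
  · rw [satCount_map φ (Finset.mem_range.1 hx)]
    exact Finset.le_sup (f := φ.numSat) (Finset.mem_univ _)
  · obtain ⟨x, hx, rfl⟩ := exists_testBit a
    rw [← satCount_map φ hx]
    exact Finset.le_sup (f := satCount φ.n _) (Finset.mem_range.2 hx)

end CNF

theorem maxCount_eq_length_iff (n : ℕ) (ms : List ℕ) :
    maxCount n ms = ms.length ↔ ∃ x < 2 ^ n, ∀ c ∈ ms, c &&& partialMask n 0 n x ≠ 0 := by
  have hle (x : ℕ) : satCount n ms x ≤ ms.length := List.countP_le_length
  have hiff (x : ℕ) : satCount n ms x = ms.length ↔ ∀ c ∈ ms, c &&& partialMask n 0 n x ≠ 0 := by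
    rw [satCount, List.countP_eq_length]; simp
  constructor
  · intro h
    obtain ⟨x, hx, e⟩ := Finset.exists_mem_eq_sup (Finset.range (2 ^ n)) (by simp) (satCount n ms)
    exact ⟨x, Finset.mem_range.1 hx, (hiff x).1 (e.symm.trans h)⟩
  · rintro ⟨x, hx, h⟩
    refine le_antisymm (Finset.sup_le fun x _ => hle x) ?_
    rw [← (hiff x).2 h]
    exact Finset.le_sup (f := satCount n ms) (Finset.mem_range.2 hx)

theorem keptMasks_false (n : ℕ) (Cs : List (List ℕ)) :
    keptMasks false n Cs = Cs.map (clauseMask n) := by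
  induction Cs using List.reverseRecOn with
  | nil => rfl
  | append_singleton Cs C ih => rw [keptMasks_append, ih, keep]; simp

theorem mem_keptMasks_true (n : ℕ) (Cs : List (List ℕ)) (c : ℕ) :
    c ∈ keptMasks true n Cs ↔ c ∈ Cs.map (clauseMask n) := by
  induction Cs using List.reverseRecOn with
  | nil => rfl
  | append_singleton Cs C ih =>
    rw [keptMasks_append, keep, List.map_append, List.mem_append, ← ih]
    split_ifs with h
    · simp only [List.map_cons, List.map_nil, List.mem_singleton, iff_self_or]
      rintro rfl; exact h.2
    · simp

theorem nodup_keptMasks_true (n : ℕ) (Cs : List (List ℕ)) : (keptMasks true n Cs).Nodup := by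
  induction Cs using List.reverseRecOn with
  | nil => simp [keptMasks]
  | append_singleton Cs C ih =>
    rw [keptMasks_append, keep]
    split_ifs with h
    · exact ih
    · simp only [true_and] at h
      rw [List.nodup_append_comm]
      simp [ih, h]

theorem CNF.answer_false (φ : CNF) :
    answer false φ.n (keptMasks false φ.n φ.words) = φ.maxSat := by
  rw [keptMasks_false, answer]
  exact φ.maxCount_map

open Classical in
theorem CNF.answer_true (φ : CNF) :
    answer true φ.n (keptMasks true φ.n φ.words) = if φ.Satisfiable then 1 else 0 := by
  rw [answer, if_pos rfl]
  refine if_congr ?_ rfl rfl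
  rw [maxCount_eq_length_iff]
  have key {x : ℕ} (hx : x < 2 ^ φ.n) :
      (∀ c ∈ keptMasks true φ.n φ.words, c &&& partialMask φ.n 0 φ.n x ≠ 0) ↔
        ∀ C ∈ φ.clauses, clauseSat (fun i => x.testBit i) C = true := by
    simp only [mem_keptMasks_true, words, List.map_map, List.mem_map, Function.comp,
      forall_exists_index, and_imp, forall_apply_eq_imp_iff₂, clauseMask_and_partialMask hx]
  constructor
  · rintro ⟨x, hx, h⟩
    exact ⟨_, (key hx).1 h⟩
  · rintro ⟨a, h⟩
    obtain ⟨x, hx, rfl⟩ := exists_testBit a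
    exact ⟨x, hx, (key hx).2 h⟩

/-- The masks of the clauses with at most `q` literals. -/
def shortMasks (n : ℕ) : ℕ → Finset ℕ
  | 0 => {0}
  | q + 1 => shortMasks n q ∪
      (shortMasks n q ×ˢ Finset.range (2 * n)).image fun e => e.1 ||| 2 ^ (e.2 / 2 + e.2 % 2 * n)

theorem card_shortMasks_le (n q : ℕ) : (shortMasks n q).card ≤ (2 * n + 1) ^ q := by
  induction q with
  | zero => simp [shortMasks]
  | succ q ih =>
    calc _ ≤ (shortMasks n q).card + (shortMasks n q).card * (2 * n) :=
          (Finset.card_union_le _ _).trans (Nat.add_le_add_left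
            (Finset.card_image_le.trans (by simp [Finset.card_product])) _)
      _ = (shortMasks n q).card * (2 * n + 1) := by ring
      _ ≤ _ := by rw [pow_succ]; exact Nat.mul_le_mul_right _ ih

theorem shortMasks_mono (n : ℕ) : Monotone (shortMasks n) :=
  monotone_nat_of_le_succ fun _ => Finset.subset_union_left

theorem clauseMask_mem_shortMasks {n : ℕ} {C : List ℕ} (hC : ∀ l ∈ C, l < 2 * n) :
    clauseMask n C ∈ shortMasks n C.length := by
  induction C using List.reverseRecOn with
  | nil => simp [clauseMask, shortMasks]
  | append_singleton C l ih =>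
    have : clauseMask n (C ++ [l]) = clauseMask n C ||| 2 ^ (l / 2 + l % 2 * n) := by
      simp [clauseMask]
    rw [this, List.length_append, List.length_singleton, shortMasks]
    refine Finset.mem_union_right _ (Finset.mem_image.2 ⟨(clauseMask n C, l), ?_, rfl⟩)
    exact Finset.mem_product.2 ⟨ih fun l hl => hC l (by simp [hl]),
      Finset.mem_range.2 (hC l (by simp))⟩

/-- A clause of width at most `q` is built by at most `q` insertions among `2 n` literals, so for
fixed `q` there are only polynomially many masks. This makes sparsification unnecessary, because the
threshold tolerates polylogarithmic factors. -/
theorem CNF.length_keptMasks_true_le {φ : CNF} {q : ℕ} (hq : ∀ C ∈ φ.clauses, C.length ≤ q) :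
    (keptMasks true φ.n φ.words).length ≤ 2 ^ q * (φ.n + 1) ^ q := by
  rw [← List.toFinset_card_of_nodup (nodup_keptMasks_true _ _)]
  refine (Finset.card_le_card (t := shortMasks φ.n q) fun c hc => ?_).trans
    ((card_shortMasks_le _ _).trans ?_)
  · rw [List.mem_toFinset, mem_keptMasks_true, words, List.map_map, List.mem_map] at hc
    obtain ⟨C, hC, rfl⟩ := hc
    refine shortMasks_mono _ ?_ (clauseMask_mem_shortMasks fun l hl => ?_)
    · simpa using hq C hC
    · obtain ⟨l', -, rfl⟩ := List.mem_map.1 hl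
      exact literalWord_lt l'
  · rw [← mul_pow]
    exact Nat.pow_le_pow_left (by omega) _

end FineGrained

/-! ### Choice of parameters and running time. -/

namespace FineGrained

/-! ### Running times -/

theorem exists_pow_le_two_rpow (D : ℕ) {η : ℝ} (hη : 0 < η) :
    ∃ A : ℝ, 0 < A ∧ ∀ n : ℕ, ((n : ℝ) + 1) ^ D ≤ A * (2 : ℝ) ^ (η * n) := by
  have h1 : (1 : ℝ) < 2 ^ η := Real.one_lt_rpow (by norm_num) hη
  obtain ⟨A, hA, h⟩ := Asymptotics.bound_of_isBigO_nat_atTop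
    (isLittleO_pow_const_const_pow_of_one_lt (R := ℝ) D h1).isBigO
  refine ⟨A * 2 ^ η, by positivity, fun n => ?_⟩
  have := h (x := n + 1) (by positivity)
  rw [Real.norm_of_nonneg (by positivity), Real.norm_of_nonneg (by positivity), pow_succ,
    ← Real.rpow_mul_natCast (by norm_num)] at this
  push_cast at this
  linarith

/-- The base of the power is at least `1`. This allows `ε ≤ 1 / 2` to be assumed later. -/
theorem KPMFSolvable.mono {ε ε' c : ℝ} (h : ε' ≤ ε) (hc : 0 ≤ c) (hs : KPMFSolvable ε c) :
    KPMFSolvable ε' c := by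
  intro C D
  obtain ⟨p, d, K, H⟩ := hs C D
  -- Nothing forces `K` to be nonnegative.
  refine ⟨p, d, |K|, fun G k hn hk hkc hm => ?_⟩
  obtain ⟨t, y, h1, h2, h3⟩ := H G k hn hk hkc hm
  refine ⟨t, y, h1, h2, h3.trans ?_⟩
  have hn' : (1 : ℝ) ≤ G.n := by exact_mod_cast hn
  have hb : (1 : ℝ) ≤ (G.n : ℝ) ^ 2 * max (k : ℝ) ((G.n : ℝ) ^ c) :=
    one_le_mul_of_one_le_of_one_le (one_le_pow₀ hn')
      (le_max_of_le_right (Real.one_le_rpow hn' hc))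
  refine mul_le_mul (le_abs_self K) (Real.rpow_le_rpow_of_exponent_le hb (by linarith))
    (by positivity) (abs_nonneg K)

/-- `W` collects the polynomial factors and `2 ^ x` the exponential size of the node set; two
factors from `N ^ 2` and one from the maximum give `W ^ 3`. -/
theorem query_time_le {W N κ c ε x : ℝ} (hW : 1 ≤ W) (hN : 1 ≤ N) (hNW : N ≤ W * 2 ^ x)
    (hc : 0 ≤ c) (hc' : c ≤ 1) (hκ : κ ≤ W * 2 ^ (c * x)) (hε : 0 ≤ ε)
    (hε' : ε ≤ 1) :
    (N ^ 2 * max κ (N ^ c)) ^ (1 - ε) ≤ W ^ 3 * 2 ^ ((2 + c) * x * (1 - ε)) := by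
  have hN0 : 0 ≤ N := by linarith
  have hW0 : 0 ≤ W := by linarith
  have h2 : (0 : ℝ) < 2 ^ x := by positivity
  have hNc : N ^ c ≤ W * 2 ^ (c * x) := by
    calc N ^ c ≤ (W * 2 ^ x) ^ c := Real.rpow_le_rpow hN0 hNW hc
      _ = W ^ c * 2 ^ (c * x) := by
        rw [Real.mul_rpow hW0 h2.le, ← Real.rpow_mul (by norm_num), mul_comm x]
      _ ≤ W * 2 ^ (c * x) := by
        gcongr
        simpa using Real.rpow_le_rpow_of_exponent_le hW hc'
  have hbase : N ^ 2 * max κ (N ^ c) ≤ W ^ 3 * 2 ^ ((2 + c) * x) := by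
    calc N ^ 2 * max κ (N ^ c) ≤ (W * 2 ^ x) ^ 2 * (W * 2 ^ (c * x)) := by
          gcongr
          exact max_le hκ hNc
      _ = W ^ 3 * (2 ^ x * 2 ^ x * 2 ^ (c * x)) := by ring
      _ = _ := by
        rw [← Real.rpow_add (by norm_num), ← Real.rpow_add (by norm_num)]
        ring_nf
  calc _ ≤ (W ^ 3 * 2 ^ ((2 + c) * x)) ^ (1 - ε) :=
        Real.rpow_le_rpow (by positivity) hbase (by linarith)
    _ = (W ^ 3) ^ (1 - ε) * 2 ^ ((2 + c) * x * (1 - ε)) := by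
        rw [Real.mul_rpow (by positivity) (by positivity), ← Real.rpow_mul (by norm_num)]
    _ ≤ _ := by
        gcongr
        simpa using Real.rpow_le_rpow_of_exponent_le (one_le_pow₀ hW)
          (show 1 - ε ≤ 1 by linarith)

/-! ### The sizes in a split instance -/

section Sizes

variable (ms : List ℕ) (n : ℕ) {Q p : ℕ}

theorem splitInstance_k :
    (splitInstance ms n Q p).k = (ms.length + 1) * 2 ^ (p * (n / (2 * Q + p))) := rfl

theorem splitInstance_X :
    (splitInstance ms n Q p).X = 3 * (splitInstance ms n Q p).k := by
  simp only [Instance.X, Instance.k]; ring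

theorem splitInstance_a :
    (splitInstance ms n Q p).a = Q * (n / (2 * Q + p)) + n % (2 * Q + p) := by
  have h := Nat.div_add_mod n (2 * Q + p)
  have e : (2 * Q + p) * (n / (2 * Q + p)) = (Q + p) * (n / (2 * Q + p)) +
    Q * (n / (2 * Q + p)) := by ring
  simp only [splitInstance]
  omega

theorem two_pow_le_nodes :
    2 ^ (Q * (n / (2 * Q + p))) ≤ (splitInstance ms n Q p).nodes := by
  have h : 2 ^ (Q * (n / (2 * Q + p))) ≤ 2 ^ (splitInstance ms n Q p).a :=
    Nat.pow_le_pow_right (by norm_num) (by rw [splitInstance_a ms n]; omega)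
  refine h.trans ?_
  rw [Instance.nodes]
  exact (Nat.le_add_right _ _).trans (Nat.le_add_left _ _)

/-- The first group receives the remainder of the division and at least a third of the variables, so
the sources alone make `log N` linear in `n`. Hence polynomial factors in `n` are polylogarithmic in
the number of nodes. -/
theorem le_log_nodes (hp : p ≤ Q) :
    n + 1 ≤ 3 * (Nat.log 2 (splitInstance ms n Q p).nodes + 1) := by
  have h1 : 2 ^ (splitInstance ms n Q p).a ≤ (splitInstance ms n Q p).nodes := by
    rw [Instance.nodes]
    exact (Nat.le_add_right _ _).trans (Nat.le_add_left _ _)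
  have h2 := Nat.log_mono_right (b := 2) h1
  rw [Nat.log_pow (by norm_num), splitInstance_a ms n] at h2
  have h := Nat.div_add_mod n (2 * Q + p)
  have e : (2 * Q + p) * (n / (2 * Q + p)) = 2 * (Q * (n / (2 * Q + p))) +
    p * (n / (2 * Q + p)) := by ring
  have := Nat.mul_le_mul_right (n / (2 * Q + p)) hp
  omega

theorem nodes_le_mul_two_pow (hQ : 0 < Q) (hp : p ≤ Q) :
    (splitInstance ms n Q p).nodes ≤
      (4 + 2 ^ (2 * Q + p)) * (ms.length + 1) * 2 ^ (Q * (n / (2 * Q + p))) := by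
  set r := n / (2 * Q + p)
  have h1 : 2 ^ (p * r) ≤ 2 ^ (Q * r) :=
    Nat.pow_le_pow_right (by norm_num) (Nat.mul_le_mul_right _ hp)
  have h2 : 2 ^ (splitInstance ms n Q p).a ≤ 2 ^ (2 * Q + p) * 2 ^ (Q * r) := by
    rw [splitInstance_a ms n, pow_add, mul_comm]
    exact Nat.mul_le_mul_right _ (Nat.pow_le_pow_right (by norm_num)
      (Nat.mod_lt _ (by omega)).le)
  have h3 : 2 ^ (2 * Q + p) * 2 ^ (Q * r) ≤
      2 ^ (2 * Q + p) * 2 ^ (Q * r) * (ms.length + 1) := Nat.le_mul_of_pos_right _ (by omega)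
  have h4 := Nat.mul_le_mul_left (ms.length + 1) h1
  have h5 : (splitInstance ms n Q p).nodes = 3 * ((ms.length + 1) * 2 ^ (p * r)) +
      (2 ^ (splitInstance ms n Q p).a + (ms.length + 1) * 2 ^ (Q * r)) := by
    rw [Instance.nodes, splitInstance_X, splitInstance_k]; rfl
  rw [h5]
  linarith

/-- A bound on the number of bits of the sizes. -/
theorem splitInstance_bits {lam : ℕ} (hlam : (ms.length + 1) * 2 ^ n ≤ 2 ^ lam) :
    (splitInstance ms n Q p).X ≤ 2 ^ (lam + 2) ∧
      (splitInstance ms n Q p).nodes ≤ 2 ^ (lam + 3) := by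
  set S := splitInstance ms n Q p with hS
  have hv : S.a + S.b + S.g = n := splitInstance_vars ms n Q p
  have hpow {i : ℕ} (hi : i ≤ n) : 2 ^ i ≤ 2 ^ n := Nat.pow_le_pow_right (by norm_num) hi
  have hg := Nat.mul_le_mul_left (ms.length + 1) (hpow (i := S.g) (by omega))
  have hb := Nat.mul_le_mul_left (ms.length + 1) (hpow (i := S.b) (by omega))
  have ha := (hpow (i := S.a) (by omega)).trans
    (Nat.le_mul_of_pos_left (2 ^ n) (Nat.succ_pos ms.length))
  have eX : S.X = 3 * ((ms.length + 1) * 2 ^ S.g) := by rw [hS, splitInstance_X]; rfl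
  have eN : S.nodes = S.X + (2 ^ S.a + (ms.length + 1) * 2 ^ S.b) := rfl
  have e2 : 2 ^ (lam + 2) = 4 * 2 ^ lam := by ring
  have e3 : 2 ^ (lam + 3) = 8 * 2 ^ lam := by ring
  rw [e2, e3, eN, eX]
  constructor <;> linarith [Nat.two_pow_pos lam]

end Sizes

theorem Instance.length_edges_le (S : Instance) : S.digraph.m ≤ S.nodes * S.X := by
  have h : S.digraph.m = S.edgeList.length := by
    have := congrArg (fun l => l.getD 2 0) (S.encode_digraph 0)
    simpa [EdgeListDigraph.encode] using this
  rw [h]; exact S.length_edgesTo _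

end FineGrained

namespace FineGrained

/-! ### Solving satisfiability problems with an algorithm for kPMF -/

theorem CNF.length_encode_lt (φ : CNF) :
    φ.encode.length < 2 ^ (2 * (φ.n + Nat.log 2 φ.m + 1) + 3) := by
  have h1 : φ.encode.length ≤ 2 + φ.m * (2 * φ.n + 1) := by
    have : (φ.clauses.map fun C => C.length + 1).sum ≤ φ.m * (2 * φ.n + 1) := by
      refine (List.sum_le_card_nsmul _ (2 * φ.n + 1) fun x hx => ?_).trans (by simp [CNF.m])
      obtain ⟨C, hC, rfl⟩ := List.mem_map.1 hx
      have := φ.length_clause_le hC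
      omega
    simp only [encode, List.length_cons, List.length_flatMap, List.length_map]
    omega
  have h2 : φ.m < 2 ^ (Nat.log 2 φ.m + 1) := Nat.lt_pow_succ_log_self (by norm_num) _
  have h3 : φ.n < 2 ^ φ.n := Nat.lt_two_pow_self
  set P := 2 ^ (φ.n + Nat.log 2 φ.m + 1) with hP
  have h4 : φ.m ≤ P := h2.le.trans (Nat.pow_le_pow_right (by norm_num) (by omega))
  have h5 : φ.n + 1 ≤ P := Nat.succ_le_of_lt
    (h3.trans_le (Nat.pow_le_pow_right (by norm_num) (by omega)))
  have e : 2 ^ (2 * (φ.n + Nat.log 2 φ.m + 1) + 3) = 8 * P ^ 2 := by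
    rw [hP]; ring
  have h6 : φ.m * (2 * φ.n + 1) ≤ P * (2 * P) := Nat.mul_le_mul h4 (by omega)
  rw [e]
  nlinarith

theorem succ_mul_two_pow_le {l m n : ℕ} (h : l ≤ m) :
    (l + 1) * 2 ^ n ≤ 2 ^ (n + Nat.log 2 m + 1) := by
  have h2 : m < 2 ^ (Nat.log 2 m + 1) := Nat.lt_pow_succ_log_self (by norm_num) _
  calc (l + 1) * 2 ^ n ≤ 2 ^ (Nat.log 2 m + 1) * 2 ^ n := Nat.mul_le_mul_right _ (by omega)
    _ = _ := by rw [← pow_add]; congr 1; omega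

theorem two_pow_le_nodes_rpow (ms : List ℕ) (n : ℕ) {Q p : ℕ} {c : ℝ} (hc : 0 ≤ c)
    (hp : (p : ℝ) ≤ c * Q) :
    (2 : ℝ) ^ (p * (n / (2 * Q + p))) ≤ ((splitInstance ms n Q p).nodes : ℝ) ^ c := by
  have h : ((2 : ℝ) ^ (Q * (n / (2 * Q + p)))) ≤ (splitInstance ms n Q p).nodes := by
    exact_mod_cast two_pow_le_nodes ms n
  refine le_trans ?_ (Real.rpow_le_rpow (by positivity) h hc)
  rw [← Real.rpow_natCast_mul (by norm_num), ← Real.rpow_natCast]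
  refine Real.rpow_le_rpow_of_exponent_le (by norm_num) ?_
  push_cast
  have : (0 : ℝ) ≤ ((n / (2 * Q + p) : ℕ) : ℝ) := Nat.cast_nonneg _
  nlinarith

/-- Rounding `p` below `c Q` gives `2 ^ (p r) ≤ N ^ c`, and the number of slots goes into the
polylogarithmic factor. -/
theorem threshold_le (ms : List ℕ) {n B D Q p : ℕ} {c : ℝ} (hc : 0 ≤ c)
    (hpQ : p ≤ Q) (hp : (p : ℝ) ≤ c * Q) (hms : ms.length ≤ B * (n + 1) ^ D) :
    ((splitInstance ms n Q p).k : ℝ) ≤ ((3 * (B + 1) * 3 ^ D : ℕ) : ℝ) *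
      ((splitInstance ms n Q p).nodes : ℝ) ^ c *
      ((Nat.log 2 (splitInstance ms n Q p).nodes : ℝ) + 1) ^ D := by
  set N := (splitInstance ms n Q p).nodes with hN
  have h1 : (ms.length : ℝ) + 1 ≤ (B + 1) * (3 ^ D * ((Nat.log 2 N : ℝ) + 1) ^ D) := by
    rw [← mul_pow]
    have a1 : (n : ℝ) + 1 ≤ 3 * ((Nat.log 2 N : ℝ) + 1) := by
      exact_mod_cast le_log_nodes ms n hpQ
    have a2 : (ms.length : ℝ) ≤ B * ((n : ℝ) + 1) ^ D := by exact_mod_cast hms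
    have a3 : (1 : ℝ) ≤ ((n : ℝ) + 1) ^ D := one_le_pow₀ (by
      have : (0 : ℝ) ≤ n := Nat.cast_nonneg _
      linarith)
    calc _ ≤ ((B : ℝ) + 1) * ((n : ℝ) + 1) ^ D := by linarith
      _ ≤ _ := by gcongr
  have h2 := two_pow_le_nodes_rpow ms n hc hp
  rw [← hN] at h2
  rw [splitInstance_k]
  push_cast
  calc _ ≤ ((B : ℝ) + 1) * (3 ^ D * ((Nat.log 2 N : ℝ) + 1) ^ D) * (N : ℝ) ^ c := by gcongr
    -- The factor `3` is not needed here: the same constant must also cover the `3 k n` bound on the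
    -- number of edges.
    _ ≤ 3 * (((B : ℝ) + 1) * (3 ^ D * ((Nat.log 2 N : ℝ) + 1) ^ D) * (N : ℝ) ^ c) := by
        linarith [show (0 : ℝ) ≤ ((B : ℝ) + 1) * (3 ^ D * ((Nat.log 2 N : ℝ) + 1) ^ D) *
          (N : ℝ) ^ c by positivity]
    _ = _ := by ring

/-- Rounding `p` down costs at most one in `2 Q + p`; since `ε Q ≥ 1`, half of the saving `ε` pays
for it. The second exponent is that of the time to write the digraph, which has a saving of its own
because one of the two large groups is absent from it. -/
theorem split_exponents_le {ε c : ℝ} {Q p n : ℕ} (hε : 0 < ε) (hε' : ε ≤ 1 / 2)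
    (hQ : 1 ≤ ε * Q) (hpQ : p ≤ Q) (hcp : c * Q ≤ p + 1) :
    (2 + c) * ((Q * (n / (2 * Q + p)) : ℕ) : ℝ) * (1 - ε) ≤ (1 - ε / 2) * n ∧
      ((Q * (n / (2 * Q + p)) + p * (n / (2 * Q + p)) : ℕ) : ℝ) ≤ (1 - ε / 2) * n := by
  set r := n / (2 * Q + p)
  have hr : (2 * (Q : ℝ) + p) * r ≤ n := by exact_mod_cast Nat.mul_div_le n (2 * Q + p)
  have hr0 : (0 : ℝ) ≤ r := Nat.cast_nonneg _
  have hp0 : (0 : ℝ) ≤ p := Nat.cast_nonneg _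
  have hpQ' : (p : ℝ) ≤ Q := by exact_mod_cast hpQ
  push_cast
  constructor
  · have h1 : (2 * (Q : ℝ) + p + 1) * (1 - ε) ≤ (1 - ε / 2) * (2 * Q + p) := by
      nlinarith [mul_nonneg hε.le hp0]
    calc (2 + c) * ((Q : ℝ) * r) * (1 - ε) = ((2 * Q + c * Q) * (1 - ε)) * r := by ring
      _ ≤ ((2 * Q + p + 1) * (1 - ε)) * r :=
          mul_le_mul_of_nonneg_right
            (mul_le_mul_of_nonneg_right (by linarith) (by linarith)) hr0
      _ ≤ ((1 - ε / 2) * (2 * Q + p)) * r := by gcongr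
      _ = (1 - ε / 2) * ((2 * Q + p) * r) := by ring
      _ ≤ _ := by
          gcongr
          linarith
  · have h1 : (Q : ℝ) + p ≤ (1 - ε / 2) * (2 * Q + p) := by nlinarith
    calc (Q : ℝ) * r + p * r = (Q + p) * r := by ring
      _ ≤ ((1 - ε / 2) * (2 * Q + p)) * r := by gcongr
      _ = (1 - ε / 2) * ((2 * Q + p) * r) := by ring
      _ ≤ _ := by
          gcongr
          linarith

theorem nodes_mul_X_le (ms : List ℕ) (n : ℕ) {Q p : ℕ} (hQ : 0 < Q) (hp : p ≤ Q) :
    (splitInstance ms n Q p).nodes * (splitInstance ms n Q p).X ≤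
      3 * ((4 + 2 ^ (2 * Q + p)) * (ms.length + 1)) ^ 3 *
        2 ^ (Q * (n / (2 * Q + p)) + p * (n / (2 * Q + p))) := by
  set W := (4 + 2 ^ (2 * Q + p)) * (ms.length + 1) with hW
  have hMW : ms.length + 1 ≤ W := Nat.le_mul_of_pos_left _ (by positivity)
  have hW1 : 1 ≤ W := by omega
  calc _ ≤ (W * 2 ^ (Q * (n / (2 * Q + p)))) *
        (3 * (W * 2 ^ (p * (n / (2 * Q + p))))) := by
        rw [splitInstance_X, splitInstance_k]
        have := nodes_le_mul_two_pow ms n hQ hp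
        gcongr
    _ = 3 * (W ^ 2 * 1) * 2 ^ (Q * (n / (2 * Q + p)) + p * (n / (2 * Q + p))) := by ring
    _ ≤ 3 * (W ^ 2 * W) * 2 ^ (Q * (n / (2 * Q + p)) + p * (n / (2 * Q + p))) := by gcongr
    _ = _ := by ring

theorem total_time_le {K T t' t N L n m W E : ℝ} (hE : 1 ≤ E) (hW : 1 ≤ W) (hm : 0 ≤ m)
    (hn : 0 ≤ n) (hL : L = 2 * n)
    (h : t' ≤ m * (L * 32 + 81) + N * 180 + t * 111 + 200) (hN : N ≤ 3 * W ^ 3 * E)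
    (ht : t ≤ K * T) (hT : T ≤ W ^ 3 * E) (hK : 0 ≤ K) :
    t' ≤ (900 + 111 * K) * ((n + 1) * W ^ 3) * E * (m + 1) := by
  have hW3 : 1 ≤ W ^ 3 := one_le_pow₀ hW
  have h1 : 1 ≤ W ^ 3 * E := one_le_mul_of_one_le_of_one_le hW3 hE
  have h2 : t ≤ K * (W ^ 3 * E) := ht.trans (mul_le_mul_of_nonneg_left hT hK)
  set V := W ^ 3 * E
  have e : (900 + 111 * K) * ((n + 1) * W ^ 3) * E * (m + 1) =
    (900 + 111 * K) * ((n + 1) * (m + 1) * V) := by simp only [V]; ring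
  have h3 : m * (L * 32 + 81) ≤ 81 * ((n + 1) * (m + 1) * V) := by
    have : (n + 1) * (m + 1) * 1 ≤ (n + 1) * (m + 1) * V := by gcongr
    rw [hL]; nlinarith [mul_nonneg hm hn]
  have h4 : V ≤ (n + 1) * (m + 1) * V := by
    have : 1 ≤ (n + 1) * (m + 1) := by nlinarith [mul_nonneg hm hn]
    nlinarith
  have h5 := mul_le_mul_of_nonneg_left h4 hK
  rw [e]
  nlinarith


/-- One program covers both problems: the hypothesis on the kept masks is all that is needed to
treat the number of slots as polynomial. Of the saving `ε / 2` in the exponent, `ε / 4` absorbs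
these polynomial factors. -/
theorem exists_program {ε c : ℝ} (hε : 0 < ε) (hε' : ε ≤ 1 / 2) (hc : 0 ≤ c) (hc' : c ≤ 1)
    (hs : KPMFSolvable ε c) (dd : Bool) (B D : ℕ) :
    ∃ (P : Program) (H : ℕ) (K : ℝ), 0 ≤ K ∧ ∀ φ : CNF,
      (keptMasks dd φ.n φ.words).length ≤ B * (φ.n + 1) ^ D →
      ∃ t : ℕ, Computes (H * (φ.n + Nat.log 2 φ.m + 1)) P φ.encode t
          [answer dd φ.n (keptMasks dd φ.n φ.words)] ∧
        (t : ℝ) ≤ K * (2 : ℝ) ^ ((1 - ε / 4) * (φ.n : ℝ)) * ((φ.m : ℝ) + 1) := by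
  -- `Q` depends only on `ε`, and `p` below only on `c` and `Q`, so both are constants in the
  -- program text.
  obtain ⟨Q, hQε⟩ := exists_nat_ge (1 / ε)
  have hQ : 1 ≤ ε * Q := by
    rw [div_le_iff₀ hε] at hQε; linarith
  have hQ0 : 0 < Q := by
    rcases Nat.eq_zero_or_pos Q with rfl | h
    · norm_num at hQ
    · exact h
  obtain ⟨p, hp, hcp⟩ : ∃ p : ℕ, (p : ℝ) ≤ c * Q ∧ c * Q ≤ p + 1 :=
    ⟨⌊c * Q⌋₊, Nat.floor_le (by positivity), (Nat.lt_floor_add_one _).le⟩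
  have hpQ : p ≤ Q := by
    have : (p : ℝ) ≤ Q := hp.trans (mul_le_of_le_one_left (Nat.cast_nonneg _) hc')
    exact_mod_cast this
  obtain ⟨prog, d, K, hK⟩ := hs (3 * (B + 1) * 3 ^ D) D
  obtain ⟨A, hA0, hA⟩ := exists_pow_le_two_rpow (3 * D + 1) (show 0 < ε / 4 by linarith)
  set C₁ := 4 + 2 ^ (2 * Q + p) with hC₁
  refine ⟨reduction dd Q p prog, 64 * (9 + 5 * d + 2 * Q + p),
    (900 + 111 * |K|) * ((C₁ : ℝ) * (B + 1)) ^ 3 * A, by positivity, fun φ hφ => ?_⟩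
  set ms := keptMasks dd φ.n φ.words with hms
  set S := splitInstance ms φ.n Q p with hS
  set lam := φ.n + Nat.log 2 φ.m + 1 with hlam
  have hmsm : ms.length ≤ φ.m := (length_keptMasks_le _ _ _).trans (by simp [CNF.words, CNF.m])
  obtain ⟨hX, hN⟩ := splitInstance_bits (Q := Q) (p := p) ms φ.n
    (succ_mul_two_pow_le (n := φ.n) hmsm)
  rw [← hS, ← hlam] at hX hN
  have hN1 : 1 ≤ S.nodes := S.X_pos.trans_le S.X_le_nodes
  have hk1 : 1 ≤ S.k := Nat.mul_pos S.M_pos (Nat.two_pow_pos _)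
  have hdn : S.digraph.n = S.nodes := rfl
  obtain ⟨t, y, hcomp, hy, ht⟩ := hK S.digraph S.k hN1 hk1
    (threshold_le ms hc hpQ hp hφ) (by
      refine S.length_edges_le.trans ?_
      have : S.X = 3 * S.k := splitInstance_X ms φ.n
      rw [this, hdn, mul_comm]
      refine Nat.mul_le_mul_right _ (Nat.mul_le_mul_right _ ?_)
      rw [mul_assoc]
      exact Nat.le_mul_of_pos_right _ (by positivity))
  rw [hdn] at hcomp ht
  -- All sizes are below powers of two with exponent linear in `lam`. The summand `5 * d` provides
  -- the subroutine's words, since `log N ≤ lam + 3`; the summands `2 * Q + p` let the literals fit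
  -- even for small formulas.
  set h := (9 + 5 * d + 2 * Q + p) * lam with hh
  have hlam1 : 1 ≤ lam := by omega
  have hge : 2 * lam + 7 + 5 * d * lam + 2 * Q + p ≤ h := by
    rw [hh]; nlinarith [Nat.zero_le (2 * Q + p)]
  have hpow {i : ℕ} (hi : i ≤ h) : 2 ^ i ≤ 2 ^ h := Nat.pow_le_pow_right (by norm_num) hi
  have hw : d * (Nat.log 2 S.nodes + 1) ≤ h := by
    have h1 := Nat.log_mono_right (b := 2) hN
    rw [Nat.log_pow (by norm_num)] at h1
    have : d * (Nat.log 2 S.nodes + 1) ≤ d * (5 * lam) := Nat.mul_le_mul_left _ (by omega)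
    have e : d * (5 * lam) = 5 * d * lam := by ring
    omega
  obtain ⟨t', ht', hcomp'⟩ := computes_reduction (L := 2 * φ.n) (Cs := φ.words) (by omega) hw
    (by omega) (by
      have h1 : 2 * Q + p + 7 < 2 ^ (2 * Q + p + 7) := Nat.lt_two_pow_self
      have h2 := hpow (i := 2 * Q + p + 7) (by omega)
      omega) dd (fun C hC => by
      obtain ⟨C', hC', rfl⟩ := List.mem_map.1 hC
      refine ⟨by simpa using φ.length_clause_le hC', fun l hl => ?_⟩
      obtain ⟨l', -, rfl⟩ := List.mem_map.1 hl
      exact CNF.literalWord_lt l') (by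
      rw [← CNF.encode_eq]
      exact φ.length_encode_lt.trans_le (hpow (by omega))) hS (by
      have h1 := hpow (i := 2 * lam + 7) (by omega)
      have h2 : S.nodes * S.X ≤ 2 ^ (lam + 3) * 2 ^ (lam + 2) := Nat.mul_le_mul hN hX
      have h3 : 2 ^ (lam + 3) * 2 ^ (lam + 2) = 2 ^ (2 * lam + 5) := by
        rw [← pow_add]; congr 1; omega
      have h4 : 2 ^ (2 * lam + 7) = 4 * 2 ^ (2 * lam + 5) := by ring
      have h5 : 2 ^ 2 ≤ 2 ^ (2 * lam + 5) := Nat.pow_le_pow_right (by norm_num) (by omega)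
      omega) hcomp hy
  refine ⟨t', ?_, ?_⟩
  · rw [CNF.encode_eq, mul_assoc, ← hh]
    exact hcomp'
  set W : ℝ := (C₁ : ℝ) * (ms.length + 1) with hW
  set E : ℝ := 2 ^ ((1 - ε / 2) * (φ.n : ℝ)) with hE
  obtain ⟨x1, x2⟩ := split_exponents_le (n := φ.n) hε hε' hQ hpQ hcp
  have hW1 : 1 ≤ W := by
    have : 1 ≤ C₁ * (ms.length + 1) := Nat.mul_pos (by positivity) (by positivity)
    rw [hW]; exact_mod_cast this
  have hE1 : 1 ≤ E := Real.one_le_rpow (by norm_num)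
    (mul_nonneg (by linarith) (Nat.cast_nonneg _))
  have hNX : ((S.nodes * S.X : ℕ) : ℝ) ≤ 3 * W ^ 3 * E := by
    have h1 : ((S.nodes * S.X : ℕ) : ℝ) ≤ 3 * W ^ 3 *
        2 ^ (Q * (φ.n / (2 * Q + p)) + p * (φ.n / (2 * Q + p))) := by
      rw [hW]; exact_mod_cast nodes_mul_X_le ms φ.n hQ0 hpQ
    refine h1.trans ?_
    have := Real.rpow_le_rpow_of_exponent_le (x := 2) (by norm_num) x2
    rw [Real.rpow_natCast] at this
    gcongr
  have hT : ((S.nodes : ℝ) ^ 2 * max (S.k : ℝ) ((S.nodes : ℝ) ^ c)) ^ (1 - ε) ≤ W ^ 3 * E := by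
    refine (query_time_le (x := ((Q * (φ.n / (2 * Q + p)) : ℕ) : ℝ)) hW1 (by exact_mod_cast hN1)
      ?_ hc hc' ?_ hε.le (by linarith)).trans ?_
    · rw [hW, Real.rpow_natCast]
      exact_mod_cast nodes_le_mul_two_pow ms φ.n hQ0 hpQ
    · rw [hS, splitInstance_k, hW]
      push_cast
      have h1 : (2 : ℝ) ^ (p * (φ.n / (2 * Q + p))) ≤
          2 ^ (c * ((Q : ℝ) * ((φ.n / (2 * Q + p) : ℕ) : ℝ))) := by
        rw [← Real.rpow_natCast]
        refine Real.rpow_le_rpow_of_exponent_le (by norm_num) ?_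
        push_cast
        have : (0 : ℝ) ≤ ((φ.n / (2 * Q + p) : ℕ) : ℝ) := Nat.cast_nonneg _
        nlinarith
      have h2 : (1 : ℝ) ≤ C₁ := by
        have : 1 ≤ C₁ := Nat.one_le_iff_ne_zero.2 (by positivity)
        exact_mod_cast this
      have h3 : (ms.length : ℝ) + 1 ≤ C₁ * (ms.length + 1) :=
        le_mul_of_one_le_left (by positivity) h2
      gcongr
    · have := Real.rpow_le_rpow_of_exponent_le (x := 2) (by norm_num) x1
      gcongr
  have key := total_time_le (K := |K|) (t' := t') (t := t) (N := (S.nodes * S.X : ℕ))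
    (L := (2 * φ.n : ℕ)) (n := φ.n) (m := φ.m) hE1 hW1 (Nat.cast_nonneg _) (Nat.cast_nonneg _)
    (by push_cast; ring)
    (by
      have e : φ.words.length = φ.m := by simp [CNF.words, CNF.m]
      rw [e] at ht'
      exact_mod_cast ht') hNX
    (ht.trans (mul_le_mul_of_nonneg_right (le_abs_self K) (by positivity))) hT (abs_nonneg K)
  refine key.trans ?_
  have hWle : W ≤ C₁ * (B + 1) * ((φ.n : ℝ) + 1) ^ D := by
    have a2 : (ms.length : ℝ) ≤ B * ((φ.n : ℝ) + 1) ^ D := by exact_mod_cast hφ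
    have a3 : (1 : ℝ) ≤ ((φ.n : ℝ) + 1) ^ D := one_le_pow₀ (by
      have : (0 : ℝ) ≤ φ.n := Nat.cast_nonneg _
      linarith)
    rw [hW, mul_assoc]
    refine mul_le_mul_of_nonneg_left ?_ (Nat.cast_nonneg _)
    linarith
  have hpoly : ((φ.n : ℝ) + 1) * W ^ 3 ≤ ((C₁ : ℝ) * (B + 1)) ^ 3 * (A * 2 ^ (ε / 4 * φ.n)) := by
    calc ((φ.n : ℝ) + 1) * W ^ 3 ≤
          ((φ.n : ℝ) + 1) * (C₁ * (B + 1) * ((φ.n : ℝ) + 1) ^ D) ^ 3 := by gcongr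
      _ = ((C₁ : ℝ) * (B + 1)) ^ 3 * ((φ.n : ℝ) + 1) ^ (3 * D + 1) := by ring
      _ ≤ _ := mul_le_mul_of_nonneg_left (hA φ.n) (by positivity)
  have hexp : (2 : ℝ) ^ ((1 - ε / 4) * (φ.n : ℝ)) = 2 ^ (ε / 4 * (φ.n : ℝ)) * E := by
    rw [hE, ← Real.rpow_add (by norm_num)]; congr 1; ring
  calc (900 + 111 * |K|) * (((φ.n : ℝ) + 1) * W ^ 3) * E * ((φ.m : ℝ) + 1) ≤
        (900 + 111 * |K|) * (((C₁ : ℝ) * (B + 1)) ^ 3 * (A * 2 ^ (ε / 4 * φ.n))) * E *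
          ((φ.m : ℝ) + 1) := by gcongr
    _ = _ := by rw [hexp]; ring

/-- The factor `m + 1` is at most `(B + 1) (n + 1)`, which costs another `ε / 8` in the exponent;
likewise `log m ≤ B n` keeps the words linear in `n`. -/
theorem maxCNFSATSolvable_of_kPMFSolvable {ε c : ℝ} (hε : 0 < ε) (hε' : ε ≤ 1 / 2) (hc : 0 ≤ c)
    (hc' : c ≤ 1) (hs : KPMFSolvable ε c) : MaxCNFSATSolvable (ε / 8) := by
  intro B
  obtain ⟨P, H, K, hK0, hK⟩ := exists_program hε hε' hc hc' hs false B 1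
  obtain ⟨A, hA0, hA⟩ := exists_pow_le_two_rpow 1 (show 0 < ε / 8 by linarith)
  refine ⟨P, H * (B + 1), K * ((B + 1) * A), fun φ hφ => ?_⟩
  obtain ⟨t, ⟨s, hs, ho⟩, ht⟩ := hK φ (by
    refine (length_keptMasks_le _ _ _).trans ?_
    rw [CNF.words, List.length_map, pow_one]
    exact hφ.trans (Nat.mul_le_mul_left _ (Nat.le_succ _)))
  refine ⟨t, ⟨s, hs.mono ?_, ho.trans (by rw [φ.answer_false])⟩, ht.trans ?_⟩
  · rw [mul_assoc]
    refine Nat.mul_le_mul_left _ ?_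
    have h1 : Nat.log 2 φ.m ≤ φ.m := Nat.log_le_self _ _
    nlinarith
  · have h1 : ((φ.m : ℝ) + 1) ≤ (B + 1) * (A * 2 ^ (ε / 8 * (φ.n : ℝ))) := by
      have h2 : (φ.m : ℝ) ≤ B * φ.n := by exact_mod_cast hφ
      have h3 := hA φ.n
      rw [pow_one] at h3
      have h4 : (0 : ℝ) ≤ φ.n := Nat.cast_nonneg _
      have h5 : (0 : ℝ) ≤ B := Nat.cast_nonneg _
      calc (φ.m : ℝ) + 1 ≤ (B + 1) * ((φ.n : ℝ) + 1) := by nlinarith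
        _ ≤ _ := by gcongr
    have hexp : (2 : ℝ) ^ ((1 - ε / 8) * (φ.n : ℝ)) =
        2 ^ ((1 - ε / 4) * (φ.n : ℝ)) * 2 ^ (ε / 8 * (φ.n : ℝ)) := by
      rw [← Real.rpow_add (by norm_num)]; congr 1; ring
    calc _ ≤ K * 2 ^ ((1 - ε / 4) * (φ.n : ℝ)) * ((B + 1) * (A * 2 ^ (ε / 8 * (φ.n : ℝ)))) := by
          gcongr
      _ = _ := by rw [hexp]; ring

/-- Removing duplicates bounds the slots by a polynomial in `n` of degree `q`, while the original
number of clauses enters the time only linearly. -/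
theorem kSATSolvable_of_kPMFSolvable {ε c : ℝ} (hε : 0 < ε) (hε' : ε ≤ 1 / 2) (hc : 0 ≤ c)
    (hc' : c ≤ 1) (hs : KPMFSolvable ε c) (q : ℕ) : KSATSolvable q (ε / 8) := by
  obtain ⟨P, H, K, hK0, hK⟩ := exists_program hε hε' hc hc' hs true (2 ^ q) q
  refine ⟨P, H, 1, K, fun φ hφ => ?_⟩
  obtain ⟨t, ht, ht'⟩ := hK φ (CNF.length_keptMasks_true_le hφ)
  refine ⟨t, by rwa [φ.answer_true] at ht, ht'.trans ?_⟩
  rw [pow_one]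
  have : (2 : ℝ) ^ ((1 - ε / 4) * (φ.n : ℝ)) ≤ 2 ^ ((1 - ε / 8) * (φ.n : ℝ)) :=
    Real.rpow_le_rpow_of_exponent_le (by norm_num)
      (mul_le_mul_of_nonneg_right (by linarith) (Nat.cast_nonneg _))
  gcongr

end FineGrained

theorem theorem6 (ε : ℝ) (hε : 0 < ε) :
    ∃ δ : ℝ, 0 < δ ∧ ∀ c : ℝ, 0 ≤ c → c ≤ 1 → FineGrained.KPMFSolvable ε c →
      FineGrained.MaxCNFSATSolvable δ ∧ ¬ FineGrained.SETH := by
  have h0 : 0 < min ε (1 / 2) := lt_min hε (by norm_num)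
  have h1 : min ε (1 / 2) ≤ 1 / 2 := min_le_right _ _
  -- This value depends on `ε` alone; `c`, `B` and `q` affect only the programs and the constants in
  -- front.
  refine ⟨min ε (1 / 2) / 8, by linarith, fun c hc hc' hs => ?_⟩
  have hs' := hs.mono (min_le_left ε (1 / 2)) hc
  refine ⟨FineGrained.maxCNFSATSolvable_of_kPMFSolvable h0 h1 hc hc' hs', fun hseth => ?_⟩
  obtain ⟨q, -, hq⟩ := hseth (min ε (1 / 2) / 8) (by linarith)
  exact hq (FineGrained.kSATSolvable_of_kPMFSolvable h0 h1 hc hc' hs' q)
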